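/- Let $0<\alpha<1$, let $k\ge 0$ be a fixed integer and put $H=\frac{1-\alpha}{2}\in(0,\frac12)$. Consider the following particle system on $\mathbb R$. At time $0$ each interval $[j,j+1)$, $j\in\mathbb Z$, contains exactly $k$ particles, at the positions given by a random vector $\rho^j=(\rho^j_1,\dots,\rho^j_k)$ with values in $[j,j+1)^k$ (of arbitrary law, possibly deterministic and possibly depending on $j$), and the vectors $\rho^j$, $j\in\mathbb Z$, are independent. The particles then move independently of each other, and independently of their initial positions, along standard symmetric $\alpha$-stable Lévy processes (with characteristic function $e^{-t|u|^\alpha}$ at time $t$). Let $N_1$ be the empirical (counting) measure of the particles at time $1$ and for $T>0$ put $$\langle Z_T,\varphi\rangle=\frac{\langle N_1,\varphi(\tfrac{\cdot}{T})\rangle-E\langle N_1,\varphi(\tfrac{\cdot}{T})\rangle}{\sqrt{T^{1-\alpha}}}.$$ For $\varphi$ in the Schwartz space $\mathcal S$ of real rapidly decreasing smooth functions on $\mathbb R$, and for the indicator functions in (b), $\langle N_1,\varphi(\frac\cdot T)\rangle$ is almost surely defined and integrable, and $Z_T$ is a random element of the space $\mathcal S'$ of (real) tempered distributions, taken with its strong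 dual topology. (a) As $T\to\infty$, $Z_T$ converges in law in $\mathcal S'$ to a centered Gaussian $\mathcal S'$-valued random variable $Z$ with covariance $$E\langle Z,\varphi\rangle\langle Z,\psi\rangle=\frac{k}{\pi}\int_{\mathbb R}\hat\varphi(x)\overline{\hat\psi(x)}\,|x|^\alpha\,dx,\qquad \varphi,\psi\in\mathcal S,$$ where $\hat\varphi(x)=\int_{\mathbb R}e^{ixy}\varphi(y)\,dy$. (b) Let $(\psi_t)_{t\ge0}$ be one of the three families $\psi_t=1_{[0,t]}$; $\psi_t=1_{[0,t]}-1_{[-t,0]}$; $\psi_t=1_{[-t,t]}$. Then there is a constant $K\ge0$, depending only on $\alpha$, $k$ and the family, with $K>0$ if $k\ge1$, such that, as $T\to\infty$, the finite-dimensional distributions of $(\langle Z_T,\psi_t\rangle)_{t\ge0}$ converge weakly to those of $(K\vartheta^H_t)_{t\ge0}$, where $\vartheta^H$ is the centered Gaussian process with covariance $E\vartheta^H_s\vartheta^H_t$ equal, respectively, to - $\frac12\left(s^{2H}+t^{2H}-|t-s|^{2H}\right)$ (fractional Brownian motion) if $\psi_t=1_{[0,t]}$; - $(1-H)\left(s^{2H}+t^{2H}-\frac12\left((s+t)^{2H}+|t-s|^{2H}\right)\right)$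 (sub-fractional Brownian motion) if $\psi_t=1_{[0,t]}-1_{[-t,0]}$; - $(s+t)^{2H}-|t-s|^{2H}$ (the process $\eta^H$) if $\psi_t=1_{[-t,t]}$. -/

import Mathlib

open MeasureTheory ProbabilityTheory Filter Topology
open scoped NNReal SchwartzMap

/-! ### Stable Lévy motion and the particle system -/

/-- `X` is a standard symmetric `α`-stable Lévy process under `P`: it starts at `0`, has
independent increments, `X t - X s` has characteristic function `u ↦ exp (-(t - s) |u| ^ α)`
for `s ≤ t`, and almost every path is right-continuous with left limits. -/
structure IsStableLevy {Ω : Type*} [MeasurableSpace Ω] (α : ℝ) (X : ℝ≥0 → Ω → ℝ)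
    (P : Measure Ω) : Prop where
  measurable : ∀ t, Measurable (X t)
  zero : ∀ᵐ ω ∂P, X 0 ω = 0
  indep : HasIndepIncrements X P
  charFun_increment : ∀ s t : ℝ≥0, s ≤ t → ∀ u : ℝ,
    charFun (P.map (fun ω => X t ω - X s ω)) u
      = ((Real.exp (-(((t : ℝ) - (s : ℝ)) * |u| ^ α)) : ℝ) : ℂ)
  cadlag : ∀ᵐ ω ∂P, ∀ t : ℝ≥0,
    ContinuousWithinAt (fun r => X r ω) (Set.Ici t) t ∧
      ∃ l : ℝ, Tendsto (fun r => X r ω) (𝓝[<] t) (𝓝 l)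

/-- A system of particles on the line with exactly `k` particles starting in each interval
`[j, j + 1)`. The positions `ρ j 0, …, ρ j (k - 1)` inside one interval may have any joint law
(possibly degenerate, possibly depending on `j`); the position vectors of different intervals are
independent. The particles move along standard symmetric `α`-stable Lévy processes `ϑ j n`,
independent of each other and of the initial positions. -/
structure StableParticleSystem {Ω : Type*} [MeasurableSpace Ω] (α : ℝ) (k : ℕ)
    (P : Measure Ω) where
  /-- initial position of the `n`-th particle of the interval `[j, j + 1)` -/
  ρ : ℤ → Fin k → Ω → ℝ
  /-- displacement process of the `n`-th particle of the interval `[j, j + 1)` -/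
  ϑ : ℤ → Fin k → ℝ≥0 → Ω → ℝ
  measurable_ρ : ∀ j n, Measurable (ρ j n)
  ρ_mem : ∀ (j : ℤ) (n : Fin k) (ω : Ω), ρ j n ω ∈ Set.Ico (j : ℝ) ((j : ℝ) + 1)
  indep_ρ : iIndepFun (fun (j : ℤ) (ω : Ω) (n : Fin k) => ρ j n ω) P
  levy : ∀ j n, IsStableLevy α (ϑ j n) P
  indep_ϑ : iIndepFun (fun (p : ℤ × Fin k) (ω : Ω) (t : ℝ≥0) => ϑ p.1 p.2 t ω) P
  indep_ρ_ϑ : IndepFun (fun (ω : Ω) (p : ℤ × Fin k) => ρ p.1 p.2 ω)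
    (fun (ω : Ω) (p : ℤ × Fin k) (t : ℝ≥0) => ϑ p.1 p.2 t ω) P

namespace StableParticleSystem

variable {Ω : Type*} [MeasurableSpace Ω] {α : ℝ} {k : ℕ} {P : Measure Ω}

/-- The empirical (counting) measure `N_t` of the particles at time `t`. -/
noncomputable def N (S : StableParticleSystem α k P) (t : ℝ≥0) (ω : Ω) : Measure ℝ :=
  Measure.sum fun p : ℤ × Fin k => Measure.dirac (S.ρ p.1 p.2 ω + S.ϑ p.1 p.2 t ω)

/-- The pairing `⟨N_1, f(· / T)⟩`. -/
noncomputable def pairing (S : StableParticleSystem α k P) (T : ℝ) (f : ℝ → ℝ) (ω : Ω) : ℝ :=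
  ∫ x, f (x / T) ∂(S.N 1 ω)

/-- The normalized fluctuation
`⟨Z_T, f⟩ = (⟨N_1, f(· / T)⟩ - E ⟨N_1, f(· / T)⟩) / √(T ^ (1 - α))`. -/
noncomputable def fluct (S : StableParticleSystem α k P) (T : ℝ) (f : ℝ → ℝ) (ω : Ω) : ℝ :=
  (S.pairing T f ω - ∫ ω', S.pairing T f ω' ∂P) / √(T ^ (1 - α))

end StableParticleSystem

/-! ### Random tempered distributions -/

/-- The space `𝒮'` of real tempered distributions on the line, the topological dual of the space
of real Schwartz functions. Its topology is the strong dual topology, that is, uniform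
convergence on bounded subsets of the Schwartz space. -/
abbrev RealTemperedDistribution : Type := 𝓢(ℝ, ℝ) →L[ℝ] ℝ

/-- `𝒮'` carries its Borel σ-algebra. -/
noncomputable instance instMeasurableSpaceRealTempered :
    MeasurableSpace RealTemperedDistribution := borel _

instance instBorelSpaceRealTempered : BorelSpace RealTemperedDistribution := ⟨rfl⟩

/-- The Fourier transform in the normalization `φ̂(x) = ∫ exp(i x y) φ(y) dy`. -/
noncomputable def fourierHat (φ : ℝ → ℝ) (x : ℝ) : ℂ :=
  ∫ y : ℝ, Complex.exp (Complex.I * (x : ℂ) * (y : ℂ)) * (φ y : ℂ)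

/-- `ν` is the law of a centered Gaussian `𝒮'`-valued random variable `Z` with covariance
`E ⟨Z, φ⟩ ⟨Z, ψ⟩ = (k / π) ∫ φ̂(x) conj(ψ̂(x)) |x| ^ α dx`. -/
structure IsLimitFieldLaw (α : ℝ) (k : ℕ) (ν : Measure RealTemperedDistribution) : Prop where
  gaussian : ∀ φ : 𝓢(ℝ, ℝ), ∃ v : ℝ≥0,
    ν.map (fun L : RealTemperedDistribution => L φ) = gaussianReal 0 v
  covariance : ∀ φ ψ : 𝓢(ℝ, ℝ),
    ((∫ L : RealTemperedDistribution, L φ * L ψ ∂ν : ℝ) : ℂ)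
      = ((k : ℂ) / (Real.pi : ℂ)) *
        ∫ x : ℝ, fourierHat φ x * (starRingEnd ℂ) (fourierHat ψ x) * ((|x| ^ α : ℝ) : ℂ)

/-! ### The three families of windows and their limit processes -/

/-- The three families of indicator test functions. -/
inductive WindowFamily
  | oneSided
  | odd
  | symmetric

/-- `ψ_t = 1_[0,t]`, `ψ_t = 1_[0,t] - 1_[-t,0]`, `ψ_t = 1_[-t,t]`, respectively. -/
noncomputable def WindowFamily.ψ (w : WindowFamily) (t : ℝ≥0) (x : ℝ) : ℝ :=
  match w with
  | .oneSided => (Set.Icc (0 : ℝ) t).indicator 1 x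
  | .odd => (Set.Icc (0 : ℝ) t).indicator 1 x - (Set.Icc (-(t : ℝ)) 0).indicator 1 x
  | .symmetric => (Set.Icc (-(t : ℝ)) t).indicator 1 x

/-- The covariance functions, respectively, of the fractional Brownian motion, of the
sub-fractional Brownian motion, and of the odd part `η^H` of the fractional Brownian motion. -/
noncomputable def WindowFamily.cov (w : WindowFamily) (H : ℝ) (s t : ℝ≥0) : ℝ :=
  match w with
  | .oneSided => 1 / 2 * ((s : ℝ) ^ (2 * H) + (t : ℝ) ^ (2 * H) - |(t : ℝ) - s| ^ (2 * H))
  | .odd => (1 - H) * ((s : ℝ) ^ (2 * H) + (t : ℝ) ^ (2 * H)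
      - 1 / 2 * (((s : ℝ) + t) ^ (2 * H) + |(t : ℝ) - s| ^ (2 * H)))
  | .symmetric => ((s : ℝ) + t) ^ (2 * H) - |(t : ℝ) - s| ^ (2 * H)

/-- `X` is a centered Gaussian process with covariance function `C`. -/
structure IsCenteredGaussianProcess {Ω : Type*} [MeasurableSpace Ω] (X : ℝ≥0 → Ω → ℝ)
    (C : ℝ≥0 → ℝ≥0 → ℝ) (Q : Measure Ω) : Prop where
  gaussian : IsGaussianProcess X Q
  centered : ∀ t, ∫ ω, X t ω ∂Q = 0
  covariance : ∀ s t, ∫ ω, X s ω * X t ω ∂Q = C s t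

/-- As `T → ∞`, the processes `Y T` converge to the process `X` in the sense of weak convergence
of all finite-dimensional distributions. -/
def TendstoFiniteDimensional {Ω Ω' : Type*} [MeasurableSpace Ω] [MeasurableSpace Ω']
    (Y : Set.Ioi (0 : ℝ) → ℝ≥0 → Ω → ℝ) (X : ℝ≥0 → Ω' → ℝ)
    (P : Measure Ω) [IsProbabilityMeasure P] (Q : Measure Ω') [IsProbabilityMeasure Q] : Prop :=
  ∀ I : Finset ℝ≥0,
    TendstoInDistribution (fun (T : Set.Ioi (0 : ℝ)) (ω : Ω) (t : I) => Y T t ω) atTop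
      (fun (ω : Ω') (t : I) => X t ω) (fun _ => P) Q

/-!
All test functions that matter, Schwartz functions as well as the indicator functions of the three
families, are *windows*: integrable functions of bounded variation (`IsWindow`). The proof has a
central limit theorem for the fluctuation of a single window at its core and derives both parts
from it by linearity.

**One window.** The contributions to `⟨N_1, f(· / T)⟩` of the particles started in different
intervals `[j, j + 1)` are independent, and divided by `√(T ^ (1 - α))` they are uniformly small.
Hence the characteristic function of the fluctuation is close to that of a Gaussian variable with
the same variance (`norm_integral_exp_hasSum_sub_le`). For the variance, the law of the positions
inside an interval is irrelevant: moving a particle inside its interval costs at most the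
oscillation of the (averaged) window there, and these oscillations sum up to the variation of the
window, which does not depend on `T` while the variance grows like `T ^ (1 - α)`
(`StableParticleSystem.exists_hasSum_variance_block`). This replaces the initial positions by `k`
times Lebesgue measure, for which Plancherel's identity (`IsWindow.integral_variance`) yields
`k / (2 π) ∫ |f̂(v)|² T ^ α (1 - exp (-2 |v / T| ^ α)) dv`, converging by dominated convergence to
`limitVar α k f = k / π ∫ |f̂(v)|² |v| ^ α dv`. The outcome is
`StableParticleSystem.tendsto_integral_exp_fluct`.

**Finite-dimensional distributions.** By the Cramér–Wold device and Lévy's continuity theorem it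
suffices to identify the limit variance of linear combinations of the `ψ_t`. It is the squared norm
of `√(k / π) |v| ^ (α / 2) f̂(v)` in `L²`, and for indicator functions the inner products
are combinations of integrals `∫ (1 - cos (x v)) |v| ^ (α - 2) dv`, which are proportional to
`|x| ^ (1 - α) = |x| ^ (2 H)` by scaling (`WindowFamily.inner_spectralMap_window`). The limit
processes exist since a Hilbert space carries an isonormal Gaussian process (`exists_isonormal`).

**Convergence in `𝒮'`.** The field is transported from a Hilbert space. There are vectors
`evalKernel y` of `L²`, of norm `O(1 / (1 + y²))` and with a derivative of the same order, and a
continuous linear map `schwartzVector` from Schwartz functions to `L²`, such that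
`φ y = ⟨evalKernel y, schwartzVector φ⟩`. So `Z_T` is the image of the fluctuation of the
`L²`-valued sum of `evalKernel` over the particles (`StableParticleSystem.vectorFluct`) under the
continuous linear map `toTempered` from `L²` to the strong dual. The coordinate of that random
vector along `g` is the fluctuation of the window `y ↦ ⟨evalKernel y, g⟩`, so its characteristic
function converges, and the decay of the kernel makes the second moments of the coordinates along
an orthonormal basis summable uniformly in `T` (`summable_sq_integral_abs_inner`). In a Hilbert
space these two facts imply convergence in distribution (`tendstoInDistribution_hilbert`); the limit
vector is constructed as a random series (`exists_gaussian_vector`).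
-/

/-! ### Integrable functions of bounded variation -/

/-- An integrable function of bounded variation on the line. The variation is encoded by a monotone
control function `G` with values in `[0, V]` whose increments dominate those of `f`. -/
structure IsWindow (f : ℝ → ℝ) (V : ℝ) : Prop where
  integrable : Integrable f
  exists_control : ∃ G : ℝ → ℝ, Monotone G ∧ (∀ x, 0 ≤ G x ∧ G x ≤ V) ∧
    ∀ x y, x ≤ y → |f y - f x| ≤ G y - G x

namespace IsWindow

variable {f g : ℝ → ℝ} {V W : ℝ}

lemma nonneg (hf : IsWindow f V) : 0 ≤ V := by
  obtain ⟨G, -, hG, -⟩ := hf.exists_control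
  exact (hG 0).1.trans (hG 0).2

lemma measurable (hf : IsWindow f V) : Measurable f := by
  obtain ⟨G, hm, -, hG⟩ := hf.exists_control
  have h : Monotone (fun x => f x + G x) := fun x y hxy => by
    have := (abs_le.1 (hG x y hxy)).1
    simp only
    linarith
  have h2 : f = (fun x => f x + G x) - G := by ext x; simp
  rw [h2]
  exact h.measurable.sub hm.measurable

lemma abs_sub_le (hf : IsWindow f V) (x y : ℝ) : |f y - f x| ≤ V := by
  obtain ⟨G, -, hb, hG⟩ := hf.exists_control
  rcases le_total x y with h | h
  · linarith [hG x y h, (hb x).1, (hb y).2]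
  · rw [abs_sub_comm]
    linarith [hG y x h, (hb y).1, (hb x).2]

/-- A window is bounded by its variation, as an integrable function on the line cannot stay away
from zero. -/
lemma abs_le (hf : IsWindow f V) (x : ℝ) : |f x| ≤ V := by
  by_contra! h
  have h1 : Integrable (fun _ : ℝ => |f x| - V) := by
    refine hf.integrable.abs.mono' (by fun_prop) (ae_of_all _ fun y => ?_)
    rw [Real.norm_eq_abs, abs_of_pos (by linarith)]
    have h2 := hf.abs_sub_le y x
    have h3 := abs_sub_abs_le_abs_sub (f x) (f y)
    linarith
  have h2 := (integrable_const_iff.1 h1)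
  rcases h2 with h2 | h2
  · linarith
  · have := h2.measure_univ_lt_top
    simp at this

lemma add (hf : IsWindow f V) (hg : IsWindow g W) : IsWindow (fun x => f x + g x) (V + W) := by
  obtain ⟨G, hm, hb, hG⟩ := hf.exists_control
  obtain ⟨G', hm', hb', hG'⟩ := hg.exists_control
  refine ⟨hf.integrable.add hg.integrable, fun x => G x + G' x, hm.add hm', fun x =>
    ⟨by linarith [(hb x).1, (hb' x).1], by linarith [(hb x).2, (hb' x).2]⟩, fun x y hxy => ?_⟩
  have h1 := hG x y hxy
  have h2 := hG' x y hxy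
  have h3 := abs_add_le (f y - f x) (g y - g x)
  rw [show f y + g y - (f x + g x) = (f y - f x) + (g y - g x) by ring]
  linarith

lemma const_mul (hf : IsWindow f V) (c : ℝ) : IsWindow (fun x => c * f x) (|c| * V) := by
  obtain ⟨G, hm, hb, hG⟩ := hf.exists_control
  refine ⟨hf.integrable.const_mul c, fun x => |c| * G x, hm.const_mul (abs_nonneg c), fun x =>
    ⟨mul_nonneg (abs_nonneg c) (hb x).1, mul_le_mul_of_nonneg_left (hb x).2 (abs_nonneg c)⟩,
    fun x y hxy => ?_⟩
  rw [← mul_sub, abs_mul, ← mul_sub]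
  gcongr
  exact hG x y hxy

lemma zero : IsWindow (fun _ => (0 : ℝ)) 0 :=
  ⟨integrable_zero _ _ _, fun _ => 0, monotone_const, fun _ => by simp, fun _ _ _ => by simp⟩

lemma sub (hf : IsWindow f V) (hg : IsWindow g W) : IsWindow (fun x => f x - g x) (V + W) := by
  simpa [sub_eq_add_neg] using hf.add (hg.const_mul (-1))

lemma comp_div (hf : IsWindow f V) {T : ℝ} (hT : 0 < T) : IsWindow (fun x => f (x / T)) V := by
  obtain ⟨G, hm, hb, hG⟩ := hf.exists_control
  exact ⟨hf.integrable.comp_div hT.ne', fun x => G (x / T),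
    fun x y hxy => hm (by gcongr), fun x => hb _, fun x y hxy => hG _ _ (by gcongr)⟩

lemma indicator_Icc (a b : ℝ) : IsWindow ((Set.Icc a b).indicator 1) 2 := by
  refine ⟨?_, fun x => (Set.Ici a).indicator 1 x + (Set.Ioi b).indicator 1 x, ?_, fun x => ?_,
    fun x y hxy => ?_⟩
  · rw [integrable_indicator_iff measurableSet_Icc]
    exact (integrableOn_const (C := (1 : ℝ)) (by simp) (by simp))
  · intro x y hxy
    simp only [Set.indicator_apply, Set.mem_Ici, Set.mem_Ioi, Pi.one_apply]
    split_ifs <;> linarith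
  · simp only [Set.indicator_apply, Set.mem_Ici, Set.mem_Ioi, Pi.one_apply]
    constructor <;> split_ifs <;> norm_num
  · simp only [Set.indicator_apply, Set.mem_Ici, Set.mem_Ioi, Set.mem_Icc, Pi.one_apply]
    rw [_root_.abs_le]
    constructor <;> split_ifs <;> first | linarith | grind

/-- A function with an integrable weak derivative has bounded variation. -/
lemma of_weak_deriv {h : ℝ → ℝ} (hf : Integrable f) (hh : Integrable h)
    (hfh : ∀ x y, x ≤ y → f y - f x = ∫ u in x..y, h u) :
    IsWindow f (∫ u, |h u|) := by
  refine ⟨hf, fun x => ∫ u in Set.Iic x, |h u|, ?_, fun x => ⟨?_, ?_⟩, fun x y hxy => ?_⟩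
  · intro x y hxy
    exact setIntegral_mono_set hh.abs.integrableOn (ae_of_all _ fun _ => abs_nonneg _)
      (Set.Iic_subset_Iic.2 hxy).eventuallyLE
  · exact setIntegral_nonneg measurableSet_Iic fun _ _ => abs_nonneg _
  · exact setIntegral_le_integral hh.abs (ae_of_all _ fun _ => abs_nonneg _)
  · rw [hfh x y hxy, intervalIntegral.integral_Iic_sub_Iic hh.abs.integrableOn
      hh.abs.integrableOn]
    exact intervalIntegral.abs_integral_le_integral_abs hxy

/-- Translation by `h` moves a window by at most `V |h|` in `L¹`. -/
lemma integral_abs_translate_le (hf : IsWindow f V) (h : ℝ) :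
    ∫ x, |f (x + h) - f x| ≤ |h| * V := by
  have key : ∀ (h : ℝ), 0 ≤ h → ∫ x, |f (x + h) - f x| ≤ h * V := by
    intro h hh
    obtain ⟨G, hm, hb, hG⟩ := hf.exists_control
    have hi : Integrable (fun x => |f (x + h) - f x|) :=
      ((hf.integrable.comp_add_right h).sub hf.integrable).abs
    have hGi : ∀ a b, IntervalIntegrable G volume a b := fun a b => hm.intervalIntegrable
    have hGi' : ∀ a b, IntervalIntegrable (fun x => G (x + h)) volume a b := fun a b =>
      (hm.comp (monotone_id.add_const h)).intervalIntegrable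
    have hlim := intervalIntegral_tendsto_integral hi tendsto_neg_atTop_atBot tendsto_id
    refine le_of_tendsto hlim ((eventually_ge_atTop 0).mono fun r hr => ?_)
    simp only [id]
    calc ∫ x in (-r)..r, |f (x + h) - f x|
        ≤ ∫ x in (-r)..r, (G (x + h) - G x) := by
          refine intervalIntegral.integral_mono_on (by linarith) hi.intervalIntegrable ?_
            fun x _ => hG _ _ (by linarith)
          exact (hGi' _ _).sub (hGi _ _)
      _ = (∫ x in r..(r + h), G x) - ∫ x in (-r)..(-r + h), G x := by
          rw [intervalIntegral.integral_sub (hGi' _ _) (hGi _ _),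
            intervalIntegral.integral_comp_add_right]
          rw [← intervalIntegral.integral_add_adjacent_intervals (hGi (-r + h) r) (hGi r (r + h)),
            ← intervalIntegral.integral_add_adjacent_intervals (hGi (-r) (-r + h))
              (hGi (-r + h) r)]
          ring
      _ ≤ (∫ x in r..(r + h), V) - ∫ x in (-r)..(-r + h), (0 : ℝ) := by
          gcongr
          · exact intervalIntegral.integral_mono_on (by linarith) (hGi _ _) (by simp)
              fun x _ => (hb x).2
          · exact intervalIntegral.integral_mono_on (by linarith) (by simp) (hGi _ _)
              fun x _ => (hb x).1
      _ = h * V := by simp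
  rcases le_total 0 h with hh | hh
  · rw [abs_of_nonneg hh]
    exact key h hh
  · rw [abs_of_nonpos hh]
    have := key (-h) (by linarith)
    rw [← integral_add_right_eq_self _ h] at this
    simpa [abs_sub_comm] using this

end IsWindow

/-! ### The Fourier transform of a window -/

lemma norm_fourierHat_le (f : ℝ → ℝ) (v : ℝ) : ‖fourierHat f v‖ ≤ ∫ x, |f x| := by
  refine (norm_integral_le_integral_norm _).trans (le_of_eq ?_)
  congr 1 with x
  rw [norm_mul, mul_assoc, ← Complex.ofReal_mul, mul_comm Complex.I,
    Complex.norm_exp_ofReal_mul_I, one_mul, Complex.norm_real, Real.norm_eq_abs]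

lemma integrable_fourierHat_integrand {f : ℝ → ℝ} (hf : Integrable f) (v : ℝ) :
    Integrable fun y : ℝ => Complex.exp (Complex.I * (v : ℂ) * (y : ℂ)) * (f y : ℂ) := by
  refine hf.norm.mono' (Continuous.aestronglyMeasurable (by fun_prop) |>.mul
    hf.ofReal.aestronglyMeasurable) (ae_of_all _ fun x => ?_)
  rw [norm_mul, mul_assoc, ← Complex.ofReal_mul, mul_comm Complex.I,
    Complex.norm_exp_ofReal_mul_I, one_mul, Complex.norm_real]

lemma fourierHat_add {f g : ℝ → ℝ} (hf : Integrable f) (hg : Integrable g) (v : ℝ) :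
    fourierHat (fun x => f x + g x) v = fourierHat f v + fourierHat g v := by
  rw [fourierHat, fourierHat, fourierHat, ← integral_add (integrable_fourierHat_integrand hf v)
    (integrable_fourierHat_integrand hg v)]
  simp only [Complex.ofReal_add, mul_add]

lemma fourierHat_const_mul (c : ℝ) (f : ℝ → ℝ) (v : ℝ) :
    fourierHat (fun x => c * f x) v = c * fourierHat f v := by
  rw [fourierHat, fourierHat, ← integral_const_mul]
  congr 1 with x
  push_cast
  ring

lemma fourierHat_neg (f : ℝ → ℝ) (v : ℝ) :
    fourierHat f (-v) = (starRingEnd ℂ) (fourierHat f v) := by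
  rw [fourierHat, fourierHat, ← integral_conj]
  congr 1 with x
  simp [← Complex.exp_conj]

/-- Scaling: `f(· / T)` has Fourier transform `T f̂(T ·)`. -/
lemma fourierHat_comp_div (f : ℝ → ℝ) {T : ℝ} (hT : 0 < T) (v : ℝ) :
    fourierHat (fun x => f (x / T)) v = T * fourierHat f (T * v) := by
  have h := Measure.integral_comp_div (fun y : ℝ =>
    Complex.exp (Complex.I * ((T * v : ℝ) : ℂ) * (y : ℂ)) * (f y : ℂ)) T
  rw [abs_of_pos hT, Complex.real_smul] at h
  rw [fourierHat, fourierHat, ← h]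
  congr 1 with x
  have : (T : ℂ) ≠ 0 := by exact_mod_cast hT.ne'
  congr 2
  push_cast
  field_simp

lemma fourierHat_eq_fourier (f : ℝ → ℝ) (v : ℝ) :
    fourierHat f v = FourierTransform.fourier (fun x => (f x : ℂ)) (-v / (2 * Real.pi)) := by
  rw [Real.fourier_eq', fourierHat]
  congr 1 with x
  rw [smul_eq_mul]
  congr 2
  have : (Real.pi : ℂ) ≠ 0 := by exact_mod_cast Real.pi_ne_zero
  simp only [RCLike.inner_apply, conj_trivial]
  push_cast
  field_simp

lemma continuous_fourierHat {f : ℝ → ℝ} (hf : Integrable f) : Continuous (fourierHat f) := by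
  have h : fourierHat f = fun v =>
      FourierTransform.fourier (fun x => (f x : ℂ)) (-v / (2 * Real.pi)) := by
    ext v; exact fourierHat_eq_fourier f v
  rw [h]
  have := VectorFourier.fourierIntegral_continuous Real.continuous_fourierChar
    (L := innerₗ ℝ) (by exact continuous_inner) hf.ofReal (𝕜 := ℝ) (E := ℂ)
  exact this.comp (by fun_prop)

namespace IsWindow

variable {f g : ℝ → ℝ} {V W : ℝ}

/-- Decay of the Fourier transform, by comparison with the translate by half a period. -/
lemma abs_mul_norm_fourierHat_le (hf : IsWindow f V) (v : ℝ) : |v| * ‖fourierHat f v‖ ≤ 2 * V := by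
  rcases eq_or_ne v 0 with rfl | hv
  · simpa using hf.nonneg
  have hvC : (v : ℂ) ≠ 0 := by exact_mod_cast hv
  have h1 : fourierHat f v = - ∫ y : ℝ, Complex.exp (Complex.I * (v : ℂ) * (y : ℂ))
      * (f (y + Real.pi / v) : ℂ) := by
    rw [fourierHat, ← integral_add_right_eq_self _ (Real.pi / v), ← integral_neg]
    congr 1 with y
    have : Complex.I * (v : ℂ) * ((y + Real.pi / v : ℝ) : ℂ)
        = Complex.I * v * y + Real.pi * Complex.I := by
      push_cast; field_simp
    rw [this, Complex.exp_add, Complex.exp_pi_mul_I]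
    ring
  have h2 : 2 * fourierHat f v = -∫ y : ℝ, Complex.exp (Complex.I * (v : ℂ) * (y : ℂ))
      * ((f (y + Real.pi / v) - f y : ℝ) : ℂ) := by
    have h3 : (2 : ℂ) * fourierHat f v = fourierHat f v + fourierHat f v := by ring
    rw [h3]
    nth_rw 2 [h1]
    rw [fourierHat, ← sub_eq_add_neg,
      ← integral_sub (integrable_fourierHat_integrand hf.integrable v)
      (integrable_fourierHat_integrand (hf.integrable.comp_add_right _) v), ← integral_neg]
    congr 1 with y
    push_cast
    ring
  have h3 : ‖2 * fourierHat f v‖ ≤ |Real.pi / v| * V := by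
    rw [h2, norm_neg]
    exact (norm_fourierHat_le (fun y => f (y + Real.pi / v) - f y) v).trans
      (hf.integral_abs_translate_le _)
  rw [norm_mul, abs_div, abs_of_pos Real.pi_pos] at h3
  have hv' : 0 < |v| := abs_pos.2 hv
  have h4 : |v| * ‖(2 : ℂ)‖ * ‖fourierHat f v‖ ≤ Real.pi * V := by
    calc |v| * ‖(2 : ℂ)‖ * ‖fourierHat f v‖ = |v| * (‖(2 : ℂ)‖ * ‖fourierHat f v‖) := by ring
      _ ≤ |v| * (Real.pi / |v| * V) := by gcongr
      _ = Real.pi * V := by field_simp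
  have h5 : Real.pi * V ≤ 4 * V := mul_le_mul_of_nonneg_right Real.pi_le_four hf.nonneg
  simp only [Complex.norm_ofNat] at h4
  linarith

lemma sq_norm_fourierHat_le (hf : IsWindow f V) (v : ℝ) :
    ‖fourierHat f v‖ ^ 2 ≤ ((∫ x, |f x|) ^ 2 + (2 * V) ^ 2) * (1 + v ^ 2)⁻¹ := by
  rw [← div_eq_mul_inv, le_div_iff₀ (by positivity), mul_add, mul_one]
  have h1 := norm_fourierHat_le f v
  have h2 := hf.abs_mul_norm_fourierHat_le v
  have h3 : ‖fourierHat f v‖ ^ 2 * v ^ 2 = (|v| * ‖fourierHat f v‖) ^ 2 := by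
    rw [mul_pow, sq_abs, mul_comm]
  rw [h3]
  gcongr

lemma integrable_sq_norm_fourierHat (hf : IsWindow f V) :
    Integrable fun v => ‖fourierHat f v‖ ^ 2 :=
  (integrable_inv_one_add_sq.const_mul _).mono'
    ((continuous_fourierHat hf.integrable).norm.pow 2).aestronglyMeasurable
    (ae_of_all _ fun v => by
      rw [Real.norm_eq_abs, abs_of_nonneg (by positivity)]
      exact hf.sq_norm_fourierHat_le v)

end IsWindow

lemma integrable_inv_one_add_sq_mul_rpow {α : ℝ} (hα₀ : 0 < α) (hα₁ : α < 1) :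
    Integrable fun v : ℝ => (1 + v ^ 2)⁻¹ * |v| ^ α := by
  have h := integrable_rpow_neg_one_add_norm_sq (E := ℝ) (r := 2 - α) (μ := volume)
    (by simp; linarith)
  refine h.mono' ?_ (ae_of_all _ fun v => ?_)
  · exact (Measurable.aestronglyMeasurable (by fun_prop))
  · rw [Real.norm_eq_abs, abs_of_nonneg (by positivity), Real.norm_eq_abs, sq_abs]
    have h1 : |v| ^ α ≤ (1 + v ^ 2) ^ (α / 2) := by
      rw [← Real.sqrt_sq_eq_abs, Real.sqrt_eq_rpow, ← Real.rpow_mul (by positivity)]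
      rw [show 1 / 2 * α = α / 2 by ring]
      exact Real.rpow_le_rpow (by positivity) (by linarith) (by positivity)
    calc (1 + v ^ 2)⁻¹ * |v| ^ α ≤ (1 + v ^ 2)⁻¹ * (1 + v ^ 2) ^ (α / 2) := by gcongr
      _ = (1 + v ^ 2) ^ (-(2 - α) / 2) := by
        rw [← Real.rpow_neg_one, ← Real.rpow_add (by positivity)]
        congr 1; ring

/-- The constant by which the squared `|v| ^ α`-weighted norm of a Fourier transform is bounded. -/
noncomputable def weightConst (α : ℝ) : ℝ := ∫ v : ℝ, (1 + v ^ 2)⁻¹ * |v| ^ α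

lemma weightConst_nonneg (α : ℝ) : 0 ≤ weightConst α := integral_nonneg fun v => by positivity

namespace IsWindow

variable {f g : ℝ → ℝ} {V W α : ℝ}

lemma sq_norm_fourierHat_mul_rpow_le (hf : IsWindow f V) (v : ℝ) :
    ‖fourierHat f v‖ ^ 2 * |v| ^ α
      ≤ ((∫ x, |f x|) ^ 2 + (2 * V) ^ 2) * ((1 + v ^ 2)⁻¹ * |v| ^ α) := by
  rw [← mul_assoc]
  have := hf.sq_norm_fourierHat_le v
  gcongr

lemma integrable_sq_norm_fourierHat_mul_rpow (hf : IsWindow f V) (hα₀ : 0 < α) (hα₁ : α < 1) :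
    Integrable fun v => ‖fourierHat f v‖ ^ 2 * |v| ^ α :=
  ((integrable_inv_one_add_sq_mul_rpow hα₀ hα₁).const_mul _).mono'
    (((continuous_fourierHat hf.integrable).norm.pow 2).aestronglyMeasurable.mul
      (Measurable.aestronglyMeasurable (by fun_prop)))
    (ae_of_all _ fun v => by
      rw [Real.norm_eq_abs, abs_of_nonneg (by positivity)]
      exact hf.sq_norm_fourierHat_mul_rpow_le v)

lemma integral_sq_norm_fourierHat_mul_rpow_le (hf : IsWindow f V) (hα₀ : 0 < α) (hα₁ : α < 1) :
    ∫ v, ‖fourierHat f v‖ ^ 2 * |v| ^ α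
      ≤ ((∫ x, |f x|) ^ 2 + (2 * V) ^ 2) * weightConst α := by
  rw [weightConst, ← integral_const_mul]
  exact integral_mono (hf.integrable_sq_norm_fourierHat_mul_rpow hα₀ hα₁)
    ((integrable_inv_one_add_sq_mul_rpow hα₀ hα₁).const_mul _)
    fun v => hf.sq_norm_fourierHat_mul_rpow_le v

end IsWindow

/-! ### Plancherel's identity for the autocorrelation of a window -/

namespace IsWindow

variable {f g : ℝ → ℝ} {V W : ℝ}

lemma integrable_mul_translate (hf : IsWindow f V) (y : ℝ) :
    Integrable fun x => f x * f (x + y) :=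
  hf.integrable.mul_bdd (c := V) (hf.integrable.comp_add_right y).aestronglyMeasurable
    (ae_of_all _ fun x => by rw [Real.norm_eq_abs]; exact hf.abs_le _)

lemma continuous_autocorrelation (hf : IsWindow f V) :
    Continuous fun y => ∫ x, f x * f (x + y) := by
  have h : LipschitzWith (V * V).toNNReal fun y => ∫ x, f x * f (x + y) := by
    refine LipschitzWith.of_dist_le_mul fun y z => ?_
    rw [Real.coe_toNNReal _ (mul_nonneg hf.nonneg hf.nonneg), Real.dist_eq, Real.dist_eq,
      ← integral_sub (hf.integrable_mul_translate y) (hf.integrable_mul_translate z)]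
    have hi : Integrable fun x => |f (x + (y - z)) - f x| :=
      ((hf.integrable.comp_add_right _).sub hf.integrable).abs
    calc |∫ x, (f x * f (x + y) - f x * f (x + z))|
        ≤ ∫ x, |f x * f (x + y) - f x * f (x + z)| := abs_integral_le_integral_abs
      _ ≤ ∫ x, V * |f (x + z + (y - z)) - f (x + z)| := by
          refine integral_mono ((hf.integrable_mul_translate y).sub
            (hf.integrable_mul_translate z)).abs ((hi.comp_add_right z).const_mul V) fun x => ?_
          simp only
          rw [← mul_sub, abs_mul, show x + z + (y - z) = x + y by ring]
          exact mul_le_mul_of_nonneg_right (hf.abs_le x) (abs_nonneg _)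
      _ = V * ∫ x, |f (x + (y - z)) - f x| := by
          rw [integral_const_mul, integral_add_right_eq_self (fun x => |f (x + (y - z)) - f x|)]
      _ ≤ V * (|y - z| * V) :=
          mul_le_mul_of_nonneg_left (hf.integral_abs_translate_le _) hf.nonneg
      _ = V * V * |y - z| := by ring
  exact h.continuous

/-- Plancherel's identity: the autocorrelation of a window is the inverse Fourier transform of
the squared modulus of its Fourier transform. -/
theorem autocorrelation_eq (hf : IsWindow f V) (y : ℝ) :
    ∫ x, f x * f (x + y)
      = (2 * Real.pi)⁻¹ * ∫ v, ‖fourierHat f v‖ ^ 2 * Real.cos (v * y) := by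
  set F : ℝ → ℂ := fun x => (f x : ℂ) with hF
  have hFi : Integrable F := hf.integrable.ofReal
  have hFn : Integrable fun x => F (-x) := hFi.comp_neg
  -- the autocorrelation is the convolution of `f` with its reflection
  set C : ℝ → ℂ := MeasureTheory.convolution (fun x => F (-x)) F
    (ContinuousLinearMap.mul ℂ ℂ) volume with hC
  have hCy : ∀ y, C y = ((∫ x, f x * f (x + y) : ℝ) : ℂ) := by
    intro y
    rw [hC, convolution_def, ← integral_complex_ofReal, ← integral_neg_eq_self]
    congr 1 with x
    simp [hF, add_comm]
  have hCc : Continuous C := by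
    have : C = fun y => ((∫ x, f x * f (x + y) : ℝ) : ℂ) := funext hCy
    rw [this]
    exact Complex.continuous_ofReal.comp hf.continuous_autocorrelation
  have hCi : Integrable C := hFn.integrable_convolution _ hFi
  have hhat : ∀ w, FourierTransform.fourier F w = fourierHat f (-(2 * Real.pi * w)) := by
    intro w
    rw [fourierHat_eq_fourier, show -(-(2 * Real.pi * w)) / (2 * Real.pi) = w by field_simp]
  have hhatn : ∀ w, FourierTransform.fourier (fun x => F (-x)) w
      = (starRingEnd ℂ) (FourierTransform.fourier F w) := by
    intro w
    rw [hhat, fourierHat_neg, Complex.conj_conj]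
    rw [Real.fourier_eq', ← integral_neg_eq_self, fourierHat]
    congr 1 with x
    simp [hF]
    left
    congr 1
    ring
  have hFC : ∀ w, FourierTransform.fourier C w
      = ((‖fourierHat f (2 * Real.pi * w)‖ ^ 2 : ℝ) : ℂ) := by
    intro w
    rw [hC, Real.fourier_mul_convolution_eq hFn hFi, hhatn, hhat, fourierHat_neg,
      Complex.conj_conj, Complex.mul_conj, Complex.normSq_eq_norm_sq]
  have hFCi : Integrable (FourierTransform.fourier C) := by
    have : FourierTransform.fourier C = fun w => ((‖fourierHat f (2 * Real.pi * w)‖ ^ 2 : ℝ) : ℂ) :=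
      funext hFC
    rw [this]
    exact (hf.integrable_sq_norm_fourierHat.comp_mul_left' (by positivity)).ofReal
  have hinv := congrFun (hCc.fourierInv_fourier_eq hCi hFCi) y
  rw [Real.fourierInv_eq', hCy] at hinv
  have hint : Integrable fun v : ℝ =>
      Complex.exp (((2 * Real.pi * inner ℝ v y : ℝ) : ℂ) * Complex.I)
      • FourierTransform.fourier C v := by
    refine hFCi.norm.mono' ?_ (ae_of_all _ fun v => ?_)
    · refine (Continuous.aestronglyMeasurable (f := fun v : ℝ =>
        Complex.exp (((2 * Real.pi * inner ℝ v y : ℝ) : ℂ) * Complex.I)) ?_).smul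
        hFCi.aestronglyMeasurable
      simp only [RCLike.inner_apply, conj_trivial]
      fun_prop
    · rw [norm_smul, Complex.norm_exp_ofReal_mul_I, one_mul]
  have hre := congrArg RCLike.re hinv
  rw [← integral_re hint] at hre
  simp only [RCLike.re_to_complex, Complex.ofReal_re] at hre
  have h2 := Measure.integral_comp_mul_left
    (fun v : ℝ => ‖fourierHat f v‖ ^ 2 * Real.cos (v * y)) (2 * Real.pi)
  rw [abs_of_pos (by positivity), smul_eq_mul] at h2
  rw [← h2, ← hre]
  congr 1 with v
  rw [hFC, smul_eq_mul, Complex.re_mul_ofReal, Complex.exp_ofReal_mul_I_re, mul_comm]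
  simp only [RCLike.inner_apply, conj_trivial]
  congr 2
  ring

lemma integrable_sq (hf : IsWindow f V) : Integrable fun x => f x ^ 2 := by
  simpa [sq] using hf.integrable_mul_translate 0

section Average

variable (μ : Measure ℝ) [IsProbabilityMeasure μ]

lemma integrable_translate_prod (hg : Integrable g) (hgm : Measurable g) :
    Integrable (fun p : ℝ × ℝ => g (p.1 + p.2)) (volume.prod μ) := by
  rw [integrable_prod_iff' (Measurable.aestronglyMeasurable (by fun_prop))]
  refine ⟨ae_of_all _ fun y => hg.comp_add_right y, ?_⟩
  simp only [integral_add_right_eq_self (fun x => ‖g x‖)]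
  exact integrable_const _

lemma integrable_translate (hf : IsWindow f V) (x : ℝ) : Integrable (fun y => f (x + y)) μ :=
  Integrable.of_bound (C := V) (hf.measurable.comp (by fun_prop)).aestronglyMeasurable
    (ae_of_all _ fun y => by rw [Real.norm_eq_abs]; exact hf.abs_le _)

/-- The squared modulus of a characteristic function is the characteristic function of the
difference of two independent copies. -/
lemma integral_integral_cos (v : ℝ) :
    ∫ y, ∫ z, Real.cos (v * (z - y)) ∂μ ∂μ = ‖charFun μ v‖ ^ 2 := by
  have hc : Integrable (fun y => Real.cos (v * y)) μ :=
    Integrable.of_bound (C := 1) (by fun_prop) (ae_of_all _ fun y => by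
      rw [Real.norm_eq_abs]; exact Real.abs_cos_le_one _)
  have hs : Integrable (fun y => Real.sin (v * y)) μ :=
    Integrable.of_bound (C := 1) (by fun_prop) (ae_of_all _ fun y => by
      rw [Real.norm_eq_abs]; exact Real.abs_sin_le_one _)
  have he : Integrable (fun y : ℝ => Complex.exp ((v : ℂ) * y * Complex.I)) μ :=
    Integrable.of_bound (C := 1) (by fun_prop) (ae_of_all _ fun y => by
      rw [← Complex.ofReal_mul, Complex.norm_exp_ofReal_mul_I])
  have hre : (charFun μ v).re = ∫ y, Real.cos (v * y) ∂μ := by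
    rw [charFun_apply_real, ← RCLike.re_to_complex, ← integral_re he]
    congr 1 with y
    rw [← Complex.ofReal_mul, RCLike.re_to_complex, Complex.exp_ofReal_mul_I_re]
  have him : (charFun μ v).im = ∫ y, Real.sin (v * y) ∂μ := by
    rw [charFun_apply_real, ← RCLike.im_to_complex, ← integral_im he]
    congr 1 with y
    rw [← Complex.ofReal_mul, RCLike.im_to_complex, Complex.exp_ofReal_mul_I_im]
  rw [← Complex.normSq_eq_norm_sq, Complex.normSq_apply, hre, him]
  have h1 : ∀ y, ∫ z, Real.cos (v * (z - y)) ∂μ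
      = Real.cos (v * y) * (∫ z, Real.cos (v * z) ∂μ)
        + Real.sin (v * y) * ∫ z, Real.sin (v * z) ∂μ := by
    intro y
    rw [← integral_const_mul, ← integral_const_mul,
      ← integral_add (hc.const_mul _) (hs.const_mul _)]
    congr 1 with z
    rw [mul_sub, Real.cos_sub]
    ring
  simp only [h1]
  rw [integral_add (hc.mul_const _) (hs.mul_const _), integral_mul_const, integral_mul_const]

lemma integrable_mul_translate_prod (hf : IsWindow f V) :
    Integrable (fun p : ℝ × ℝ × ℝ => f (p.1 + p.2.1) * f (p.1 + p.2.2))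
      (volume.prod (μ.prod μ)) := by
  have hm := hf.measurable
  have h : Integrable (fun p : ℝ × ℝ × ℝ => f (p.1 + p.2.1)) (volume.prod (μ.prod μ)) := by
    rw [integrable_prod_iff' (Measurable.aestronglyMeasurable (by fun_prop))]
    refine ⟨ae_of_all _ fun y => hf.integrable.comp_add_right y.1, ?_⟩
    simp only [integral_add_right_eq_self (fun x => ‖f x‖)]
    exact integrable_const _
  exact h.mul_bdd (c := V) (Measurable.aestronglyMeasurable (by fun_prop))
    (ae_of_all _ fun x => by rw [Real.norm_eq_abs]; exact hf.abs_le _)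

/-- Plancherel's identity for the average of a window over random translations. -/
lemma integral_sq_average (hf : IsWindow f V) :
    ∫ x, (∫ y, f (x + y) ∂μ) ^ 2
      = (2 * Real.pi)⁻¹ * ∫ v, ‖fourierHat f v‖ ^ 2 * ‖charFun μ v‖ ^ 2 := by
  have h1 : ∀ x, (∫ y, f (x + y) ∂μ) ^ 2 = ∫ p : ℝ × ℝ, f (x + p.1) * f (x + p.2) ∂(μ.prod μ) := by
    intro x
    rw [integral_prod_mul (fun y => f (x + y)) (fun y => f (x + y)), sq]
  simp only [h1]
  rw [integral_integral_swap (hf.integrable_mul_translate_prod μ)]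
  have h2 : ∀ p : ℝ × ℝ, ∫ x, f (x + p.1) * f (x + p.2)
      = (2 * Real.pi)⁻¹ * ∫ v, ‖fourierHat f v‖ ^ 2 * Real.cos (v * (p.2 - p.1)) := by
    intro p
    rw [← hf.autocorrelation_eq,
      ← integral_add_right_eq_self (fun x => f x * f (x + (p.2 - p.1))) p.1]
    congr 1 with x
    congr 2
    ring
  simp only [h2]
  rw [integral_const_mul]
  congr 1
  have hi : Integrable (fun q : (ℝ × ℝ) × ℝ =>
      ‖fourierHat f q.2‖ ^ 2 * Real.cos (q.2 * (q.1.2 - q.1.1))) ((μ.prod μ).prod volume) := by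
    have := (continuous_fourierHat hf.integrable)
    refine Integrable.mul_bdd (c := 1) ?_ (by fun_prop)
      (ae_of_all _ fun x => by rw [Real.norm_eq_abs]; exact Real.abs_cos_le_one _)
    exact hf.integrable_sq_norm_fourierHat.comp_snd (μ.prod μ)
  rw [integral_integral_swap hi]
  congr 1 with v
  rw [integral_const_mul, ← integral_integral_cos μ v]
  congr 1
  exact integral_prod (fun p : ℝ × ℝ => Real.cos (v * (p.2 - p.1)))
    (Integrable.of_bound (C := 1) (by fun_prop) (ae_of_all _ fun y => by
      rw [Real.norm_eq_abs]; exact Real.abs_cos_le_one _))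

lemma integrable_average_sq (hf : IsWindow f V) : Integrable fun x => ∫ y, f (x + y) ^ 2 ∂μ :=
  (integrable_translate_prod μ hf.integrable_sq (hf.measurable.pow_const 2)).integral_prod_left

lemma integrable_sq_average (hf : IsWindow f V) :
    Integrable fun x => (∫ y, f (x + y) ∂μ) ^ 2 := by
  have := (hf.integrable_mul_translate_prod μ).integral_prod_left
  refine this.congr (ae_of_all _ fun x => ?_)
  simp only
  rw [integral_prod_mul (fun y => f (x + y)) (fun y => f (x + y)), sq]

/-- The integral over the starting point of the variance of `f` at the endpoint of a displacement
of law `μ`. -/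
theorem integral_variance (hf : IsWindow f V) :
    ∫ x, (∫ y, f (x + y) ^ 2 ∂μ - (∫ y, f (x + y) ∂μ) ^ 2)
      = (2 * Real.pi)⁻¹ * ∫ v, ‖fourierHat f v‖ ^ 2 * (1 - ‖charFun μ v‖ ^ 2) := by
  rw [integral_sub (hf.integrable_average_sq μ) (hf.integrable_sq_average μ),
    hf.integral_sq_average μ]
  have h1 : ∫ x, ∫ y, f (x + y) ^ 2 ∂μ = (2 * Real.pi)⁻¹ * ∫ v, ‖fourierHat f v‖ ^ 2 := by
    rw [integral_integral_swap (integrable_translate_prod μ hf.integrable_sq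
      (hf.measurable.pow_const 2))]
    simp only [integral_add_right_eq_self (fun x => f x ^ 2)]
    have := hf.autocorrelation_eq 0
    simp only [add_zero, mul_zero, Real.cos_zero, mul_one, ← sq] at this
    simp [this]
  have hi : Integrable fun v => ‖fourierHat f v‖ ^ 2 * ‖charFun μ v‖ ^ 2 := by
    refine hf.integrable_sq_norm_fourierHat.mul_bdd (c := 1) (by fun_prop)
      (ae_of_all _ fun v => ?_)
    rw [norm_pow, norm_norm]
    exact pow_le_one₀ (norm_nonneg _) (norm_charFun_le_one v)
  rw [h1, ← mul_sub, ← integral_sub hf.integrable_sq_norm_fourierHat hi]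
  congr 2 with v
  ring

end Average

end IsWindow

/-! ### Independence of blocks and random series -/

section Independence

variable {Ω ι κ : Type*} [MeasurableSpace Ω] {P : Measure Ω}

/-- Grouping an independent family indexed by pairs according to the first index. -/
lemma iIndepFun_curry {𝓧 : Type*} [MeasurableSpace 𝓧] {X : ι × κ → Ω → 𝓧}
    (mX : ∀ p, Measurable (X p)) (h : iIndepFun X P) :
    iIndepFun (fun (i : ι) (ω : Ω) (j : κ) => X (i, j) ω) P := by
  have := h.isProbabilityMeasure
  have hp : ∀ p, IsProbabilityMeasure (P.map (X p)) :=
    fun p => Measure.isProbabilityMeasure_map (mX p).aemeasurable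
  rw [iIndepFun_iff_map_fun_eq_infinitePi_map (by fun_prop)]
  have h1 : ∀ i, P.map (fun ω j => X (i, j) ω)
      = Measure.infinitePi fun j => P.map (X (i, j)) := fun i =>
    (iIndepFun_iff_map_fun_eq_infinitePi_map (fun j => mX (i, j))).1
      (h.precomp (g := fun j : κ => (i, j)) (fun a b hab => (Prod.ext_iff.1 hab).2))
  simp only [h1]
  have h2 := (iIndepFun_iff_map_fun_eq_infinitePi_map mX).1 h
  have h3 := Measure.infinitePi_map_curry (fun i j => P.map (X (i, j)))
  rw [← h3, ← h2, Measure.map_map (by fun_prop) (by fun_prop)]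
  rfl

/-- Pairing two independent families, independent of each other, index by index. -/
lemma iIndepFun_prodMk {β γ : ι → Type*} [∀ i, MeasurableSpace (β i)] [∀ i, MeasurableSpace (γ i)]
    {A : ∀ i, Ω → β i} {B : ∀ i, Ω → γ i} (mA : ∀ i, Measurable (A i)) (mB : ∀ i, Measurable (B i))
    (hA : iIndepFun A P) (hB : iIndepFun B P)
    (hAB : IndepFun (fun ω i => A i ω) (fun ω i => B i ω) P) :
    iIndepFun (fun i ω => (A i ω, B i ω)) P := by
  classical
  have := hA.isProbabilityMeasure
  rw [iIndepFun_iff_iIndep]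
  -- rectangles form a generating π-system, on which independence is the product formula
  let π : ι → Set (Set Ω) := fun i => Set.preimage (fun ω => (A i ω, B i ω)) ''
    (Set.image2 (· ×ˢ ·) {s | MeasurableSet s} {t | MeasurableSet t})
  refine iIndepSets.iIndep (fun i => ((mA i).prodMk (mB i)).comap_le) π (fun i => ?_)
    (fun i => ?_) ?_
  · exact isPiSystem_prod.comap _
  · rw [← generateFrom_prod, MeasurableSpace.comap_generateFrom]
  · rw [iIndepSets_iff]
    intro s f hf
    have h1 : ∀ i, ∃ (a : Set (β i)) (b : Set (γ i)), MeasurableSet a ∧ MeasurableSet b ∧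
        (i ∈ s → f i = A i ⁻¹' a ∩ B i ⁻¹' b) := by
      intro i
      by_cases hi : i ∈ s
      · obtain ⟨-, ⟨a, ha, b, hb, rfl⟩, h⟩ := hf i hi
        exact ⟨a, b, ha, hb, fun _ => h.symm⟩
      · exact ⟨∅, ∅, .empty, .empty, fun h => absurd h hi⟩
    choose a b ha hb hab using h1
    have h2 : ⋂ i ∈ s, f i = (fun ω i => A i ω) ⁻¹' (Set.pi s a)
        ∩ (fun ω i => B i ω) ⁻¹' (Set.pi s b) := by
      ext ω
      simp only [Set.mem_iInter, Set.mem_inter_iff, Set.mem_preimage, Set.mem_pi, Finset.mem_coe]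
      constructor
      · intro h
        exact ⟨fun i hi => ((hab i hi) ▸ h i hi).1, fun i hi => ((hab i hi) ▸ h i hi).2⟩
      · intro h i hi
        rw [hab i hi]
        exact ⟨h.1 i hi, h.2 i hi⟩
    have h3 : ∀ i ∈ s, P (f i) = P (A i ⁻¹' a i) * P (B i ⁻¹' b i) := by
      intro i hi
      rw [hab i hi]
      have := hAB.comp (φ := fun x => x i) (ψ := fun x => x i) (by fun_prop) (by fun_prop)
      exact this.measure_inter_preimage_eq_mul _ _ (ha i) (hb i)
    rw [h2, hAB.measure_inter_preimage_eq_mul _ _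
      (.pi s.countable_toSet fun i _ => ha i) (.pi s.countable_toSet fun i _ => hb i),
      Finset.prod_congr rfl h3, Finset.prod_mul_distrib]
    congr 1
    · rw [← hA.measure_inter_preimage_eq_mul s fun i _ => ha i]
      congr 1
      ext ω; simp
    · rw [← hB.measure_inter_preimage_eq_mul s fun i _ => hb i]
      congr 1
      ext ω; simp

end Independence

section Series

variable {Ω ι E : Type*} [MeasurableSpace Ω] {P : Measure Ω} [Countable ι]
  [NormedAddCommGroup E]

lemma ae_summable_norm_of_summable_integral_norm {ξ : ι → Ω → E} (hi : ∀ i, Integrable (ξ i) P)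
    (hs : Summable fun i => ∫ ω, ‖ξ i ω‖ ∂P) : ∀ᵐ ω ∂P, Summable fun i => ‖ξ i ω‖ := by
  have h1 : ∫⁻ ω, ∑' i, ‖ξ i ω‖ₑ ∂P ≠ ⊤ := by
    rw [lintegral_tsum fun i => (hi i).aestronglyMeasurable.enorm]
    have h2 : ∀ i, ∫⁻ ω, ‖ξ i ω‖ₑ ∂P = ENNReal.ofReal (∫ ω, ‖ξ i ω‖ ∂P) := fun i => by
      rw [ofReal_integral_norm_eq_lintegral_enorm (hi i)]
    simp only [h2]
    exact hs.tsum_ofReal_ne_top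
  have h3 := ae_lt_top' (AEMeasurable.tsum fun i => (hi i).aestronglyMeasurable.enorm) h1
  filter_upwards [h3] with ω hω
  have := ENNReal.summable_toReal hω.ne
  simpa using this

lemma integrable_tsum_of_summable_integral_norm [CompleteSpace E] {ξ : ι → Ω → E}
    (hi : ∀ i, Integrable (ξ i) P)
    (hs : Summable fun i => ∫ ω, ‖ξ i ω‖ ∂P) : Integrable (fun ω => ∑' i, ξ i ω) P := by
  have hae := ae_summable_norm_of_summable_integral_norm hi hs
  have hb : Integrable (fun ω => ∑' i, ‖ξ i ω‖) P := by
    have h1 : ∫⁻ ω, ∑' i, ‖ξ i ω‖ₑ ∂P ≠ ⊤ := by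
      rw [lintegral_tsum fun i => (hi i).aestronglyMeasurable.enorm]
      have h2 : ∀ i, ∫⁻ ω, ‖ξ i ω‖ₑ ∂P = ENNReal.ofReal (∫ ω, ‖ξ i ω‖ ∂P) := fun i => by
        rw [ofReal_integral_norm_eq_lintegral_enorm (hi i)]
      simp only [h2]
      exact hs.tsum_ofReal_ne_top
    have := integrable_toReal_of_lintegral_ne_top
      (AEMeasurable.tsum fun i => (hi i).aestronglyMeasurable.enorm) h1
    refine this.congr (hae.mono fun ω hω => ?_)
    simp only
    rw [ENNReal.tsum_toReal_eq (fun i => by simp)]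
    simp
  refine hb.mono' ?_ (hae.mono fun ω hω => norm_tsum_le_tsum_norm hω)
  refine aestronglyMeasurable_of_tendsto_ae (atTop : Filter (Finset ι))
    (f := fun s ω => ∑ i ∈ s, ξ i ω)
    (fun s => Finset.aestronglyMeasurable_fun_sum s fun i _ => (hi i).aestronglyMeasurable) ?_
  filter_upwards [hae] with ω hω
  exact hω.of_norm.hasSum

end Series

/-! ### The central limit theorem for bounded independent summands, in quantitative form -/

section CLT

/-- Replacing the factors of a product in the unit disc one at a time. -/
lemma norm_prod_sub_prod_le_sum {ι : Type*} (s : Finset ι) {a b : ι → ℂ}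
    (ha : ∀ i, ‖a i‖ ≤ 1) (hb : ∀ i, ‖b i‖ ≤ 1) :
    ‖∏ i ∈ s, a i - ∏ i ∈ s, b i‖ ≤ ∑ i ∈ s, ‖a i - b i‖ := by
  classical
  induction s using Finset.induction with
  | empty => simp
  | insert j s hj ih =>
    rw [Finset.prod_insert hj, Finset.prod_insert hj, Finset.sum_insert hj]
    have h1 : a j * ∏ i ∈ s, a i - b j * ∏ i ∈ s, b i
        = (a j - b j) * ∏ i ∈ s, a i + b j * (∏ i ∈ s, a i - ∏ i ∈ s, b i) := by ring
    have h2 : ‖∏ i ∈ s, a i‖ ≤ 1 := by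
      rw [norm_prod]; exact Finset.prod_le_one (fun _ _ => norm_nonneg _) fun i _ => ha i
    rw [h1]
    refine (norm_add_le _ _).trans ?_
    rw [norm_mul, norm_mul]
    exact add_le_add (mul_le_of_le_one_right (norm_nonneg _) h2)
      ((mul_le_of_le_one_left (norm_nonneg _) (hb j)).trans ih)

variable {Ω ι : Type*} [MeasurableSpace Ω] {P : Measure Ω} [IsProbabilityMeasure P]

/-- Gaussian approximation of the characteristic function of one small centered variable, by Taylor
expansion to second order. -/
lemma norm_integral_exp_sub_le {X : Ω → ℝ} (hX : Measurable X) {ε : ℝ} (hε : ε ≤ 1)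
    (hb : ∀ ω, |X ω| ≤ ε) (h0 : ∫ ω, X ω ∂P = 0) :
    ‖∫ ω, Complex.exp (Complex.I * X ω) ∂P - Real.exp (-(∫ ω, X ω ^ 2 ∂P) / 2)‖
      ≤ 4 * ε * ∫ ω, X ω ^ 2 ∂P := by
  obtain ⟨ω₀⟩ : Nonempty Ω := nonempty_of_isProbabilityMeasure P
  have hε0 : 0 ≤ ε := (abs_nonneg _).trans (hb ω₀)
  have hXi : Integrable X P := Integrable.of_bound (C := ε) hX.aestronglyMeasurable
    (ae_of_all _ hb)
  have hX2 : ∀ ω, X ω ^ 2 ≤ ε ^ 2 := fun ω => by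
    rw [← sq_abs]; exact pow_le_pow_left₀ (abs_nonneg _) (hb ω) 2
  have hX2i : Integrable (fun ω => X ω ^ 2) P := Integrable.of_bound (C := ε ^ 2)
    (hX.pow_const 2).aestronglyMeasurable (ae_of_all _ fun ω => by
      rw [Real.norm_eq_abs, abs_of_nonneg (sq_nonneg _)]; exact hX2 ω)
  have hei : Integrable (fun ω => Complex.exp (Complex.I * X ω)) P :=
    Integrable.of_bound (C := 1) (by fun_prop) (ae_of_all _ fun ω => by
      rw [mul_comm, Complex.norm_exp_ofReal_mul_I])
  set v := ∫ ω, X ω ^ 2 ∂P with hv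
  have hv0 : 0 ≤ v := integral_nonneg fun ω => sq_nonneg _
  have hvε : v ≤ ε ^ 2 := by
    calc v ≤ ∫ _, ε ^ 2 ∂P := integral_mono hX2i (integrable_const _) hX2
      _ = ε ^ 2 := by simp
  have h1 : ∫ ω, (1 + Complex.I * (X ω : ℂ) - ((X ω ^ 2 : ℝ) : ℂ) / 2) ∂P = 1 - (v : ℂ) / 2 := by
    rw [integral_sub ((integrable_const _).add (hXi.ofReal.const_mul _)) (hX2i.ofReal.div_const _),
      integral_add (integrable_const _) (hXi.ofReal.const_mul _), integral_const_mul,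
      integral_complex_ofReal, h0, integral_div, integral_complex_ofReal, ← hv]
    simp
  have h2 : ‖∫ ω, Complex.exp (Complex.I * X ω) ∂P - (1 - (v : ℂ) / 2)‖ ≤ 3 * ε * v := by
    have hqi : Integrable (fun ω => 1 + Complex.I * (X ω : ℂ) - ((X ω ^ 2 : ℝ) : ℂ) / 2) P :=
      ((integrable_const _).add (hXi.ofReal.const_mul _)).sub (hX2i.ofReal.div_const _)
    rw [← h1, ← integral_sub hei hqi, hv, ← integral_const_mul]
    refine norm_integral_le_of_norm_le (hX2i.const_mul _) (ae_of_all _ fun ω => ?_)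
    have h3 := Complex.norm_exp_sub_sum_le_norm_mul_exp (Complex.I * X ω) 3
    have h4 : ‖Complex.I * (X ω : ℂ)‖ = |X ω| := by simp
    rw [h4] at h3
    have h5 : ∑ m ∈ Finset.range 3, (Complex.I * (X ω : ℂ)) ^ m / (m.factorial : ℂ)
        = 1 + Complex.I * (X ω : ℂ) - ((X ω ^ 2 : ℝ) : ℂ) / 2 := by
      simp [Finset.sum_range_succ, Nat.factorial, mul_pow, Complex.I_sq]
      ring
    rw [h5] at h3
    refine h3.trans ?_
    have h6 : Real.exp |X ω| ≤ 3 :=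
      (Real.exp_le_exp.2 ((hb ω).trans hε)).trans (by linarith [Real.exp_one_lt_d9])
    calc |X ω| ^ 3 * Real.exp |X ω| = (|X ω| * Real.exp |X ω|) * X ω ^ 2 := by
          rw [← sq_abs]; ring
      _ ≤ (ε * 3) * X ω ^ 2 := by
          gcongr
          exact hb ω
      _ = 3 * ε * X ω ^ 2 := by ring
  have h7 : |Real.exp (-v / 2) - 1 - -v / 2| ≤ (-v / 2) ^ 2 := by
    refine Real.abs_exp_sub_one_sub_id_le ?_
    rw [abs_div, abs_neg, abs_of_nonneg hv0, abs_two]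
    nlinarith
  have h8 : ‖(1 - (v : ℂ) / 2) - (Real.exp (-v / 2) : ℂ)‖ ≤ ε * v := by
    rw [← norm_neg, show -((1 - (v : ℂ) / 2) - (Real.exp (-v / 2) : ℂ))
      = ((Real.exp (-v / 2) - 1 - -v / 2 : ℝ) : ℂ) by push_cast; ring, Complex.norm_real,
      Real.norm_eq_abs]
    refine h7.trans ?_
    have : v ≤ ε := hvε.trans (by nlinarith)
    nlinarith
  calc _ = ‖(∫ ω, Complex.exp (Complex.I * X ω) ∂P - (1 - (v : ℂ) / 2))
        + ((1 - (v : ℂ) / 2) - (Real.exp (-v / 2) : ℂ))‖ := by congr 1; ring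
    _ ≤ 3 * ε * v + ε * v := (norm_add_le _ _).trans (add_le_add h2 h8)
    _ = 4 * ε * v := by ring

/-- Gaussian approximation for a finite sum of centered independent summands. The error is linear in
the total variance, so it survives the passage to infinitely many summands. -/
lemma norm_integral_exp_sum_sub_le {X : ι → Ω → ℝ} (hX : ∀ i, Measurable (X i))
    (hind : iIndepFun X P) {ε : ℝ} (hε : ε ≤ 1) (hb : ∀ i ω, |X i ω| ≤ ε)
    (h0 : ∀ i, ∫ ω, X i ω ∂P = 0) (s : Finset ι) :
    ‖∫ ω, Complex.exp (Complex.I * ((∑ i ∈ s, X i ω : ℝ) : ℂ)) ∂P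
        - Real.exp (-(∑ i ∈ s, ∫ ω, X i ω ^ 2 ∂P) / 2)‖
      ≤ 4 * ε * ∑ i ∈ s, ∫ ω, X i ω ^ 2 ∂P := by
  have hchar : ∀ Y : Ω → ℝ, Measurable Y →
      charFun (P.map Y) 1 = ∫ ω, Complex.exp (Complex.I * Y ω) ∂P := by
    intro Y hY
    rw [charFun_apply_real, integral_map hY.aemeasurable (by fun_prop)]
    congr 1 with ω
    rw [Complex.ofReal_one, one_mul, mul_comm]
  have h1 := congrFun ((hind.restrict s).charFun_map_fun_finsetSum_eq_prod
    fun i _ => (hX i).aemeasurable) 1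
  rw [hchar _ (Finset.measurable_fun_sum s fun i _ => hX i), Finset.prod_apply] at h1
  simp only [hchar _ (hX _)] at h1
  rw [h1, ← Finset.sum_neg_distrib, Finset.sum_div, Real.exp_sum, Complex.ofReal_prod,
    Finset.mul_sum]
  refine (norm_prod_sub_prod_le_sum s (fun i => ?_) fun i => ?_).trans
    (Finset.sum_le_sum fun i _ => norm_integral_exp_sub_le (hX i) hε (hb i) (h0 i))
  · refine (norm_integral_le_of_norm_le_const (C := 1) (ae_of_all _ fun ω => ?_)).trans (by simp)
    rw [mul_comm, Complex.norm_exp_ofReal_mul_I]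
  · rw [Complex.norm_real, Real.norm_eq_abs, Real.abs_exp]
    exact Real.exp_le_one_iff.2 (by
      have : 0 ≤ ∫ ω, X i ω ^ 2 ∂P := integral_nonneg fun ω => sq_nonneg _
      linarith)

/-- Gaussian approximation for an almost surely convergent series of centered independent summands
bounded by a small number `ε`. -/
lemma norm_integral_exp_hasSum_sub_le [Countable ι] {X : ι → Ω → ℝ} (hX : ∀ i, Measurable (X i))
    (hind : iIndepFun X P) {ε : ℝ} (hε : ε ≤ 1) (hb : ∀ i ω, |X i ω| ≤ ε)
    (h0 : ∀ i, ∫ ω, X i ω ∂P = 0) {D : ℝ} (hD : HasSum (fun i => ∫ ω, X i ω ^ 2 ∂P) D)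
    {S : Ω → ℝ} (hS : ∀ᵐ ω ∂P, HasSum (fun i => X i ω) (S ω)) :
    ‖∫ ω, Complex.exp (Complex.I * (S ω : ℂ)) ∂P - Real.exp (-D / 2)‖ ≤ 4 * ε * D := by
  have h1 : Tendsto
      (fun s : Finset ι => ∫ ω, Complex.exp (Complex.I * ((∑ i ∈ s, X i ω : ℝ) : ℂ)) ∂P) atTop
      (𝓝 (∫ ω, Complex.exp (Complex.I * (S ω : ℂ)) ∂P)) := by
    refine tendsto_integral_filter_of_dominated_convergence (fun _ => 1)
      (.of_forall fun s => ?_) (.of_forall fun s => ae_of_all _ fun ω => ?_)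
      (integrable_const _) (hS.mono fun ω hω => ?_)
    · exact Measurable.aestronglyMeasurable (by fun_prop)
    · rw [mul_comm, Complex.norm_exp_ofReal_mul_I]
    · have hc : Continuous fun x : ℝ => Complex.exp (Complex.I * (x : ℂ)) := by fun_prop
      exact (hc.tendsto _).comp hω
  have hc : Continuous fun x : ℝ => ((Real.exp (-x / 2) : ℝ) : ℂ) := by fun_prop
  have h2 := (h1.sub ((hc.tendsto D).comp hD)).norm
  refine le_of_tendsto_of_tendsto' h2 (hD.const_mul (4 * ε)) fun s => ?_
  exact norm_integral_exp_sum_sub_le hX hind hε hb h0 s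

/-- Fatou bound for the second moment of an almost surely convergent series of centered independent
bounded summands. -/
lemma lintegral_sq_hasSum_le [Countable ι] {X : ι → Ω → ℝ} (hX : ∀ i, Measurable (X i))
    (hind : iIndepFun X P) {ε : ℝ} (hb : ∀ i ω, |X i ω| ≤ ε)
    (h0 : ∀ i, ∫ ω, X i ω ∂P = 0) {D : ℝ} (hD : HasSum (fun i => ∫ ω, X i ω ^ 2 ∂P) D)
    {S : Ω → ℝ} (hS : ∀ᵐ ω ∂P, HasSum (fun i => X i ω) (S ω)) :
    ∫⁻ ω, ENNReal.ofReal (S ω ^ 2) ∂P ≤ ENNReal.ofReal D := by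
  have hmem : ∀ i, MemLp (X i) 2 P := fun i =>
    MemLp.of_bound (hX i).aestronglyMeasurable ε (ae_of_all _ (hb i))
  have hfin : ∀ s : Finset ι, ∫⁻ ω, ENNReal.ofReal ((∑ i ∈ s, X i ω) ^ 2) ∂P
      ≤ ENNReal.ofReal D := by
    intro s
    have hm : MemLp (fun ω => ∑ i ∈ s, X i ω) 2 P := memLp_finsetSum s fun i _ => hmem i
    rw [← ofReal_integral_eq_lintegral_ofReal hm.integrable_sq (ae_of_all _ fun _ => sq_nonneg _)]
    refine ENNReal.ofReal_le_ofReal ?_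
    have hvar := IndepFun.variance_sum (s := s) (X := X) (μ := P) (fun i _ => hmem i)
      fun i _ j _ hij => hind.indepFun hij
    have h00 : ∫ ω, ∑ i ∈ s, X i ω ∂P = 0 := by
      rw [integral_finsetSum s fun i _ => (hmem i).integrable (by norm_num)]
      simp [h0]
    have h3 : (∑ i ∈ s, X i) = fun ω => ∑ i ∈ s, X i ω := by ext; simp
    rw [h3, variance_of_integral_eq_zero hm.aestronglyMeasurable.aemeasurable h00] at hvar
    rw [hvar]
    have h4 : ∀ i, Var[X i; P] = ∫ ω, X i ω ^ 2 ∂P := fun i =>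
      variance_of_integral_eq_zero (hX i).aemeasurable (h0 i)
    simp only [h4]
    exact sum_le_hasSum s (fun i _ => integral_nonneg fun ω => sq_nonneg _) hD
  have h5 : ∫⁻ ω, ENNReal.ofReal (S ω ^ 2) ∂P
      ≤ ∫⁻ ω, liminf (fun s : Finset ι => ENNReal.ofReal ((∑ i ∈ s, X i ω) ^ 2)) atTop ∂P := by
    refine lintegral_mono_ae (hS.mono fun ω hω => ?_)
    have hc : Continuous fun x : ℝ => ENNReal.ofReal (x ^ 2) :=
      ENNReal.continuous_ofReal.comp (by fun_prop)
    exact ((hc.tendsto _).comp hω).liminf_eq.ge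
  refine h5.trans ((lintegral_liminf_le' fun s => ?_).trans ?_)
  · exact Measurable.aemeasurable (by fun_prop)
  · exact (liminf_le_liminf (.of_forall hfin)).trans (by simp)

end CLT

/-! ### Oscillation of windows over unit intervals -/

/-- The increments over unit intervals of a monotone function with values in `[0, V]` sum up to
at most `V`. -/
lemma sum_monotone_increments_le {G : ℝ → ℝ} {V : ℝ} (hm : Monotone G)
    (hb : ∀ x, 0 ≤ G x ∧ G x ≤ V) (s : Finset ℤ) :
    ∑ j ∈ s, (G ((j : ℝ) + 1) - G j) ≤ V := by
  -- enlarge the index set to an interval of integers, over which the sum telescopes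
  obtain ⟨m, hmabs⟩ : ∃ m : ℕ, ∀ j ∈ s, |j| < m := by
    refine ⟨s.sup Int.natAbs + 1, fun j hj => ?_⟩
    have := Finset.le_sup (f := Int.natAbs) hj
    rw [Int.abs_eq_natAbs]
    omega
  have hsub : s ⊆ (Finset.range (2 * m)).image (fun i : ℕ => (i : ℤ) - m) := by
    intro j hj
    have := abs_lt.1 (hmabs j hj)
    rw [Finset.mem_image]
    exact ⟨(j + m).toNat, by simp; omega, by omega⟩
  refine (Finset.sum_le_sum_of_subset_of_nonneg hsub fun j _ _ =>
    sub_nonneg.2 (hm (by linarith))).trans ?_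
  rw [Finset.sum_image fun a _ b _ h => by simpa using h]
  have := Finset.sum_range_sub (fun i : ℕ => G ((i : ℝ) - m)) (2 * m)
  have h2 : ∀ i : ℕ, G ((((i : ℤ) - m : ℤ) : ℝ) + 1) - G (((i : ℤ) - m : ℤ) : ℝ)
      = G (((i + 1 : ℕ) : ℝ) - m) - G ((i : ℝ) - m) := fun i => by
    push_cast
    congr 2
    ring
  simp only [h2]
  rw [this]
  linarith [(hb (((2 * m : ℕ) : ℝ) - m)).2, (hb (((0 : ℕ) : ℝ) - m)).1]

namespace IsWindow

variable {f : ℝ → ℝ} {V : ℝ}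

/-- The oscillations of a window over the unit intervals `[j, j + 1]` sum up to at most `V`. -/
lemma exists_osc (hf : IsWindow f V) : ∃ v : ℤ → ℝ, (∀ j, 0 ≤ v j) ∧
    (∀ s : Finset ℤ, ∑ j ∈ s, v j ≤ V) ∧ ∀ (j : ℤ) (x y : ℝ), x ∈ Set.Icc (j : ℝ) (j + 1) →
      y ∈ Set.Icc (j : ℝ) (j + 1) → |f x - f y| ≤ v j := by
  obtain ⟨G, hm, hb, hG⟩ := hf.exists_control
  refine ⟨fun j => G ((j : ℝ) + 1) - G j, fun j => sub_nonneg.2 (hm (by linarith)),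
    sum_monotone_increments_le hm hb, fun j x y hx hy => ?_⟩
  rcases le_total x y with h | h
  · rw [abs_sub_comm]
    linarith [hG x y h, hm hx.1, hm hy.2]
  · linarith [hG y x h, hm hy.1, hm hx.2]

protected lemma abs (hf : IsWindow f V) : IsWindow (fun x => |f x|) V := by
  obtain ⟨G, hm, hb, hG⟩ := hf.exists_control
  exact ⟨hf.integrable.abs, G, hm, hb, fun x y hxy =>
    (abs_abs_sub_abs_le_abs_sub _ _).trans (hG x y hxy)⟩

protected lemma sq (hf : IsWindow f V) : IsWindow (fun x => f x ^ 2) (2 * V * V) := by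
  obtain ⟨G, hm, hb, hG⟩ := hf.exists_control
  have hV : 0 ≤ 2 * V := by linarith [hf.nonneg]
  refine ⟨hf.integrable_sq, fun x => 2 * V * G x, hm.const_mul hV, fun x =>
    ⟨mul_nonneg hV (hb x).1, mul_le_mul_of_nonneg_left (hb x).2 hV⟩, fun x y hxy => ?_⟩
  rw [show f y ^ 2 - f x ^ 2 = (f y + f x) * (f y - f x) by ring, abs_mul, ← mul_sub]
  have h1 : |f y + f x| ≤ 2 * V := (abs_add_le _ _).trans (by linarith [hf.abs_le x, hf.abs_le y])
  exact mul_le_mul h1 (hG x y hxy) (abs_nonneg _) hV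

/-- Averaging over random translations does not increase the variation. -/
lemma average (hf : IsWindow f V) (μ : Measure ℝ) [IsProbabilityMeasure μ] :
    IsWindow (fun x => ∫ y, f (x + y) ∂μ) V := by
  obtain ⟨G, hm, hb, hG⟩ := hf.exists_control
  have hGi : ∀ x, Integrable (fun y => G (x + y)) μ := fun x =>
    Integrable.of_bound (C := V) (hm.measurable.comp (by fun_prop)).aestronglyMeasurable
      (ae_of_all _ fun y => by rw [Real.norm_eq_abs, abs_of_nonneg (hb _).1]; exact (hb _).2)
  refine ⟨(integrable_translate_prod μ hf.integrable hf.measurable).integral_prod_left,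
    fun x => ∫ y, G (x + y) ∂μ, fun x y hxy => ?_, fun x => ⟨?_, ?_⟩, fun x y hxy => ?_⟩
  · exact integral_mono (hGi x) (hGi y) fun z => hm (by linarith)
  · exact integral_nonneg fun z => (hb _).1
  · calc ∫ y, G (x + y) ∂μ ≤ ∫ _, V ∂μ :=
        integral_mono (hGi x) (integrable_const _) fun z => (hb _).2
      _ = V := by simp
  · rw [← integral_sub (hf.integrable_translate μ y) (hf.integrable_translate μ x),
      ← integral_sub (hGi y) (hGi x)]
    exact norm_integral_le_of_norm_le (f := fun z => f (y + z) - f (x + z))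
      (g := fun z => G (y + z) - G (x + z)) ((hGi y).sub (hGi x))
      (ae_of_all _ fun z => hG (x + z) (y + z) (by linarith))

end IsWindow

section UnitInterval

variable {Ω : Type*} [MeasurableSpace Ω] {P : Measure Ω} [IsProbabilityMeasure P]

/-- The position of a particle inside its unit interval matters only up to the oscillation of
`f`. -/
lemma abs_integral_comp_sub_le {f : ℝ → ℝ} {V v : ℝ} (hf : IsWindow f V) {j : ℤ}
    (hv : ∀ x y : ℝ, x ∈ Set.Icc (j : ℝ) (j + 1) → y ∈ Set.Icc (j : ℝ) (j + 1) →
      |f x - f y| ≤ v) {X : Ω → ℝ} (hX : Measurable X)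
    (hXj : ∀ ω, X ω ∈ Set.Ico (j : ℝ) (j + 1)) {x : ℝ} (hx : x ∈ Set.Icc (j : ℝ) (j + 1)) :
    |∫ ω, f (X ω) ∂P - f x| ≤ v := by
  have hfi : Integrable (fun ω => f (X ω)) P := Integrable.of_bound (C := V)
    (hf.measurable.comp hX).aestronglyMeasurable (ae_of_all _ fun ω => hf.abs_le _)
  have : ∫ ω, f (X ω) ∂P - f x = ∫ ω, (f (X ω) - f x) ∂P := by
    rw [integral_sub hfi (integrable_const _)]; simp
  rw [this]
  have h := norm_integral_le_of_norm_le_const (μ := P) (f := fun ω => f (X ω) - f x) (C := v)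
    (ae_of_all _ fun ω => hv _ _ (Set.Ico_subset_Icc_self (hXj ω)) hx)
  simpa using h

/-- Comparison of a number with the average of a function over a unit interval. -/
lemma abs_sub_setIntegral_Ico_le {j : ℤ} {f : ℝ → ℝ} {m v : ℝ}
    (hf : IntegrableOn f (Set.Ico (j : ℝ) (j + 1)))
    (h : ∀ x ∈ Set.Icc (j : ℝ) (j + 1), |m - f x| ≤ v) :
    |m - ∫ x in Set.Ico (j : ℝ) (j + 1), f x| ≤ v := by
  have hvol : volume.real (Set.Ico (j : ℝ) (j + 1)) = 1 := by simp [Measure.real]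
  have h2 : m - ∫ x in Set.Ico (j : ℝ) (j + 1), f x
      = ∫ x in Set.Ico (j : ℝ) (j + 1), (m - f x) := by
    have hc : IntegrableOn (fun _ => m) (Set.Ico (j : ℝ) (j + 1)) volume :=
      integrableOn_const (by simp)
    rw [integral_sub hc hf, setIntegral_const, hvol, one_smul]
  rw [h2]
  have h3 := norm_setIntegral_le_of_norm_le_const (μ := volume) (s := Set.Ico (j : ℝ) (j + 1))
    (f := fun x => m - f x) (C := v) (by simp) fun x hx => h x (Set.Ico_subset_Icc_self hx)
  simpa [hvol] using h3

lemma hasSum_setIntegral_Ico {f : ℝ → ℝ} (hf : Integrable f) :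
    HasSum (fun j : ℤ => ∫ x in Set.Ico (j : ℝ) (j + 1), f x) (∫ x, f x) := by
  have h := hasSum_integral_iUnion (f := f) (μ := volume)
    (s := fun j : ℤ => Set.Ico (j : ℝ) (j + 1)) (fun _ => measurableSet_Ico)
    (Set.pairwise_disjoint_Ico_intCast ℝ) hf.integrableOn
  rwa [iUnion_Ico_intCast, setIntegral_univ] at h

/-- Fubini's theorem for a bounded function of two independent random elements. -/
lemma integral_comp_of_indepFun {β γ : Type*} [MeasurableSpace β] [MeasurableSpace γ]
    {U : Ω → β} {Y : Ω → γ} (hU : Measurable U) (hY : Measurable Y) (h : IndepFun U Y P)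
    {g : β × γ → ℝ} (hg : Measurable g) {C : ℝ} (hb : ∀ x, |g x| ≤ C) :
    ∫ ω, g (U ω, Y ω) ∂P = ∫ ω, ∫ y, g (U ω, y) ∂(P.map Y) ∂P := by
  have := Measure.isProbabilityMeasure_map (μ := P) hU.aemeasurable
  have := Measure.isProbabilityMeasure_map (μ := P) hY.aemeasurable
  have hmap := (indepFun_iff_map_prod_eq_prod_map_map hU.aemeasurable hY.aemeasurable).1 h
  rw [← integral_map (φ := fun ω => (U ω, Y ω)) (by fun_prop) hg.aestronglyMeasurable, hmap,
    integral_prod _ (Integrable.of_bound (C := C) hg.aestronglyMeasurable (ae_of_all _ hb)),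
    integral_map hU.aemeasurable]
  exact (hg.stronglyMeasurable.integral_prod_right').aestronglyMeasurable

end UnitInterval

/-! ### Moments of the particle system at time one -/

namespace StableParticleSystem

variable {Ω : Type*} [MeasurableSpace Ω] {α : ℝ} {k : ℕ} {P : Measure Ω}
  (S : StableParticleSystem α k P)

/-- The position at time `1` of a particle. -/
noncomputable def pos (p : ℤ × Fin k) (ω : Ω) : ℝ := S.ρ p.1 p.2 ω + S.ϑ p.1 p.2 1 ω

lemma measurable_displacement (p : ℤ × Fin k) : Measurable (S.ϑ p.1 p.2 1) :=
  (S.levy p.1 p.2).measurable 1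

lemma measurable_pos (p : ℤ × Fin k) : Measurable (S.pos p) :=
  (S.measurable_ρ _ _).add (S.measurable_displacement p)

lemma indep_displacement : iIndepFun (fun (p : ℤ × Fin k) (ω : Ω) => S.ϑ p.1 p.2 1 ω) P :=
  S.indep_ϑ.comp (fun _ x => x 1) fun _ => measurable_pi_apply 1

/-- The particles started in different intervals are independent. -/
lemma indep_pos : iIndepFun (fun (j : ℤ) (ω : Ω) (n : Fin k) => S.pos (j, n) ω) P := by
  have h1 := iIndepFun_curry S.measurable_displacement S.indep_displacement
  have h2 : IndepFun (fun ω (j : ℤ) (n : Fin k) => S.ρ j n ω)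
      (fun ω (j : ℤ) (n : Fin k) => S.ϑ j n 1 ω) P :=
    S.indep_ρ_ϑ.comp (φ := fun (x : ℤ × Fin k → ℝ) (j : ℤ) (n : Fin k) => x (j, n))
      (ψ := fun (x : ℤ × Fin k → ℝ≥0 → ℝ) (j : ℤ) (n : Fin k) => x (j, n) 1)
      (by fun_prop) (by fun_prop)
  have h3 := iIndepFun_prodMk (fun j => measurable_pi_iff.2 fun n => S.measurable_ρ j n)
    (fun j => measurable_pi_iff.2 fun n => S.measurable_displacement (j, n)) S.indep_ρ h1 h2
  exact h3.comp (fun _ x n => x.1 n + x.2 n) fun _ => by fun_prop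

lemma charFun_displacement (p : ℤ × Fin k) (u : ℝ) :
    charFun (P.map (S.ϑ p.1 p.2 1)) u = ((Real.exp (-(|u| ^ α)) : ℝ) : ℂ) := by
  have h := (S.levy p.1 p.2).charFun_increment 0 1 zero_le_one u
  have h0 : (fun ω => S.ϑ p.1 p.2 1 ω - S.ϑ p.1 p.2 0 ω) =ᵐ[P] S.ϑ p.1 p.2 1 := by
    filter_upwards [(S.levy p.1 p.2).zero] with ω hω
    simp [hω]
  rw [Measure.map_congr h0] at h
  simpa using h

/-- The contribution to `⟨N_1, f⟩` of the particles started in `[j, j + 1)`. -/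
noncomputable def block (f : ℝ → ℝ) (j : ℤ) (ω : Ω) : ℝ := ∑ n : Fin k, f (S.pos (j, n) ω)

lemma measurable_block {f : ℝ → ℝ} (hf : Measurable f) (j : ℤ) : Measurable (S.block f j) :=
  Finset.measurable_fun_sum _ fun n _ => hf.comp (S.measurable_pos (j, n))

lemma abs_block_le {f : ℝ → ℝ} {C : ℝ} (hb : ∀ x, |f x| ≤ C) (j : ℤ) (ω : Ω) :
    |S.block f j ω| ≤ k * C := by
  refine (Finset.abs_sum_le_sum_abs _ _).trans ((Finset.sum_le_sum fun n _ => hb _).trans ?_)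
  simp

lemma indep_block {f : ℝ → ℝ} (hf : Measurable f) : iIndepFun (S.block f) P :=
  S.indep_pos.comp (fun _ x => ∑ n : Fin k, f (x n)) fun _ => by fun_prop

variable [IsProbabilityMeasure P]

/-- All displacements have the same law, as they have the same characteristic function. -/
lemma map_displacement_eq (p q : ℤ × Fin k) :
    P.map (S.ϑ p.1 p.2 1) = P.map (S.ϑ q.1 q.2 1) := by
  have := Measure.isProbabilityMeasure_map (μ := P) (S.measurable_displacement p).aemeasurable
  have := Measure.isProbabilityMeasure_map (μ := P) (S.measurable_displacement q).aemeasurable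
  refine Measure.ext_of_charFun (funext fun u => ?_)
  rw [S.charFun_displacement, S.charFun_displacement]

variable {μ : Measure ℝ}

/-- The mean of `f` at the position of a particle is the mean over its starting point of the average
of `f` over the displacement. -/
lemma integral_pos (hμ : ∀ p : ℤ × Fin k, P.map (S.ϑ p.1 p.2 1) = μ) {f : ℝ → ℝ}
    (hf : Measurable f) {C : ℝ} (hb : ∀ x, |f x| ≤ C) (p : ℤ × Fin k) :
    ∫ ω, f (S.pos p ω) ∂P = ∫ ω, ∫ y, f (S.ρ p.1 p.2 ω + y) ∂μ ∂P := by
  have h : IndepFun (S.ρ p.1 p.2) (S.ϑ p.1 p.2 1) P :=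
    S.indep_ρ_ϑ.comp (φ := fun x : ℤ × Fin k → ℝ => x p)
      (ψ := fun x : ℤ × Fin k → ℝ≥0 → ℝ => x p 1) (by fun_prop) (by fun_prop)
  rw [← hμ p]
  exact integral_comp_of_indepFun (S.measurable_ρ _ _) (S.measurable_displacement p) h
    (g := fun x => f (x.1 + x.2)) (by fun_prop) fun x => hb _

variable [IsProbabilityMeasure μ]

/-- Given the starting points, two different particles are independent; the starting points
themselves may be dependent. -/
lemma integral_pos_mul_pos (hμ : ∀ p : ℤ × Fin k, P.map (S.ϑ p.1 p.2 1) = μ) {f : ℝ → ℝ}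
    (hf : Measurable f) {C : ℝ} (hb : ∀ x, |f x| ≤ C) {p q : ℤ × Fin k} (hpq : p ≠ q) :
    ∫ ω, f (S.pos p ω) * f (S.pos q ω) ∂P
      = ∫ ω, (∫ y, f (S.ρ p.1 p.2 ω + y) ∂μ) * (∫ y, f (S.ρ q.1 q.2 ω + y) ∂μ) ∂P := by
  have h : IndepFun (fun ω => (S.ρ p.1 p.2 ω, S.ρ q.1 q.2 ω))
      (fun ω => (S.ϑ p.1 p.2 1 ω, S.ϑ q.1 q.2 1 ω)) P :=
    S.indep_ρ_ϑ.comp (φ := fun x => (x p, x q)) (ψ := fun x => (x p 1, x q 1))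
      (by fun_prop) (by fun_prop)
  have hY : P.map (fun ω => (S.ϑ p.1 p.2 1 ω, S.ϑ q.1 q.2 1 ω)) = μ.prod μ := by
    rw [(indepFun_iff_map_prod_eq_prod_map_map (S.measurable_displacement p).aemeasurable
      (S.measurable_displacement q).aemeasurable).1 (S.indep_displacement.indepFun hpq), hμ p, hμ q]
  have hmp := S.measurable_displacement p
  have hmq := S.measurable_displacement q
  have hrp := S.measurable_ρ p.1 p.2
  have hrq := S.measurable_ρ q.1 q.2
  have h2 := integral_comp_of_indepFun (P := P) (by fun_prop) (by fun_prop) h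
    (g := fun x => f (x.1.1 + x.2.1) * f (x.1.2 + x.2.2)) (C := C * C) (by fun_prop) fun x => by
      rw [abs_mul]
      exact mul_le_mul (hb _) (hb _) (abs_nonneg _) ((abs_nonneg _).trans (hb 0))
  refine h2.trans ?_
  rw [hY]
  congr 1 with ω
  exact integral_prod_mul (fun y => f (S.ρ p.1 p.2 ω + y)) (fun y => f (S.ρ q.1 q.2 ω + y))

/-- A window is integrable with respect to the mean measure of the particles, which is compared
with `k` times Lebesgue measure up to the oscillations over unit intervals. -/
lemma summable_integral_norm (hμ : ∀ p : ℤ × Fin k, P.map (S.ϑ p.1 p.2 1) = μ) {f : ℝ → ℝ}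
    {V : ℝ} (hf : IsWindow f V) : Summable fun p => ∫ ω, |f (S.pos p ω)| ∂P := by
  have hg := hf.abs.average μ
  obtain ⟨v, hv0, hvs, hv⟩ := hg.exists_osc
  have hA : Summable fun j : ℤ => (∫ x in Set.Ico (j : ℝ) (j + 1), ∫ y, |f (x + y)| ∂μ) + v j :=
    (hasSum_setIntegral_Ico hg.integrable).summable.add (summable_of_sum_le hv0 hvs)
  have h1 : Summable fun p : ℤ × Fin k =>
      ((∫ x in Set.Ico (p.1 : ℝ) (p.1 + 1), ∫ y, |f (x + y)| ∂μ) + v p.1) * 1 := by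
    refine hA.mul_of_nonneg (g := fun _ : Fin k => (1 : ℝ)) (Summable.of_finite) (fun j => ?_)
      fun _ => zero_le_one
    exact add_nonneg (integral_nonneg fun x => integral_nonneg fun y => abs_nonneg _) (hv0 j)
  refine h1.of_nonneg_of_le (fun p => integral_nonneg fun ω => abs_nonneg _) fun p => ?_
  rw [mul_one, S.integral_pos hμ hf.abs.measurable (C := V)
    (fun x => by rw [abs_abs]; exact hf.abs_le x) p]
  have h2 := abs_sub_setIntegral_Ico_le hg.integrable.integrableOn fun x hx =>
    abs_integral_comp_sub_le (P := P) hg (hv p.1) (S.measurable_ρ p.1 p.2) (S.ρ_mem p.1 p.2) hx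
  linarith [(abs_le.1 h2).2]

/-- Covariances inside one block. On the diagonal the variance is close to the integral over the
unit interval of the variance of a particle started there; off the diagonal, where the starting
points may have any joint law, the covariance is close to zero. Both errors are bounded in terms of
the oscillations `v` of the average of `f` and `w` of the average of `f²`. -/
lemma abs_covariance_sub_le (hμ : ∀ p : ℤ × Fin k, P.map (S.ϑ p.1 p.2 1) = μ) {f : ℝ → ℝ}
    {V : ℝ} (hf : IsWindow f V) {j : ℤ} {v w : ℝ} (hv0 : 0 ≤ v)
    (hv : ∀ x y : ℝ, x ∈ Set.Icc (j : ℝ) (j + 1) → y ∈ Set.Icc (j : ℝ) (j + 1) →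
      |∫ z, f (x + z) ∂μ - ∫ z, f (y + z) ∂μ| ≤ v)
    (hw : ∀ x y : ℝ, x ∈ Set.Icc (j : ℝ) (j + 1) → y ∈ Set.Icc (j : ℝ) (j + 1) →
      |∫ z, f (x + z) ^ 2 ∂μ - ∫ z, f (y + z) ^ 2 ∂μ| ≤ w) (n m : Fin k) :
    |cov[fun ω => f (S.pos (j, n) ω), fun ω => f (S.pos (j, m) ω); P]
      - (if n = m then ∫ x in Set.Ico (j : ℝ) (j + 1),
          (∫ y, f (x + y) ^ 2 ∂μ - (∫ y, f (x + y) ∂μ) ^ 2) else 0)|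
      ≤ (if n = m then w + 2 * V * v else 0) + V * v := by
  have hg := hf.average μ
  have hh := hf.sq.average μ
  have hV := hf.nonneg
  have hL2 : ∀ n, MemLp (fun ω => f (S.pos (j, n) ω)) 2 P := fun n =>
    MemLp.of_bound (hf.measurable.comp (S.measurable_pos _)).aestronglyMeasurable V
      (ae_of_all _ fun ω => hf.abs_le _)
  have hmean : ∀ n, ∫ ω, f (S.pos (j, n) ω) ∂P = ∫ ω, ∫ y, f (S.ρ j n ω + y) ∂μ ∂P := fun n =>
    S.integral_pos hμ hf.measurable hf.abs_le (j, n)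
  have hosc : ∀ n, ∀ x ∈ Set.Icc (j : ℝ) (j + 1),
      |∫ ω, ∫ y, f (S.ρ j n ω + y) ∂μ ∂P - ∫ y, f (x + y) ∂μ| ≤ v := fun n x hx =>
    abs_integral_comp_sub_le (P := P) hg hv (S.measurable_ρ j n) (S.ρ_mem j n) hx
  have hgb : ∀ n, |∫ ω, ∫ y, f (S.ρ j n ω + y) ∂μ ∂P| ≤ V := fun n => by
    have := norm_integral_le_of_norm_le_const (μ := P)
      (f := fun ω => ∫ y, f (S.ρ j n ω + y) ∂μ) (C := V) (ae_of_all _ fun ω => hg.abs_le _)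
    simpa using this
  rw [covariance_eq_sub (hL2 n) (hL2 m)]
  simp only [Pi.mul_apply]
  split_ifs with hnm
  · subst hnm
    have h1 : ∫ ω, f (S.pos (j, n) ω) * f (S.pos (j, n) ω) ∂P
        = ∫ ω, ∫ y, f (S.ρ j n ω + y) ^ 2 ∂μ ∂P := by
      have := S.integral_pos hμ (f := fun x => f x ^ 2) (hf.measurable.pow_const 2)
        hf.sq.abs_le (j, n)
      simpa [sq] using this
    rw [h1, hmean n, integral_sub (hf.integrable_average_sq μ).integrableOn
      (hf.integrable_sq_average μ).integrableOn]
    have h2 := abs_sub_setIntegral_Ico_le (hf.integrable_average_sq μ).integrableOn fun x hx =>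
      abs_integral_comp_sub_le (P := P) hh hw (S.measurable_ρ j n) (S.ρ_mem j n) hx
    have h3 := abs_sub_setIntegral_Ico_le (m := (∫ ω, ∫ y, f (S.ρ j n ω + y) ∂μ ∂P) ^ 2)
      (v := 2 * V * v) (j := j) (hf.integrable_sq_average μ).integrableOn fun x hx => by
        rw [sq_sub_sq, abs_mul]
        refine mul_le_mul ?_ (hosc n x hx) (abs_nonneg _) (by linarith)
        exact (abs_add_le _ _).trans (by linarith [hgb n, hg.abs_le x])
    have h4 := abs_le.1 h2
    have h5 := abs_le.1 h3
    have h6 : 0 ≤ V * v := mul_nonneg hV hv0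
    rw [abs_le]
    constructor <;> nlinarith
  · rw [S.integral_pos_mul_pos hμ hf.measurable hf.abs_le (by simpa using hnm), hmean n, hmean m,
      sub_zero, zero_add]
    have hgi : ∀ n, Integrable (fun ω => ∫ y, f (S.ρ j n ω + y) ∂μ) P := fun n =>
      Integrable.of_bound (C := V) (hg.measurable.comp (S.measurable_ρ j n)).aestronglyMeasurable
        (ae_of_all _ fun ω => hg.abs_le _)
    have h1 : Integrable (fun ω => (∫ y, f (S.ρ j n ω + y) ∂μ) * ∫ y, f (S.ρ j m ω + y) ∂μ) P :=
      (hgi n).mul_bdd (c := V) (hgi m).aestronglyMeasurable (ae_of_all _ fun ω => hg.abs_le _)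
    rw [← integral_mul_const, ← integral_sub h1 ((hgi n).mul_const _)]
    have h2 : ∀ C : ℝ, C * P.real Set.univ = C := by simp
    rw [← h2 (V * v), ← Real.norm_eq_abs]
    refine norm_integral_le_of_norm_le_const (ae_of_all _ fun ω => ?_)
    rw [← mul_sub, norm_mul]
    refine mul_le_mul (hg.abs_le _) ?_ (norm_nonneg _) hV
    rw [norm_sub_rev]
    exact hosc m _ (Set.Ico_subset_Icc_self (S.ρ_mem j m ω))

/-- The variances of the blocks add up, and up to a bounded error their sum is `k` times the
integral over the starting point of the variance of one particle. -/
lemma exists_hasSum_variance_block (hμ : ∀ p : ℤ × Fin k, P.map (S.ϑ p.1 p.2 1) = μ) {f : ℝ → ℝ}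
    {V : ℝ} (hf : IsWindow f V) : ∃ D, HasSum (fun j => Var[S.block f j; P]) D ∧
      |D - k * ∫ x, (∫ y, f (x + y) ^ 2 ∂μ - (∫ y, f (x + y) ∂μ) ^ 2)|
        ≤ (4 * k + k ^ 2) * V ^ 2 := by
  obtain ⟨v, hv0, hvs, hv⟩ := (hf.average μ).exists_osc
  obtain ⟨w, hw0, hws, hw⟩ := (hf.sq.average μ).exists_osc
  have hV := hf.nonneg
  set I : ℤ → ℝ := fun j => ∫ x in Set.Ico (j : ℝ) (j + 1),
    (∫ y, f (x + y) ^ 2 ∂μ - (∫ y, f (x + y) ∂μ) ^ 2) with hI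
  have hIs : HasSum I (∫ x, (∫ y, f (x + y) ^ 2 ∂μ - (∫ y, f (x + y) ∂μ) ^ 2)) :=
    hasSum_setIntegral_Ico ((hf.integrable_average_sq μ).sub (hf.integrable_sq_average μ))
  have hL2 : ∀ j n, MemLp (fun ω => f (S.pos (j, n) ω)) 2 P := fun j n =>
    MemLp.of_bound (hf.measurable.comp (S.measurable_pos _)).aestronglyMeasurable V
      (ae_of_all _ fun ω => hf.abs_le _)
  have hvar : ∀ j, |Var[S.block f j; P] - k * I j|
      ≤ k * (w j + 2 * V * v j) + k ^ 2 * (V * v j) := by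
    intro j
    have h1 : Var[S.block f j; P] = ∑ n, ∑ m,
        cov[fun ω => f (S.pos (j, n) ω), fun ω => f (S.pos (j, m) ω); P] :=
      variance_fun_sum fun n => hL2 j n
    have h2 : (k : ℝ) * I j = ∑ n : Fin k, ∑ m : Fin k, if n = m then I j else 0 := by simp
    have h3 : (k : ℝ) * (w j + 2 * V * v j) + k ^ 2 * (V * v j)
        = ∑ n : Fin k, ∑ m : Fin k, ((if n = m then w j + 2 * V * v j else 0) + V * v j) := by
      simp [Finset.sum_add_distrib]; ring
    rw [h1, h2, h3, ← Finset.sum_sub_distrib]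
    refine (Finset.abs_sum_le_sum_abs _ _).trans (Finset.sum_le_sum fun n _ => ?_)
    rw [← Finset.sum_sub_distrib]
    refine (Finset.abs_sum_le_sum_abs _ _).trans (Finset.sum_le_sum fun m _ => ?_)
    exact S.abs_covariance_sub_le hμ hf (hv0 j) (hv j) (hw j) n m
  have hvS : Summable v := summable_of_sum_le hv0 hvs
  have hwS : Summable w := summable_of_sum_le hw0 hws
  have hbS : Summable fun j => k * (w j + 2 * V * v j) + k ^ 2 * (V * v j) :=
    ((hwS.add (hvS.mul_left _)).mul_left _).add ((hvS.mul_left _).mul_left _)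
  have hdS : Summable fun j => Var[S.block f j; P] - k * I j :=
    Summable.of_norm_bounded hbS hvar
  have hkI := hIs.mul_left (k : ℝ)
  refine ⟨_, by simpa using hdS.hasSum.add hkI, ?_⟩
  rw [add_sub_cancel_right]
  refine (tsum_of_norm_bounded (f := fun j => Var[S.block f j; P] - k * I j)
    hbS.hasSum hvar).trans ?_
  have hvt : ∑' j, v j ≤ V := hvS.tsum_le_of_sum_le hvs
  have hwt : ∑' j, w j ≤ 2 * V * V := hwS.tsum_le_of_sum_le hws
  rw [((hwS.add (hvS.mul_left _)).mul_left _).tsum_add ((hvS.mul_left _).mul_left _),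
    tsum_mul_left, tsum_mul_left, tsum_mul_left, hwS.tsum_add (hvS.mul_left _), tsum_mul_left]
  have hk : (0 : ℝ) ≤ k := k.cast_nonneg
  have h5 : V * ∑' j, v j ≤ V * V := mul_le_mul_of_nonneg_left hvt hV
  calc (k : ℝ) * (∑' j, w j + 2 * V * ∑' j, v j) + k ^ 2 * (V * ∑' j, v j)
      ≤ k * (2 * V * V + 2 * (V * V)) + k ^ 2 * (V * V) := by
        have h6 : ∑' j, w j + 2 * V * ∑' j, v j ≤ 2 * V * V + 2 * (V * V) := by linarith
        exact add_le_add (mul_le_mul_of_nonneg_left h6 hk)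
          (mul_le_mul_of_nonneg_left h5 (by positivity))
    _ = (4 * k + k ^ 2) * V ^ 2 := by ring

end StableParticleSystem

/-! ### The limit variance -/

/-- The limit variance `(k / π) ∫ |f̂(v)|² |v| ^ α dv`. -/
noncomputable def limitVar (α : ℝ) (k : ℕ) (f : ℝ → ℝ) : ℝ :=
  k / Real.pi * ∫ v, ‖fourierHat f v‖ ^ 2 * |v| ^ α

lemma limitVar_nonneg (α : ℝ) (k : ℕ) (f : ℝ → ℝ) : 0 ≤ limitVar α k f :=
  mul_nonneg (div_nonneg k.cast_nonneg Real.pi_pos.le) (integral_nonneg fun v => by positivity)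

/-- The integrated variance of one particle at scale `T`, normalized, for a displacement of
characteristic function `exp (-|u| ^ α)`. -/
noncomputable def scaledVar (α : ℝ) (k : ℕ) (f : ℝ → ℝ) (T : ℝ) : ℝ :=
  k / (2 * Real.pi) * ∫ v, ‖fourierHat f v‖ ^ 2 * (T ^ α * (1 - Real.exp (-2 * |v / T| ^ α)))

lemma rpow_mul_one_sub_exp_nonneg {α T : ℝ} (hT : 0 < T) (v : ℝ) :
    0 ≤ T ^ α * (1 - Real.exp (-2 * |v / T| ^ α)) := by
  have : Real.exp (-2 * |v / T| ^ α) ≤ 1 := Real.exp_le_one_iff.2 (by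
    have : 0 ≤ |v / T| ^ α := by positivity
    linarith)
  exact mul_nonneg (by positivity) (by linarith)

lemma rpow_mul_one_sub_exp_le {α T : ℝ} (hT : 0 < T) (v : ℝ) :
    T ^ α * (1 - Real.exp (-2 * |v / T| ^ α)) ≤ 2 * |v| ^ α := by
  have h1 := Real.add_one_le_exp (-2 * |v / T| ^ α)
  have h2 : T ^ α * |v / T| ^ α = |v| ^ α := by
    rw [abs_div, abs_of_pos hT, Real.div_rpow (abs_nonneg _) hT.le]
    field_simp
  calc T ^ α * (1 - Real.exp (-2 * |v / T| ^ α)) ≤ T ^ α * (2 * |v / T| ^ α) := by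
        gcongr; linarith
    _ = 2 * (T ^ α * |v / T| ^ α) := by ring
    _ = 2 * |v| ^ α := by rw [h2]

/-- The pointwise limit of the integrand of `scaledVar`. -/
lemma tendsto_rpow_mul_one_sub_exp {α : ℝ} (hα : 0 < α) (v : ℝ) :
    Tendsto (fun T : ℝ => T ^ α * (1 - Real.exp (-2 * |v / T| ^ α))) atTop
      (𝓝 (2 * |v| ^ α)) := by
  rcases eq_or_ne v 0 with rfl | hv
  · simp [Real.zero_rpow hα.ne']
  set c := |v| ^ α with hc
  have hc0 : 0 < c := Real.rpow_pos_of_pos (abs_pos.2 hv) α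
  -- with `h = T ^ (-α)` this is the derivative at `0` of `h ↦ 1 - exp (-2 c h)`
  have hd : HasDerivAt (fun h : ℝ => 1 - Real.exp (-2 * c * h)) (2 * c) 0 := by
    have h1 : HasDerivAt (fun h : ℝ => -2 * c * h) (-2 * c) 0 := by
      simpa using (hasDerivAt_id (0 : ℝ)).const_mul (-2 * c)
    have h2 := h1.exp.const_sub 1
    simpa using h2
  have hs := hd.tendsto_slope_zero_right
  have hT : Tendsto (fun T : ℝ => T ^ (-α)) atTop (𝓝[>] 0) := by
    refine tendsto_nhdsWithin_iff.2 ⟨tendsto_rpow_neg_atTop hα, ?_⟩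
    filter_upwards [eventually_gt_atTop 0] with T hT using Real.rpow_pos_of_pos hT _
  refine (hs.comp hT).congr' ?_
  filter_upwards [eventually_gt_atTop 0] with T hT0
  have h1 : |v / T| ^ α = c * T ^ (-α) := by
    rw [abs_div, abs_of_pos hT0, Real.div_rpow (abs_nonneg _) hT0.le, Real.rpow_neg hT0.le]
    rfl
  simp only [Function.comp_apply, zero_add, mul_zero, Real.exp_zero, sub_self, sub_zero,
    smul_eq_mul]
  rw [h1, Real.rpow_neg hT0.le, inv_inv, mul_assoc]

namespace IsWindow

variable {f : ℝ → ℝ} {V α : ℝ} (hf : IsWindow f V)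
include hf

lemma scaledVar_le (hα₀ : 0 < α) (hα₁ : α < 1) (k : ℕ) {T : ℝ} (hT : 0 < T) :
    scaledVar α k f T ≤ limitVar α k f := by
  have hi := (hf.integrable_sq_norm_fourierHat_mul_rpow hα₀ hα₁).const_mul 2
  have hpi := Real.pi_pos
  have h : ∫ v, ‖fourierHat f v‖ ^ 2 * (T ^ α * (1 - Real.exp (-2 * |v / T| ^ α)))
      ≤ ∫ v, 2 * (‖fourierHat f v‖ ^ 2 * |v| ^ α) := by
    refine integral_mono_of_nonneg (ae_of_all _ fun v => mul_nonneg (by positivity)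
      (rpow_mul_one_sub_exp_nonneg hT v)) hi (ae_of_all _ fun v => ?_)
    simp only
    rw [mul_left_comm (2 : ℝ)]
    exact mul_le_mul_of_nonneg_left (rpow_mul_one_sub_exp_le hT v) (sq_nonneg _)
  rw [integral_const_mul] at h
  calc scaledVar α k f T ≤ k / (2 * Real.pi) * (2 * ∫ v, ‖fourierHat f v‖ ^ 2 * |v| ^ α) := by
        unfold scaledVar
        gcongr
    _ = limitVar α k f := by
        unfold limitVar
        field_simp

lemma tendsto_scaledVar (hα₀ : 0 < α) (hα₁ : α < 1) (k : ℕ) :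
    Tendsto (scaledVar α k f) atTop (𝓝 (limitVar α k f)) := by
  have hi := (hf.integrable_sq_norm_fourierHat_mul_rpow hα₀ hα₁).const_mul 2
  have hpi := Real.pi_pos
  have hc := continuous_fourierHat hf.integrable
  have h : Tendsto (fun T : ℝ => ∫ v, ‖fourierHat f v‖ ^ 2 *
      (T ^ α * (1 - Real.exp (-2 * |v / T| ^ α)))) atTop
      (𝓝 (∫ v, ‖fourierHat f v‖ ^ 2 * (2 * |v| ^ α))) := by
    refine tendsto_integral_filter_of_dominated_convergence _ (.of_forall fun T => ?_) ?_ hi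
      (ae_of_all _ fun v => (tendsto_rpow_mul_one_sub_exp hα₀ v).const_mul _)
    · exact Measurable.aestronglyMeasurable (by fun_prop)
    · filter_upwards [eventually_gt_atTop 0] with T hT
      refine ae_of_all _ fun v => ?_
      rw [Real.norm_eq_abs, abs_of_nonneg (mul_nonneg (by positivity)
        (rpow_mul_one_sub_exp_nonneg hT v)), mul_left_comm (2 : ℝ)]
      exact mul_le_mul_of_nonneg_left (rpow_mul_one_sub_exp_le hT v) (sq_nonneg _)
  have h2 : limitVar α k f
      = k / (2 * Real.pi) * ∫ v, ‖fourierHat f v‖ ^ 2 * (2 * |v| ^ α) := by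
    have : ∫ v, ‖fourierHat f v‖ ^ 2 * (2 * |v| ^ α) = 2 * ∫ v, ‖fourierHat f v‖ ^ 2 * |v| ^ α := by
      rw [← integral_const_mul]
      congr 1 with v
      ring
    rw [this, limitVar]
    field_simp
  rw [h2]
  exact h.const_mul _

/-- The integrated variance of the rescaled window, by Plancherel's identity and scaling. -/
lemma integral_variance_comp_div {μ : Measure ℝ} [IsProbabilityMeasure μ]
    {k : ℕ} (hμ : k ≠ 0 → ∀ u, charFun μ u = ((Real.exp (-(|u| ^ α)) : ℝ) : ℂ)) {T : ℝ}
    (hT : 0 < T) :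
    k * ∫ x, (∫ y, f ((x + y) / T) ^ 2 ∂μ - (∫ y, f ((x + y) / T) ∂μ) ^ 2)
      = scaledVar α k f T * T ^ (1 - α) := by
  rcases eq_or_ne k 0 with rfl | hk
  · simp [scaledVar]
  replace hμ := hμ hk
  rw [(hf.comp_div hT).integral_variance μ]
  have h1 : ∀ v, ‖fourierHat (fun x => f (x / T)) v‖ ^ 2 * (1 - ‖charFun μ v‖ ^ 2)
      = (fun w => T ^ 2 * (‖fourierHat f w‖ ^ 2 * (1 - Real.exp (-2 * |w / T| ^ α)))) (T * v) := by
    intro v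
    simp only
    rw [fourierHat_comp_div f hT, hμ, norm_mul, Complex.norm_real, Complex.norm_real,
      Real.norm_eq_abs, Real.norm_eq_abs, abs_of_pos hT, Real.abs_exp, mul_pow,
      mul_div_cancel_left₀ _ hT.ne', ← Real.exp_nat_mul]
    rw [show ((2 : ℕ) : ℝ) * -|v| ^ α = -2 * |v| ^ α by push_cast; ring]
    ring
  rw [integral_congr_ae (ae_of_all _ h1), Measure.integral_comp_mul_left
    (fun w => T ^ 2 * (‖fourierHat f w‖ ^ 2 * (1 - Real.exp (-2 * |w / T| ^ α)))) T,
    integral_const_mul, scaledVar]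
  have h2 : ∫ v, ‖fourierHat f v‖ ^ 2 * (T ^ α * (1 - Real.exp (-2 * |v / T| ^ α)))
      = T ^ α * ∫ v, ‖fourierHat f v‖ ^ 2 * (1 - Real.exp (-2 * |v / T| ^ α)) := by
    rw [← integral_const_mul]
    congr 1 with v
    ring
  have h3 : T ^ α * T ^ (1 - α) = T := by
    rw [← Real.rpow_add hT]; simp
  rw [h2, abs_of_pos (by positivity), smul_eq_mul, mul_assoc, mul_right_comm (T ^ α), h3]
  field_simp

end IsWindow

/-! ### Asymptotic normality of the fluctuation of a single window -/

namespace StableParticleSystem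

variable {Ω : Type*} [MeasurableSpace Ω] {α : ℝ} {k : ℕ} {P : Measure Ω}
  (S : StableParticleSystem α k P)

section Pairing

variable {E : Type*} [NormedAddCommGroup E]

lemma integrable_N_of_summable {F : ℝ → E} {ω : Ω} (h : Summable fun p => ‖F (S.pos p ω)‖) :
    Integrable F (S.N 1 ω) := by
  refine integrable_sum_measure (fun p => integrable_dirac (by simp)) ?_
  simpa [integral_dirac, pos] using h

lemma hasSum_integral_N [NormedSpace ℝ E] [CompleteSpace E] {F : ℝ → E} {ω : Ω}
    (h : Integrable F (S.N 1 ω)) : HasSum (fun p => F (S.pos p ω)) (∫ x, F x ∂(S.N 1 ω)) := by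
  simpa [integral_dirac, pos, N] using hasSum_integral_measure h

variable [IsProbabilityMeasure P]

/-- The common law of the displacements. Without particles the law is irrelevant, and its
characteristic function is left unspecified. -/
lemma exists_displacement_law : ∃ μ : Measure ℝ, IsProbabilityMeasure μ ∧
    (∀ p : ℤ × Fin k, P.map (S.ϑ p.1 p.2 1) = μ) ∧
    (k ≠ 0 → ∀ u, charFun μ u = ((Real.exp (-(|u| ^ α)) : ℝ) : ℂ)) := by
  rcases Nat.eq_zero_or_pos k with hk | hk
  · subst hk
    exact ⟨Measure.dirac 0, inferInstance, fun p => p.2.elim0, fun h => (h rfl).elim⟩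
  · refine ⟨P.map (S.ϑ 0 ⟨0, hk⟩ 1),
      Measure.isProbabilityMeasure_map (S.measurable_displacement (0, ⟨0, hk⟩)).aemeasurable,
      fun p => S.map_displacement_eq p (0, ⟨0, hk⟩), fun _ u =>
      S.charFun_displacement (0, ⟨0, hk⟩) u⟩

variable {f : ℝ → ℝ} {V : ℝ} {F : ℝ → E}

/-- Integration of a vector-valued function against the particles is controlled by a window that
dominates its norm. -/
lemma integrable_comp_pos (hF : StronglyMeasurable F) (hf : IsWindow f V)
    (hFf : ∀ x, ‖F x‖ ≤ f x) (p : ℤ × Fin k) : Integrable (fun ω => F (S.pos p ω)) P :=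
  Integrable.of_bound (C := V) (hF.comp_measurable (S.measurable_pos p)).aestronglyMeasurable
    (ae_of_all _ fun _ => (hFf _).trans ((le_abs_self _).trans (hf.abs_le _)))

lemma summable_integral_norm_comp_pos (hF : StronglyMeasurable F) (hf : IsWindow f V)
    (hFf : ∀ x, ‖F x‖ ≤ f x) : Summable fun p => ∫ ω, ‖F (S.pos p ω)‖ ∂P := by
  obtain ⟨μ, hμp, hμ, -⟩ := S.exists_displacement_law
  refine (S.summable_integral_norm hμ hf).of_nonneg_of_le
    (fun p => integral_nonneg fun ω => norm_nonneg _) fun p => ?_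
  refine integral_mono (S.integrable_comp_pos hF hf hFf p).norm
    (Integrable.of_bound (C := V) ?_ (ae_of_all _ fun ω => ?_)) fun ω =>
    (hFf _).trans (le_abs_self _)
  · exact (hf.abs.measurable.comp (S.measurable_pos p)).aestronglyMeasurable
  · simpa using hf.abs_le (S.pos p ω)

lemma ae_integrable_N (hF : StronglyMeasurable F) (hf : IsWindow f V)
    (hFf : ∀ x, ‖F x‖ ≤ f x) : ∀ᵐ ω ∂P, Integrable F (S.N 1 ω) := by
  filter_upwards [ae_summable_norm_of_summable_integral_norm (S.integrable_comp_pos hF hf hFf)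
    (S.summable_integral_norm_comp_pos hF hf hFf)] with ω hω using S.integrable_N_of_summable hω

variable [NormedSpace ℝ E] [CompleteSpace E]

lemma ae_tsum_eq_integral_N (hF : StronglyMeasurable F) (hf : IsWindow f V)
    (hFf : ∀ x, ‖F x‖ ≤ f x) :
    (fun ω => ∑' p, F (S.pos p ω)) =ᵐ[P] fun ω => ∫ x, F x ∂(S.N 1 ω) := by
  filter_upwards [S.ae_integrable_N hF hf hFf] with ω hω using (S.hasSum_integral_N hω).tsum_eq

lemma integrable_integral_N (hF : StronglyMeasurable F) (hf : IsWindow f V)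
    (hFf : ∀ x, ‖F x‖ ≤ f x) : Integrable (fun ω => ∫ x, F x ∂(S.N 1 ω)) P :=
  (integrable_tsum_of_summable_integral_norm (S.integrable_comp_pos hF hf hFf)
    (S.summable_integral_norm_comp_pos hF hf hFf)).congr (S.ae_tsum_eq_integral_N hF hf hFf)

lemma hasSum_integral_comp_pos (hF : StronglyMeasurable F) (hf : IsWindow f V)
    (hFf : ∀ x, ‖F x‖ ≤ f x) :
    HasSum (fun p => ∫ ω, F (S.pos p ω) ∂P) (∫ ω, ∫ x, F x ∂(S.N 1 ω) ∂P) := by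
  rw [← integral_congr_ae (S.ae_tsum_eq_integral_N hF hf hFf)]
  exact hasSum_integral_of_summable_integral_norm (S.integrable_comp_pos hF hf hFf)
    (S.summable_integral_norm_comp_pos hF hf hFf)

end Pairing

variable {f : ℝ → ℝ} {V T : ℝ}

/-- The centered and normalized contribution of the particles started in `[j, j + 1)`. -/
noncomputable def normBlock (T : ℝ) (f : ℝ → ℝ) (j : ℤ) (ω : Ω) : ℝ :=
  (S.block (fun x => f (x / T)) j ω - ∫ ω', S.block (fun x => f (x / T)) j ω' ∂P) / √(T ^ (1 - α))

lemma measurable_normBlock (hf : IsWindow f V) (hT : 0 < T) (j : ℤ) :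
    Measurable (S.normBlock T f j) :=
  ((S.measurable_block (hf.comp_div hT).measurable j).sub_const _).div_const _

lemma indep_normBlock (hf : IsWindow f V) (hT : 0 < T) : iIndepFun (S.normBlock T f) P :=
  (S.indep_block (hf.comp_div hT).measurable).comp
    (fun j x => (x - ∫ ω', S.block (fun x => f (x / T)) j ω' ∂P) / √(T ^ (1 - α)))
    fun j => by fun_prop

lemma integral_normBlock_sq (hf : IsWindow f V) (hT : 0 < T) (j : ℤ) :
    ∫ ω, S.normBlock T f j ω ^ 2 ∂P
      = Var[S.block (fun x => f (x / T)) j; P] / T ^ (1 - α) := by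
  rw [variance_eq_integral (S.measurable_block (hf.comp_div hT).measurable j).aemeasurable,
    ← integral_div]
  congr 1 with ω
  rw [normBlock, div_pow, Real.sq_sqrt (by positivity)]

variable [IsProbabilityMeasure P]

lemma integrable_pairing (hf : IsWindow f V) (hT : 0 < T) : Integrable (S.pairing T f) P :=
  S.integrable_integral_N (F := fun x => f (x / T)) (hf.comp_div hT).measurable.stronglyMeasurable
    (hf.comp_div hT).abs fun _ => le_rfl

lemma ae_integrable_window (hf : IsWindow f V) (hT : 0 < T) :
    ∀ᵐ ω ∂P, Integrable (fun x => f (x / T)) (S.N 1 ω) :=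
  S.ae_integrable_N (hf.comp_div hT).measurable.stronglyMeasurable
    (hf.comp_div hT).abs fun _ => le_rfl

lemma integrable_fluct (hf : IsWindow f V) (hT : 0 < T) : Integrable (S.fluct T f) P :=
  ((S.integrable_pairing hf hT).sub (integrable_const _)).div_const _

lemma integrable_block (hf : IsWindow f V) (j : ℤ) : Integrable (S.block f j) P :=
  Integrable.of_bound (C := k * V) (S.measurable_block hf.measurable j).aestronglyMeasurable
    (ae_of_all _ fun ω => S.abs_block_le hf.abs_le j ω)

lemma abs_normBlock_le (hf : IsWindow f V) (hT : 0 < T) (j : ℤ) (ω : Ω) :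
    |S.normBlock T f j ω| ≤ 2 * k * V / √(T ^ (1 - α)) := by
  have hm : |∫ ω', S.block (fun x => f (x / T)) j ω' ∂P| ≤ k * V := by
    have := norm_integral_le_of_norm_le_const (μ := P)
      (f := S.block (fun x => f (x / T)) j) (C := k * V)
      (ae_of_all _ fun ω => S.abs_block_le (hf.comp_div hT).abs_le j ω)
    simpa using this
  rw [normBlock, abs_div, abs_of_nonneg (Real.sqrt_nonneg _)]
  gcongr
  refine (abs_sub _ _).trans ?_
  linarith [S.abs_block_le (hf.comp_div hT).abs_le j ω]

lemma integral_normBlock (hf : IsWindow f V) (hT : 0 < T) (j : ℤ) :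
    ∫ ω, S.normBlock T f j ω ∂P = 0 := by
  simp only [normBlock]
  rw [integral_div, integral_sub (S.integrable_block (hf.comp_div hT) j) (integrable_const _)]
  simp

lemma ae_hasSum_normBlock (hf : IsWindow f V) (hT : 0 < T) :
    ∀ᵐ ω ∂P, HasSum (fun j => S.normBlock T f j ω) (S.fluct T f ω) := by
  have hg := hf.comp_div hT
  have hm1 := S.hasSum_integral_comp_pos (F := fun x => f (x / T))
    hg.measurable.stronglyMeasurable hg.abs fun _ => le_rfl
  have hb : ∀ j, HasSum (fun n => ∫ ω', f (S.pos (j, n) ω' / T) ∂P)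
      (∫ ω', S.block (fun x => f (x / T)) j ω' ∂P) := by
    intro j
    have : ∫ ω', S.block (fun x => f (x / T)) j ω' ∂P
        = ∑ n, ∫ ω', f (S.pos (j, n) ω' / T) ∂P :=
      integral_finsetSum _ fun n _ => S.integrable_comp_pos (F := fun x => f (x / T))
        hg.measurable.stronglyMeasurable hg.abs (fun _ => le_rfl) (j, n)
    rw [this]
    exact hasSum_fintype _
  have hm : HasSum (fun j => ∫ ω', S.block (fun x => f (x / T)) j ω' ∂P)
      (∫ ω', S.pairing T f ω' ∂P) := HasSum.prod_fiberwise hm1 hb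
  filter_upwards [S.ae_integrable_window hf hT] with ω hω
  have h1 := S.hasSum_integral_N hω
  have h2 : ∀ j, HasSum (fun n => f (S.pos (j, n) ω / T)) (S.block (fun x => f (x / T)) j ω) :=
    fun j => hasSum_fintype _
  have h3 : HasSum (fun j => S.block (fun x => f (x / T)) j ω) (S.pairing T f ω) :=
    HasSum.prod_fiberwise h1 h2
  exact (h3.sub hm).div_const _

/-- The variances of the normalized blocks sum up to `scaledVar`, up to an error of order
`T ^ (α - 1)`. -/
lemma exists_hasSum_integral_normBlock_sq (hf : IsWindow f V) (hT : 0 < T) :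
    ∃ D, HasSum (fun j => ∫ ω, S.normBlock T f j ω ^ 2 ∂P) D ∧
      |D - scaledVar α k f T| ≤ (4 * k + k ^ 2) * V ^ 2 / T ^ (1 - α) := by
  obtain ⟨μ, hμp, hμ, hμc⟩ := S.exists_displacement_law
  obtain ⟨D, hD, hDb⟩ := S.exists_hasSum_variance_block hμ (hf.comp_div hT)
  have hT' : 0 < T ^ (1 - α) := by positivity
  refine ⟨D / T ^ (1 - α), ?_, ?_⟩
  · simp only [S.integral_normBlock_sq hf hT]
    exact hD.div_const _
  · rw [hf.integral_variance_comp_div hμc hT] at hDb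
    rw [← mul_div_cancel_right₀ (scaledVar α k f T) hT'.ne', ← sub_div, abs_div, abs_of_pos hT']
    gcongr

/-- The second moments of the fluctuations are bounded uniformly in `T`. -/
lemma lintegral_fluct_sq_le (hα₀ : 0 < α) (hα₁ : α < 1) (hf : IsWindow f V) (hT : 1 ≤ T) :
    ∫⁻ ω, ENNReal.ofReal (S.fluct T f ω ^ 2) ∂P
      ≤ ENNReal.ofReal (limitVar α k f + (4 * k + k ^ 2) * V ^ 2) := by
  have hT0 : 0 < T := one_pos.trans_le hT
  obtain ⟨D, hD, hDb⟩ := S.exists_hasSum_integral_normBlock_sq hf hT0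
  refine (lintegral_sq_hasSum_le (S.measurable_normBlock hf hT0) (S.indep_normBlock hf hT0)
    (S.abs_normBlock_le hf hT0) (S.integral_normBlock hf hT0) hD
    (S.ae_hasSum_normBlock hf hT0)).trans (ENNReal.ofReal_le_ofReal ?_)
  have h1 : (4 * k + k ^ 2) * V ^ 2 / T ^ (1 - α) ≤ (4 * k + k ^ 2) * V ^ 2 :=
    div_le_self (by positivity) (Real.one_le_rpow hT (by linarith))
  linarith [(abs_le.1 hDb).2, hf.scaledVar_le hα₀ hα₁ k hT0]

/-- The fluctuation of a window is asymptotically Gaussian. -/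
lemma tendsto_integral_exp_fluct (hα₀ : 0 < α) (hα₁ : α < 1) (hf : IsWindow f V) :
    Tendsto (fun T => ∫ ω, Complex.exp (Complex.I * S.fluct T f ω) ∂P) atTop
      (𝓝 ((Real.exp (-limitVar α k f / 2) : ℝ) : ℂ)) := by
  have hpow : Tendsto (fun T : ℝ => T ^ (1 - α)) atTop atTop := tendsto_rpow_atTop (by linarith)
  have hD : ∀ T : ℝ, ∃ D, 0 < T → HasSum (fun j => ∫ ω, S.normBlock T f j ω ^ 2 ∂P) D ∧
      |D - scaledVar α k f T| ≤ (4 * k + k ^ 2) * V ^ 2 / T ^ (1 - α) := fun T => by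
    by_cases hT : 0 < T
    · obtain ⟨D, h⟩ := S.exists_hasSum_integral_normBlock_sq hf hT
      exact ⟨D, fun _ => h⟩
    · exact ⟨0, fun h => (hT h).elim⟩
  choose D hD using hD
  have hD0 : Tendsto (fun T => D T - scaledVar α k f T) atTop (𝓝 0) := by
    refine squeeze_zero_norm' ?_ (hpow.const_div_atTop ((4 * k + k ^ 2) * V ^ 2))
    filter_upwards [eventually_gt_atTop 0] with T hT using (hD T hT).2
  have hDl : Tendsto D atTop (𝓝 (limitVar α k f)) := by
    simpa using hD0.add (hf.tendsto_scaledVar hα₀ hα₁ k)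
  have hε : Tendsto (fun T : ℝ => 2 * k * V / √(T ^ (1 - α))) atTop (𝓝 0) :=
    (Real.tendsto_sqrt_atTop.comp hpow).const_div_atTop _
  have hexp : Tendsto (fun T => ((Real.exp (-D T / 2) : ℝ) : ℂ)) atTop
      (𝓝 ((Real.exp (-limitVar α k f / 2) : ℝ) : ℂ)) :=
    (Complex.continuous_ofReal.tendsto _).comp
      ((Real.continuous_exp.tendsto _).comp (hDl.neg.div_const 2))
  have hdiff : Tendsto (fun T => ∫ ω, Complex.exp (Complex.I * S.fluct T f ω) ∂P
      - ((Real.exp (-D T / 2) : ℝ) : ℂ)) atTop (𝓝 0) := by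
    refine squeeze_zero_norm' (a := fun T => 4 * (2 * k * V / √(T ^ (1 - α))) * D T) ?_ ?_
    · filter_upwards [eventually_gt_atTop 0, hε.eventually_le_const one_pos] with T hT hT1
      exact norm_integral_exp_hasSum_sub_le (S.measurable_normBlock hf hT)
        (S.indep_normBlock hf hT) hT1 (S.abs_normBlock_le hf hT) (S.integral_normBlock hf hT)
        (hD T hT).1 (S.ae_hasSum_normBlock hf hT)
    · simpa using (hε.const_mul 4).mul hDl
  simpa using hdiff.add hexp

end StableParticleSystem

/-! ### The isonormal Gaussian process of a Hilbert space -/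

section Isonormal

variable {Ω : Type*} [MeasurableSpace Ω] {Q : Measure Ω} [IsProbabilityMeasure Q]

lemma norm_exp_I_mul_sub_exp_I_mul_le (x y : ℝ) :
    ‖Complex.exp (Complex.I * x) - Complex.exp (Complex.I * y)‖ ≤ |x - y| := by
  have h : Complex.exp (Complex.I * x) - Complex.exp (Complex.I * y)
      = Complex.exp (Complex.I * y) * (Complex.exp (Complex.I * ((x - y : ℝ) : ℂ)) - 1) := by
    rw [mul_sub, ← Complex.exp_add, mul_one]
    congr 2
    push_cast
    ring
  rw [h, norm_mul, mul_comm Complex.I (y : ℂ), Complex.norm_exp_ofReal_mul_I, one_mul]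
  exact Real.norm_exp_I_mul_ofReal_sub_one_le

lemma integrable_exp_I_mul {X : Ω → ℝ} (hX : AEStronglyMeasurable X Q) :
    Integrable (fun ω => Complex.exp (Complex.I * X ω)) Q := by
  refine Integrable.of_bound (C := 1) ?_ (ae_of_all _ fun ω => ?_)
  · exact (Continuous.comp_aestronglyMeasurable (g := fun x : ℝ => Complex.exp (Complex.I * x))
      (by fun_prop) hX)
  · rw [mul_comm, Complex.norm_exp_ofReal_mul_I]

lemma integral_abs_le_norm_Lp (X : Lp ℝ 2 Q) : ∫ ω, |X ω| ∂Q ≤ ‖X‖ := by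
  have h1 := (Lp.memLp X)
  have h2 := eLpNorm_le_eLpNorm_of_exponent_le (p := 1) (q := 2) (by norm_num)
    (Lp.aestronglyMeasurable X)
  have h3 : ∫ ω, |X ω| ∂Q = (eLpNorm X 1 Q).toReal := by
    rw [eLpNorm_one_eq_lintegral_enorm]
    exact integral_norm_eq_lintegral_enorm (Lp.aestronglyMeasurable X)
  rw [h3, Lp.norm_def]
  exact ENNReal.toReal_mono (Lp.eLpNorm_ne_top X) h2

/-- The characteristic function at `1` is continuous in `L²`, which lets Gaussian laws pass to
limits in `L²`. -/
lemma continuous_integral_exp_Lp :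
    Continuous fun X : Lp ℝ 2 Q => ∫ ω, Complex.exp (Complex.I * X ω) ∂Q := by
  refine (LipschitzWith.of_dist_le_mul (K := 1) fun X Y => ?_).continuous
  rw [dist_eq_norm, dist_eq_norm, NNReal.coe_one, one_mul, ← integral_sub
    (integrable_exp_I_mul (Lp.aestronglyMeasurable X))
    (integrable_exp_I_mul (Lp.aestronglyMeasurable Y))]
  refine le_trans ?_ (integral_abs_le_norm_Lp (X - Y))
  have hi : Integrable (fun ω => |(X - Y) ω|) Q :=
    ((Lp.memLp (X - Y)).integrable (by norm_num)).abs
  refine norm_integral_le_of_norm_le hi ?_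
  filter_upwards [Lp.coeFn_sub X Y] with ω hω
  rw [hω]
  exact norm_exp_I_mul_sub_exp_I_mul_le _ _

/-- Independent standard Gaussian variables are orthonormal in `L²`, and the closed subspace they
span consists of centered Gaussian variables. -/
theorem exists_isonormal (K : Type) [NormedAddCommGroup K] [InnerProductSpace ℝ K]
    [CompleteSpace K] : ∃ (Ω : Type) (_ : MeasurableSpace Ω) (Q : Measure Ω)
      (_ : IsProbabilityMeasure Q) (W : K →ₗᵢ[ℝ] Lp ℝ 2 Q),
      ∀ h, ∫ ω, Complex.exp (Complex.I * W h ω) ∂Q = ((Real.exp (-‖h‖ ^ 2 / 2) : ℝ) : ℂ) := by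
  obtain ⟨w, b, -⟩ := exists_hilbertBasis ℝ K
  let Q : Measure (w → ℝ) := Measure.infinitePi fun _ => gaussianReal 0 1
  have hmp : ∀ i, MeasurePreserving (fun ω : w → ℝ => ω i) Q (gaussianReal 0 1) := fun i =>
    measurePreserving_eval_infinitePi _ i
  have hind : iIndepFun (fun (i : w) (ω : w → ℝ) => ω i) Q :=
    iIndepFun_infinitePi (X := fun _ x => x) fun _ => measurable_id
  have hL2 : ∀ i, MemLp (fun ω : w → ℝ => ω i) 2 Q := fun i =>
    (memLp_id_gaussianReal 2).comp_measurePreserving (hmp i)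
  have hint : ∀ i (g : ℝ → ℝ), Measurable g → ∫ ω, g (ω i) ∂Q = ∫ x, g x ∂(gaussianReal 0 1) :=
    fun i g hg => by
      rw [← (hmp i).map_eq, integral_map (hmp i).aemeasurable hg.aestronglyMeasurable]
  have hmean : ∀ i, ∫ ω, ω i ∂Q = 0 := fun i => by
    rw [hint i (fun x => x) measurable_id]
    exact integral_id_gaussianReal
  have hsq : ∀ i, ∫ ω, ω i * ω i ∂Q = 1 := fun i => by
    rw [hint i (fun x => x * x) (by fun_prop)]
    have h := variance_of_integral_eq_zero (X := fun x : ℝ => x) (μ := gaussianReal 0 1)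
      measurable_id.aemeasurable integral_id_gaussianReal
    rw [variance_fun_id_gaussianReal] at h
    simpa [sq] using h.symm
  -- the isometry maps the basis `b` to the coordinate variables
  let ξ : w → Lp ℝ 2 Q := fun i => (hL2 i).toLp
  have hξ : Orthonormal ℝ ξ := by
    classical
    rw [orthonormal_iff_ite]
    intro i j
    have h1 : inner ℝ (ξ i) (ξ j) = ∫ ω, ω i * ω j ∂Q := by
      rw [L2.inner_def]
      refine integral_congr_ae ?_
      filter_upwards [(hL2 i).coeFn_toLp, (hL2 j).coeFn_toLp] with ω h1 h2
      rw [h1, h2]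
      simp [mul_comm]
    rw [h1]
    split_ifs with hij
    · subst hij
      exact hsq i
    · rw [(hind.indepFun hij).integral_fun_mul_eq_mul_integral
        (hL2 i).aestronglyMeasurable (hL2 j).aestronglyMeasurable, hmean i, zero_mul]
  have hfin : ∀ (c : w → ℝ) (s : Finset w),
      ∫ ω, Complex.exp (Complex.I * (∑ i ∈ s, c i • ξ i : Lp ℝ 2 Q) ω) ∂Q
        = ((Real.exp (-(∑ i ∈ s, c i ^ 2) / 2) : ℝ) : ℂ) := by
    intro c s
    have hae : ∀ᵐ ω ∂Q, (∑ i ∈ s, c i • ξ i : Lp ℝ 2 Q) ω = ∑ i ∈ s, c i * ω i := by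
      have h1 := Lp.coeFn_finsetSum s fun i => c i • ξ i
      have h2 : ∀ᵐ ω ∂Q, ∀ i ∈ s, (c i • ξ i) ω = c i * ω i := by
        refine (Finset.eventually_all s).2 fun i _ => ?_
        filter_upwards [Lp.coeFn_smul (c i) (ξ i), (hL2 i).coeFn_toLp] with ω h3 h4
        rw [h3, Pi.smul_apply, h4, smul_eq_mul]
      filter_upwards [h1, h2] with ω h1 h2
      rw [h1, Finset.sum_apply]
      exact Finset.sum_congr rfl h2
    have hind' : iIndepFun (fun (i : w) (ω : w → ℝ) => c i * ω i) Q :=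
      hind.comp (fun i x => c i * x) fun i => by fun_prop
    have hcm : ∀ i, Measurable fun ω : w → ℝ => c i * ω i := fun i => by fun_prop
    have h3 := congrFun ((hind'.restrict s).charFun_map_fun_finsetSum_eq_prod
      fun i _ => (hcm i).aemeasurable) 1
    rw [charFun_apply, integral_map
      (Finset.measurable_fun_sum s fun i _ => hcm i).aemeasurable (by fun_prop),
      Finset.prod_apply] at h3
    calc _ = ∫ ω, Complex.exp (((∑ i ∈ s, c i * ω i : ℝ) : ℂ) * Complex.I) ∂Q := by
          refine integral_congr_ae (hae.mono fun ω hω => ?_)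
          simp only
          rw [hω, mul_comm]
      _ = ∏ i ∈ s, charFun (Q.map fun ω => c i * ω i) 1 := by
          rw [← h3]
          simp
      _ = ∏ i ∈ s, Complex.exp (-(c i : ℂ) ^ 2 / 2) := by
          refine Finset.prod_congr rfl fun i _ => ?_
          have : (Q.map fun ω => c i * ω i) = (gaussianReal 0 1).map fun x => c i * x := by
            rw [← (hmp i).map_eq, Measure.map_map (by fun_prop) (by fun_prop)]
            rfl
          rw [this, charFun_map_mul, charFun_gaussianReal]
          congr 1
          simp
          ring
      _ = _ := by
          rw [← Complex.exp_sum]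
          push_cast
          rw [← Finset.sum_div, Finset.sum_neg_distrib]
  refine ⟨w → ℝ, inferInstance, Q, inferInstance,
    hξ.orthogonalFamily.linearIsometry.comp b.repr.toLinearIsometry, fun h => ?_⟩
  have h1 : HasSum (fun i => b.repr h i • ξ i)
      (hξ.orthogonalFamily.linearIsometry (b.repr h)) := by
    simpa using hξ.orthogonalFamily.hasSum_linearIsometry (b.repr h)
  have h2 : HasSum (fun i => b.repr h i ^ 2) (‖h‖ ^ 2) := by
    have := lp.hasSum_norm (p := 2) (by norm_num) (b.repr h)
    simpa using this
  refine tendsto_nhds_unique ((continuous_integral_exp_Lp.tendsto _).comp h1) ?_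
  have h3 := (Complex.continuous_ofReal.tendsto _).comp
    ((Real.continuous_exp.tendsto _).comp (h2.neg.div_const 2))
  refine h3.congr fun s => ?_
  simp only [Function.comp_apply]
  rw [hfin (fun i => b.repr h i) s, ← Finset.sum_div, Finset.sum_neg_distrib]

end Isonormal

/-- Recognizing a centered Gaussian variable by its characteristic function. -/
lemma map_eq_gaussianReal_of_integral_exp {Ω : Type*} [MeasurableSpace Ω] {Q : Measure Ω}
    [IsProbabilityMeasure Q] {X : Ω → ℝ} (hX : AEMeasurable X Q) (v : ℝ≥0)
    (h : ∀ u : ℝ, ∫ ω, Complex.exp (Complex.I * ((u * X ω : ℝ) : ℂ)) ∂Q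
      = ((Real.exp (-(u ^ 2 * v) / 2) : ℝ) : ℂ)) : Q.map X = gaussianReal 0 v := by
  have := Measure.isProbabilityMeasure_map hX
  refine Measure.ext_of_charFun (funext fun u => ?_)
  rw [charFun_gaussianReal, charFun_apply, integral_map hX (by fun_prop)]
  refine Eq.trans (integral_congr_ae (ae_of_all _ fun ω => ?_)) ((h u).trans ?_)
  · simp only [RCLike.inner_apply, conj_trivial]
    rw [mul_comm]
  · push_cast
    congr 1
    ring

/-! ### Convergence in distribution through characteristic functions -/

section Levy

variable {Ω Ω' ι : Type*} [MeasurableSpace Ω] [MeasurableSpace Ω'] {P : Measure Ω}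
  [IsProbabilityMeasure P] {Q : Measure Ω'} [IsProbabilityMeasure Q] {l : Filter ι}
  [l.IsCountablyGenerated]

omit [IsProbabilityMeasure P] in
lemma charFun_map_eq_integral {E : Type*} [NormedAddCommGroup E] [InnerProductSpace ℝ E]
    [MeasurableSpace E] [BorelSpace E] {Y : Ω → E} (hY : AEMeasurable Y P) (t : E) :
    charFun (P.map Y) t = ∫ ω, Complex.exp (Complex.I * (inner ℝ t (Y ω) : ℝ)) ∂P := by
  rw [charFun_apply, integral_map hY (Continuous.aestronglyMeasurable (by fun_prop))]
  simp only [mul_comm Complex.I, real_inner_comm t]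

/-- Lévy's continuity theorem along a countably generated filter. -/
lemma tendstoInDistribution_of_integral_exp_inner {E : Type*} [NormedAddCommGroup E]
    [InnerProductSpace ℝ E] [FiniteDimensional ℝ E] [MeasurableSpace E] [BorelSpace E]
    {X : ι → Ω → E} {Z : Ω' → E} (hX : ∀ i, AEMeasurable (X i) P) (hZ : AEMeasurable Z Q)
    (h : ∀ t, Tendsto (fun i => ∫ ω, Complex.exp (Complex.I * (inner ℝ t (X i ω) : ℝ)) ∂P) l
      (𝓝 (∫ ω, Complex.exp (Complex.I * (inner ℝ t (Z ω) : ℝ)) ∂Q))) :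
    TendstoInDistribution X l Z (fun _ => P) Q := by
  refine ⟨hX, hZ, tendsto_of_seq_tendsto fun u hu =>
    ProbabilityMeasure.tendsto_of_tendsto_charFun fun t => ?_⟩
  have h1 := (h t).comp hu
  rw [← charFun_map_eq_integral hZ] at h1
  refine h1.congr fun n => ?_
  exact (charFun_map_eq_integral (hX (u n)) t).symm

/-- The Cramér–Wold device. -/
lemma tendstoInDistribution_pi_of_integral_exp {κ : Type*} [Fintype κ]
    {X : ι → Ω → κ → ℝ} {Z : Ω' → κ → ℝ} (hX : ∀ i, AEMeasurable (X i) P)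
    (hZ : AEMeasurable Z Q)
    (h : ∀ c : κ → ℝ, Tendsto
      (fun i => ∫ ω, Complex.exp (Complex.I * (∑ k, c k * X i ω k : ℝ)) ∂P) l
      (𝓝 (∫ ω, Complex.exp (Complex.I * (∑ k, c k * Z ω k : ℝ)) ∂Q))) :
    TendstoInDistribution X l Z (fun _ => P) Q := by
  have hm : Measurable (WithLp.toLp 2 : (κ → ℝ) → EuclideanSpace ℝ κ) := by fun_prop
  have h1 : TendstoInDistribution (fun i ω => (WithLp.toLp 2 (X i ω) : EuclideanSpace ℝ κ)) l
      (fun ω => (WithLp.toLp 2 (Z ω) : EuclideanSpace ℝ κ)) (fun _ => P) Q := by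
    refine tendstoInDistribution_of_integral_exp_inner (fun i => hm.comp_aemeasurable (hX i))
      (hm.comp_aemeasurable hZ) fun t => ?_
    simpa [PiLp.inner_apply, mul_comm] using h t
  exact h1.continuous_comp (g := WithLp.ofLp) (by fun_prop)

end Levy

section Hilbert

variable {H κ : Type*} [NormedAddCommGroup H] [InnerProductSpace ℝ H]

lemma Orthonormal.countable_of_separable [TopologicalSpace.SeparableSpace H] {v : κ → H}
    (hv : Orthonormal ℝ v) : Countable κ := by
  refine Pairwise.countable_of_isOpen_disjoint (s := fun k => Metric.ball (v k) (1 / 2)) ?_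
    (fun k => Metric.isOpen_ball) fun k => ⟨v k, Metric.mem_ball_self (by norm_num)⟩
  intro i j hij
  refine Metric.ball_disjoint_ball ?_
  have h : dist (v i) (v j) ^ 2 = 2 := by
    rw [dist_eq_norm, norm_sub_sq_real, hv.1 i, hv.1 j, hv.2 hij]
    norm_num
  nlinarith [dist_nonneg (x := v i) (y := v j)]

lemma HilbertBasis.hasSum_inner_sq (b : HilbertBasis κ ℝ H) (x : H) :
    HasSum (fun k => inner ℝ (b k) x ^ 2) (‖x‖ ^ 2) := by
  have := b.hasSum_inner_mul_inner x x
  rw [real_inner_self_eq_norm_sq] at this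
  refine this.congr_fun fun k => ?_
  rw [real_inner_comm x, sq]

/-- The coordinates outside of a finite set. -/
lemma HilbertBasis.hasSum_sub_sum (b : HilbertBasis κ ℝ H) (A : Finset κ) (x : H) :
    HasSum (fun k : {k // k ∉ A} => inner ℝ (b k) x ^ 2)
      (‖x - ∑ k ∈ A, inner ℝ (b k) x • b k‖ ^ 2) := by
  classical
  have h : ∀ k, inner ℝ (b k) (x - ∑ j ∈ A, inner ℝ (b j) x • b j) ^ 2
      = Set.indicator {k | k ∉ A} (fun k => inner ℝ (b k) x ^ 2) k := by
    intro k
    rw [inner_sub_right, inner_sum]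
    simp only [inner_smul_right, orthonormal_iff_ite.1 b.orthonormal]
    by_cases hk : k ∈ A <;> simp [hk]
  have h2 := b.hasSum_inner_sq (x - ∑ k ∈ A, inner ℝ (b k) x • b k)
  simp only [h] at h2
  exact hasSum_subtype_iff_indicator.2 h2

variable [MeasurableSpace H] [BorelSpace H] {Ω : Type*} [MeasurableSpace Ω] {P : Measure Ω}
  [IsProbabilityMeasure P]

/-- A bound on the error made by truncating the coordinates of a random vector in the expectation
of a Lipschitz function. -/
lemma abs_integral_sub_integral_truncate_le [Countable κ] [SecondCountableTopology H]
    (b : HilbertBasis κ ℝ H) {F : Ω → H}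
    (hF : AEMeasurable F P) {s : κ → ℝ} (hs0 : ∀ k, 0 ≤ s k) (hs : Summable s)
    (hFs : ∀ k, ∫⁻ ω, ENNReal.ofReal (inner ℝ (b k) (F ω) ^ 2) ∂P ≤ ENNReal.ofReal (s k))
    {f : H → ℝ} {C : ℝ} (hC : ∀ x, |f x| ≤ C) {L : ℝ≥0} (hf : LipschitzWith L f) {η : ℝ}
    (hη : 0 < η) (A : Finset κ) (hA : ∑' k : {k // k ∉ A}, s k ≤ η ^ 2) :
    |∫ ω, f (F ω) ∂P - ∫ ω, f (∑ k ∈ A, inner ℝ (b k) (F ω) • b k) ∂P| ≤ L * (2 * η) := by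
  set R : Ω → H := fun ω => F ω - ∑ k ∈ A, inner ℝ (b k) (F ω) • b k with hR
  have hm : AEMeasurable (fun ω => ∑ k ∈ A, inner ℝ (b k) (F ω) • b k) P :=
    Finset.aemeasurable_fun_sum _ fun k _ => by fun_prop
  have hRm : AEMeasurable R P := hF.sub hm
  have h1 : ∫⁻ ω, ENNReal.ofReal (‖R ω‖ ^ 2) ∂P ≤ ENNReal.ofReal (η ^ 2) := by
    have h2 : ∀ ω, ENNReal.ofReal (‖R ω‖ ^ 2)
        = ∑' k : {k // k ∉ A}, ENNReal.ofReal (inner ℝ (b k) (F ω) ^ 2) := fun ω => by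
      rw [hR, ← (b.hasSum_sub_sum A (F ω)).tsum_eq,
        ENNReal.ofReal_tsum_of_nonneg (fun _ => sq_nonneg _) (b.hasSum_sub_sum A (F ω)).summable]
    simp only [h2]
    rw [lintegral_tsum fun k => by fun_prop]
    refine (ENNReal.tsum_le_tsum fun k : {k // k ∉ A} => hFs k).trans ?_
    rw [← ENNReal.ofReal_tsum_of_nonneg (fun k => hs0 _) (hs.subtype _)]
    exact ENNReal.ofReal_le_ofReal hA
  have hRi : Integrable (fun ω => ‖R ω‖ ^ 2) P := by
    refine ⟨by fun_prop, ?_⟩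
    rw [hasFiniteIntegral_iff_ofReal (ae_of_all _ fun ω => by positivity)]
    exact h1.trans_lt ENNReal.ofReal_lt_top
  have h3 : ∫ ω, ‖R ω‖ ^ 2 ∂P ≤ η ^ 2 := by
    rw [← ofReal_integral_eq_lintegral_ofReal hRi (ae_of_all _ fun ω => by positivity)] at h1
    exact (ENNReal.ofReal_le_ofReal_iff (by positivity)).1 h1
  have hfi : ∀ {Y : Ω → H}, AEMeasurable Y P → Integrable (fun ω => f (Y ω)) P := fun hY =>
    Integrable.of_bound (C := C)
      (hf.continuous.measurable.comp_aemeasurable hY).aestronglyMeasurable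
      (ae_of_all _ fun ω => hC _)
  rw [← integral_sub (hfi hF) (hfi hm), ← Real.norm_eq_abs]
  have hi : Integrable (fun ω => L * (η + ‖R ω‖ ^ 2 / η)) P :=
    ((integrable_const _).add (hRi.div_const _)).const_mul _
  refine (norm_integral_le_of_norm_le hi (ae_of_all _ fun ω => ?_)).trans ?_
  · -- `‖R‖ ≤ η + ‖R‖² / η` spares the use of the Cauchy–Schwarz inequality
    refine (hf.norm_sub_le _ _).trans (mul_le_mul_of_nonneg_left ?_ L.2)
    change ‖R ω‖ ≤ _
    rw [← sub_le_iff_le_add', le_div_iff₀ hη]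
    nlinarith [sq_nonneg (‖R ω‖ - η)]
  · rw [integral_const_mul, integral_add (integrable_const _) (hRi.div_const _), integral_div]
    refine mul_le_mul_of_nonneg_left ?_ L.2
    have : (∫ ω, ‖R ω‖ ^ 2 ∂P) / η ≤ η := by
      rw [div_le_iff₀ hη]; nlinarith
    simp only [integral_const, probReal_univ, smul_eq_mul, one_mul]
    linarith

/-- In a separable Hilbert space, pointwise convergence of the characteristic functions implies
convergence in distribution, provided that the second moments of the coordinates with respect to
some orthonormal basis are bounded by a summable sequence. -/
theorem tendstoInDistribution_hilbert [CompleteSpace H] [SecondCountableTopology H]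
    (b : HilbertBasis κ ℝ H)
    {Ω' ι : Type*} [MeasurableSpace Ω'] {Q : Measure Ω'} [IsProbabilityMeasure Q] {l : Filter ι}
    [l.IsCountablyGenerated] {F : ι → Ω → H} {G : Ω' → H} (hF : ∀ i, AEMeasurable (F i) P)
    (hG : AEMeasurable G Q)
    (hchar : ∀ g, Tendsto (fun i => ∫ ω, Complex.exp (Complex.I * (inner ℝ g (F i ω) : ℝ)) ∂P) l
      (𝓝 (∫ ω, Complex.exp (Complex.I * (inner ℝ g (G ω) : ℝ)) ∂Q)))
    {s : κ → ℝ} (hs0 : ∀ k, 0 ≤ s k) (hs : Summable s)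
    (hFs : ∀ᶠ i in l, ∀ k, ∫⁻ ω, ENNReal.ofReal (inner ℝ (b k) (F i ω) ^ 2) ∂P
      ≤ ENNReal.ofReal (s k))
    (hGs : ∀ k, ∫⁻ ω, ENNReal.ofReal (inner ℝ (b k) (G ω) ^ 2) ∂Q ≤ ENNReal.ofReal (s k)) :
    TendstoInDistribution F l G (fun _ => P) Q := by
  have : Countable κ := b.orthonormal.countable_of_separable
  -- finitely many coordinates converge by the Cramér–Wold device
  have hfinite : ∀ A : Finset κ, TendstoInDistribution
      (fun i ω => ∑ k ∈ A, inner ℝ (b k) (F i ω) • b k) l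
      (fun ω => ∑ k ∈ A, inner ℝ (b k) (G ω) • b k) (fun _ => P) Q := by
    intro A
    have h1 : TendstoInDistribution (fun i ω (k : A) => inner ℝ (b k) (F i ω)) l
        (fun ω (k : A) => inner ℝ (b k) (G ω)) (fun _ => P) Q := by
      refine tendstoInDistribution_pi_of_integral_exp (fun i => aemeasurable_pi_lambda _ fun k => by
        fun_prop) (aemeasurable_pi_lambda _ fun k => by fun_prop) fun c => ?_
      simpa [sum_inner, inner_smul_left] using hchar (∑ k : A, c k • b k)
    have h2 := h1.continuous_comp (g := fun c : A → ℝ => ∑ k : A, c k • b k) (by fun_prop)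
    have h3 : ∀ x : H, ∑ k ∈ A, inner ℝ (b k) x • b k = ∑ k : A, inner ℝ (b k) x • b k := fun x =>
      (Finset.sum_coe_sort A fun k => inner ℝ (b k) x • b k).symm
    simp only [h3]
    exact h2
  refine ⟨hF, hG, tendsto_iff_forall_lipschitz_integral_tendsto.2 ?_⟩
  rintro f ⟨C, hC⟩ ⟨L, hL⟩
  have hbd : ∀ x, |f x| ≤ C + |f 0| := fun x => by
    have := hC x 0
    rw [Real.dist_eq] at this
    have h2 := abs_sub_abs_le_abs_sub (f x) (f 0)
    linarith
  have hfm := hL.continuous.measurable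
  simp only [ProbabilityMeasure.coe_mk]
  rw [integral_map hG hfm.aestronglyMeasurable]
  simp only [integral_map (hF _) hfm.aestronglyMeasurable]
  refine Metric.tendsto_nhds.2 fun ε hε => ?_
  set η : ℝ := ε / (8 * (L + 1)) with hη
  have hη0 : 0 < η := by positivity
  have hLη : L * (2 * η) ≤ ε / 4 := by
    rw [hη]
    have hL0 : (0 : ℝ) ≤ L := L.2
    rw [show (L : ℝ) * (2 * (ε / (8 * (L + 1)))) = ε / 4 * (L / (L + 1)) by field_simp; ring]
    exact mul_le_of_le_one_right (by positivity) ((div_le_one (by positivity)).2 (by linarith))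
  obtain ⟨A, hA⟩ : ∃ A : Finset κ, ∑' k : {k // k ∉ A}, s k ≤ η ^ 2 :=
    ((tendsto_order.1 (tendsto_tsum_compl_atTop_zero s)).2 (η ^ 2) (by positivity)).exists.imp
      fun _ h => h.le
  have h1 := (hfinite A).tendsto
  have h2 := tendsto_iff_forall_lipschitz_integral_tendsto.1 h1 f ⟨C, hC⟩ ⟨L, hL⟩
  simp only [ProbabilityMeasure.coe_mk] at h2
  rw [integral_map (hfinite A).aemeasurable_limit hfm.aestronglyMeasurable] at h2
  simp only [integral_map ((hfinite A).forall_aemeasurable _) hfm.aestronglyMeasurable] at h2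
  filter_upwards [hFs, Metric.tendsto_nhds.1 h2 (ε / 4) (by positivity)] with i hi h3
  have h4 := abs_integral_sub_integral_truncate_le b (hF i) hs0 hs hi hbd hL hη0 A hA
  have h5 := abs_integral_sub_integral_truncate_le b hG hs0 hs hGs hbd hL hη0 A hA
  rw [Real.dist_eq] at h3 ⊢
  rw [abs_lt] at h3 ⊢
  rw [abs_le] at h4 h5
  constructor <;> linarith

end Hilbert

/-! ### The spectral representation of the limit covariance -/

/-- The real vector space of all windows. -/
def windowSpace : Submodule ℝ (ℝ → ℝ) where
  carrier := {f | ∃ V, IsWindow f V}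
  add_mem' := by
    rintro f g ⟨V, hf⟩ ⟨W, hg⟩
    exact ⟨V + W, hf.add hg⟩
  zero_mem' := ⟨0, IsWindow.zero⟩
  smul_mem' := by
    rintro c f ⟨V, hf⟩
    exact ⟨|c| * V, hf.const_mul c⟩

lemma windowSpace.integrable (f : windowSpace) : Integrable (f : ℝ → ℝ) :=
  f.2.choose_spec.integrable

/-- The Fourier transform of `f`, weighted by `|v| ^ (α / 2)`. -/
noncomputable def spectral (α : ℝ) (f : ℝ → ℝ) (v : ℝ) : ℂ :=
  ((|v| ^ (α / 2) : ℝ) : ℂ) * fourierHat f v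

lemma rpow_half_mul_rpow_half (α v : ℝ) : |v| ^ (α / 2) * |v| ^ (α / 2) = |v| ^ α := by
  rw [← sq, ← Real.rpow_natCast, ← Real.rpow_mul (abs_nonneg v)]
  congr 1
  push_cast
  ring

lemma conj_spectral_mul_spectral (α : ℝ) (f g : ℝ → ℝ) (v : ℝ) :
    starRingEnd ℂ (spectral α f v) * spectral α g v
      = starRingEnd ℂ (fourierHat f v) * fourierHat g v * ((|v| ^ α : ℝ) : ℂ) := by
  rw [spectral, spectral, map_mul, Complex.conj_ofReal, ← rpow_half_mul_rpow_half α v]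
  push_cast
  ring

lemma sq_norm_spectral (α : ℝ) (f : ℝ → ℝ) (v : ℝ) :
    ‖spectral α f v‖ ^ 2 = ‖fourierHat f v‖ ^ 2 * |v| ^ α := by
  rw [spectral, norm_mul, Complex.norm_real, Real.norm_eq_abs, abs_of_nonneg (by positivity),
    mul_pow, sq (|v| ^ (α / 2)), rpow_half_mul_rpow_half, mul_comm]

lemma IsWindow.memLp_spectral {f : ℝ → ℝ} {V α : ℝ} (hf : IsWindow f V) (hα₀ : 0 < α)
    (hα₁ : α < 1) : MemLp (spectral α f) 2 := by
  have hm : Measurable (spectral α f) := by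
    have := (continuous_fourierHat hf.integrable).measurable
    unfold spectral
    fun_prop
  rw [memLp_two_iff_integrable_sq_norm hm.aestronglyMeasurable]
  simp only [sq_norm_spectral]
  exact hf.integrable_sq_norm_fourierHat_mul_rpow hα₀ hα₁

section

variable {α : ℝ} (hα₀ : 0 < α) (hα₁ : α < 1)

/-- The linear map `f ↦ |v| ^ (α / 2) f̂(v)` from windows to `L²(ℝ; ℂ)`, the latter considered
as a real Hilbert space. -/
noncomputable def spectralMap : windowSpace →ₗ[ℝ] Lp ℂ 2 (volume : Measure ℝ) where
  toFun f := (f.2.choose_spec.memLp_spectral hα₀ hα₁).toLp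
  map_add' f g := by
    rw [← MemLp.toLp_add]
    refine MemLp.toLp_congr _ _ (ae_of_all _ fun v => ?_)
    rw [Pi.add_apply, spectral, spectral, spectral, ← mul_add,
      ← fourierHat_add (windowSpace.integrable f) (windowSpace.integrable g)]
    rfl
  map_smul' c f := by
    rw [RingHom.id_apply, ← MemLp.toLp_const_smul]
    refine MemLp.toLp_congr _ _ (ae_of_all _ fun v => ?_)
    rw [Pi.smul_apply, spectral, spectral, Complex.real_smul, mul_left_comm,
      ← fourierHat_const_mul c f]
    rfl

lemma coeFn_spectralMap (f : windowSpace) : spectralMap hα₀ hα₁ f =ᵐ[volume] spectral α f :=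
  (f.2.choose_spec.memLp_spectral hα₀ hα₁).coeFn_toLp

lemma inner_spectralMap (f g : windowSpace) :
    inner ℝ (spectralMap hα₀ hα₁ f) (spectralMap hα₀ hα₁ g)
      = ∫ v, (starRingEnd ℂ (fourierHat f v) * fourierHat g v).re * |v| ^ α := by
  rw [L2.inner_def]
  refine integral_congr_ae ?_
  filter_upwards [coeFn_spectralMap hα₀ hα₁ f, coeFn_spectralMap hα₀ hα₁ g] with v h1 h2
  rw [h1, h2, Complex.inner, mul_comm, conj_spectral_mul_spectral, Complex.re_mul_ofReal]

lemma limitVar_eq_norm_spectralMap (k : ℕ) (f : windowSpace) :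
    limitVar α k f = k / Real.pi * ‖spectralMap hα₀ hα₁ f‖ ^ 2 := by
  rw [← real_inner_self_eq_norm_sq, inner_spectralMap, limitVar]
  congr 2 with v
  rw [mul_comm (starRingEnd ℂ _), Complex.mul_conj, Complex.ofReal_re, Complex.normSq_eq_norm_sq]

end

/-! ### Fourier transforms of the window families -/

/-- The constant `∫ (1 - cos v) |v| ^ (α - 2) dv`, which is finite for `0 < α < 1`. -/
noncomputable def cosConst (α : ℝ) : ℝ := ∫ v : ℝ, (1 - Real.cos v) * |v| ^ (α - 2)

/-- The transform of an indicator function, multiplied by `i v` so that no division by `v`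
occurs. -/
lemma fourierHat_indicator_Icc {a b : ℝ} (hab : a ≤ b) (v : ℝ) :
    Complex.I * v * fourierHat ((Set.Icc a b).indicator 1) v
      = Complex.exp (Complex.I * v * b) - Complex.exp (Complex.I * v * a) := by
  rcases eq_or_ne v 0 with rfl | hv
  · simp
  have hc : Complex.I * v ≠ 0 := mul_ne_zero Complex.I_ne_zero (by exact_mod_cast hv)
  have h1 : fourierHat ((Set.Icc a b).indicator 1) v
      = ∫ y in a..b, Complex.exp (Complex.I * v * y) := by
    rw [intervalIntegral.integral_of_le hab, ← integral_Icc_eq_integral_Ioc,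
      ← integral_indicator measurableSet_Icc, fourierHat]
    congr 1 with y
    by_cases hy : y ∈ Set.Icc a b <;> simp [hy]
  rw [h1, integral_exp_mul_complex hc, mul_div_cancel₀ _ hc]

lemma rpow_eq_sq_mul_rpow_sub_two (α : ℝ) {v : ℝ} (hv : v ≠ 0) :
    |v| ^ α = v ^ 2 * |v| ^ (α - 2) := by
  rw [← sq_abs, ← Real.rpow_natCast, ← Real.rpow_add (abs_pos.2 hv)]
  congr 1
  push_cast
  ring

/-- The inner product of two transforms, in terms of the transforms of the derivatives. -/
lemma conj_mul_rpow_eq (α : ℝ) {v : ℝ} (hv : v ≠ 0) (a b : ℂ) :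
    (starRingEnd ℂ a * b).re * |v| ^ α
      = (starRingEnd ℂ (Complex.I * v * a) * (Complex.I * v * b)).re * |v| ^ (α - 2) := by
  have h : starRingEnd ℂ (Complex.I * v * a) * (Complex.I * v * b)
      = starRingEnd ℂ a * b * ((v ^ 2 : ℝ) : ℂ) := by
    simp only [map_mul, Complex.conj_I, Complex.conj_ofReal]
    push_cast
    linear_combination (-(v : ℂ) ^ 2 * starRingEnd ℂ a * b) * Complex.I_sq
  rw [h, Complex.re_mul_ofReal, rpow_eq_sq_mul_rpow_sub_two α hv, mul_assoc]

lemma one_sub_cos_mul_rpow_scale (α : ℝ) {x : ℝ} (hx : x ≠ 0) (v : ℝ) :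
    (1 - Real.cos (x * v)) * |v| ^ (α - 2)
      = |x| ^ (2 - α) * ((1 - Real.cos (x * v)) * |x * v| ^ (α - 2)) := by
  have h : |x| ^ (2 - α) * |x| ^ (α - 2) = 1 := by
    rw [← Real.rpow_add (abs_pos.2 hx)]
    simp
  rw [abs_mul, Real.mul_rpow (abs_nonneg _) (abs_nonneg _)]
  linear_combination (-(1 - Real.cos (x * v)) * |v| ^ (α - 2)) * h

section

variable {α : ℝ} (hα₀ : 0 < α) (hα₁ : α < 1)
include hα₀ hα₁

lemma integrable_one_sub_cos_mul_rpow :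
    Integrable fun v : ℝ => (1 - Real.cos v) * |v| ^ (α - 2) := by
  -- up to a factor, this is the weighted squared transform of the indicator function of `[0, 1]`
  have h := ((IsWindow.indicator_Icc 0 1).integrable_sq_norm_fourierHat_mul_rpow
    hα₀ hα₁).div_const 2
  refine h.congr ?_
  filter_upwards [Measure.ae_ne volume 0] with v hv
  have h1 := conj_mul_rpow_eq α hv (fourierHat ((Set.Icc 0 1).indicator 1) v)
    (fourierHat ((Set.Icc 0 1).indicator 1) v)
  rw [fourierHat_indicator_Icc zero_le_one, mul_comm (starRingEnd ℂ _), Complex.mul_conj,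
    mul_comm (starRingEnd ℂ _), Complex.mul_conj, Complex.ofReal_re, Complex.ofReal_re,
    Complex.normSq_eq_norm_sq] at h1
  rw [h1, Complex.normSq_apply]
  simp only [Complex.sub_re, Complex.sub_im, Complex.exp_re, Complex.exp_im]
  simp
  linear_combination (|v| ^ (α - 2) / 2) * Real.sin_sq_add_cos_sq v

lemma cosConst_pos : 0 < cosConst α := by
  refine (integral_pos_iff_support_of_nonneg (fun v => ?_)
    (integrable_one_sub_cos_mul_rpow hα₀ hα₁)).2 ?_
  · exact mul_nonneg (by linarith [Real.cos_le_one v]) (by positivity)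
  · refine lt_of_lt_of_le (b := volume (Set.Ioo (0 : ℝ) 1)) (by simp) (measure_mono fun v hv => ?_)
    have h1 : Real.cos v < 1 := by
      have := Real.cos_lt_cos_of_nonneg_of_le_pi (x := 0) (y := v) le_rfl
        (by linarith [Real.pi_gt_three, hv.2]) hv.1
      simpa using this
    have h2 : 0 < |v| := abs_pos.2 hv.1.ne'
    exact (mul_pos (by linarith) (by positivity)).ne'

lemma integrable_one_sub_cos_mul_mul_rpow (x : ℝ) :
    Integrable fun v : ℝ => (1 - Real.cos (x * v)) * |v| ^ (α - 2) := by
  rcases eq_or_ne x 0 with rfl | hx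
  · simp
  simp only [one_sub_cos_mul_rpow_scale α hx]
  exact ((integrable_one_sub_cos_mul_rpow hα₀ hα₁).comp_mul_left' hx).const_mul _

end

/-- Scaling `v ↦ x v` produces the power `|x| ^ (1 - α) = |x| ^ (2 H)` in the covariances. -/
lemma integral_one_sub_cos_mul_mul_rpow {α : ℝ} (hα₁ : α < 1) (x : ℝ) :
    ∫ v : ℝ, (1 - Real.cos (x * v)) * |v| ^ (α - 2) = cosConst α * |x| ^ (1 - α) := by
  rcases eq_or_ne x 0 with rfl | hx
  · simp [Real.zero_rpow (by linarith : 1 - α ≠ 0)]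
  simp only [one_sub_cos_mul_rpow_scale α hx]
  rw [integral_const_mul,
    Measure.integral_comp_mul_left (fun v => (1 - Real.cos v) * |v| ^ (α - 2)) x, smul_eq_mul,
    ← mul_assoc, mul_comm (cosConst α), cosConst]
  congr 1
  rw [abs_inv, show 2 - α = 1 + (1 - α) by ring, Real.rpow_add (abs_pos.2 hx), Real.rpow_one]
  field_simp

/-! ### The window families and fractional covariances -/

/-- The spectral inner product of two windows whose derivatives have a transform product that is a
combination of cosines. -/
lemma inner_spectralMap_of_cos {α : ℝ} (hα₀ : 0 < α) (hα₁ : α < 1) (f g : windowSpace)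
    (a b c s t : ℝ)
    (h : ∀ v : ℝ, (starRingEnd ℂ (Complex.I * v * fourierHat f v)
      * (Complex.I * v * fourierHat g v)).re
        = a * ((1 - Real.cos (s * v)) + (1 - Real.cos (t * v)))
          + b * (1 - Real.cos ((s + t) * v)) + c * (1 - Real.cos ((t - s) * v))) :
    inner ℝ (spectralMap hα₀ hα₁ f) (spectralMap hα₀ hα₁ g)
      = cosConst α * (a * (|s| ^ (1 - α) + |t| ^ (1 - α)) + b * |s + t| ^ (1 - α)
          + c * |t - s| ^ (1 - α)) := by
  have hi := integrable_one_sub_cos_mul_mul_rpow hα₀ hα₁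
  have h1 : inner ℝ (spectralMap hα₀ hα₁ f) (spectralMap hα₀ hα₁ g)
      = ∫ v : ℝ, (a * ((1 - Real.cos (s * v)) * |v| ^ (α - 2)
          + (1 - Real.cos (t * v)) * |v| ^ (α - 2))
          + b * ((1 - Real.cos ((s + t) * v)) * |v| ^ (α - 2))
          + c * ((1 - Real.cos ((t - s) * v)) * |v| ^ (α - 2))) := by
    rw [inner_spectralMap]
    refine integral_congr_ae ?_
    filter_upwards [Measure.ae_ne volume 0] with v hv
    rw [conj_mul_rpow_eq α hv, h v]
    ring
  have hst : Integrable fun v : ℝ => (1 - Real.cos (s * v)) * |v| ^ (α - 2)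
      + (1 - Real.cos (t * v)) * |v| ^ (α - 2) := (hi s).add (hi t)
  have hab : Integrable fun v : ℝ => a * ((1 - Real.cos (s * v)) * |v| ^ (α - 2)
      + (1 - Real.cos (t * v)) * |v| ^ (α - 2))
      + b * ((1 - Real.cos ((s + t) * v)) * |v| ^ (α - 2)) :=
    (hst.const_mul a).add ((hi (s + t)).const_mul b)
  rw [h1, integral_add hab ((hi (t - s)).const_mul c),
    integral_add (hst.const_mul a) ((hi (s + t)).const_mul b),
    integral_const_mul, integral_const_mul, integral_const_mul, integral_add (hi s) (hi t)]
  simp only [integral_one_sub_cos_mul_mul_rpow hα₁]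
  ring

namespace WindowFamily

lemma exists_isWindow (w : WindowFamily) (t : ℝ≥0) : ∃ V, IsWindow (w.ψ t) V := by
  cases w
  · exact ⟨_, IsWindow.indicator_Icc 0 t⟩
  · exact ⟨_, (IsWindow.indicator_Icc 0 t).sub (IsWindow.indicator_Icc (-t) 0)⟩
  · exact ⟨_, IsWindow.indicator_Icc (-t) t⟩

/-- The function `ψ_t` of a window family as an element of the space of windows. -/
noncomputable def window (w : WindowFamily) (t : ℝ≥0) : windowSpace :=
  ⟨w.ψ t, w.exists_isWindow t⟩

lemma fourierHat_oneSided (t : ℝ≥0) (v : ℝ) :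
    Complex.I * v * fourierHat (oneSided.ψ t) v = Complex.exp (Complex.I * v * t) - 1 := by
  refine Eq.trans (fourierHat_indicator_Icc t.2 v) ?_
  simp

lemma fourierHat_symmetric (t : ℝ≥0) (v : ℝ) :
    Complex.I * v * fourierHat (symmetric.ψ t) v
      = Complex.exp (Complex.I * v * t) - Complex.exp (Complex.I * v * (-t : ℝ)) :=
  fourierHat_indicator_Icc (neg_le_self t.2) v

lemma fourierHat_odd (t : ℝ≥0) (v : ℝ) :
    Complex.I * v * fourierHat (odd.ψ t) v
      = Complex.exp (Complex.I * v * t) - 1 - (1 - Complex.exp (Complex.I * v * (-t : ℝ))) := by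
  have h1 := fourierHat_indicator_Icc t.2 v
  have h2 := fourierHat_indicator_Icc (neg_nonpos.2 t.2) v
  have h3 : fourierHat (odd.ψ t) v = fourierHat ((Set.Icc 0 (t : ℝ)).indicator 1) v
      + ((-1 : ℝ) : ℂ) * fourierHat ((Set.Icc (-(t : ℝ)) 0).indicator 1) v := by
    rw [← fourierHat_const_mul, ← fourierHat_add (IsWindow.indicator_Icc 0 t).integrable
      ((IsWindow.indicator_Icc (-t) 0).integrable.const_mul _)]
    congr 1
    ext x
    simp only [WindowFamily.ψ]
    ring
  rw [h3, mul_add, mul_left_comm]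
  change Complex.I * v * fourierHat ((Set.Icc 0 (t : ℝ)).indicator 1) v = _ at h1
  rw [h1]
  change Complex.I * v * fourierHat ((Set.Icc (-(t : ℝ)) 0).indicator 1) v = _ at h2
  rw [h2]
  simp
  ring

/-- The proportionality constant between the spectral inner product and the covariance function of
the limit process. -/
noncomputable def covConst (w : WindowFamily) (α : ℝ) : ℝ :=
  match w with
  | .oneSided => 2 * cosConst α
  | .odd => 4 * cosConst α / (1 - (1 - α) / 2)
  | .symmetric => 2 * cosConst α

lemma covConst_pos (w : WindowFamily) {α : ℝ} (hα₀ : 0 < α) (hα₁ : α < 1) : 0 < w.covConst α := by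
  have h := cosConst_pos hα₀ hα₁
  cases w
  · exact mul_pos two_pos h
  · exact div_pos (mul_pos four_pos h) (by linarith)
  · exact mul_pos two_pos h

lemma inner_spectralMap_window (w : WindowFamily) {α : ℝ} (hα₀ : 0 < α) (hα₁ : α < 1)
    (s t : ℝ≥0) :
    inner ℝ (spectralMap hα₀ hα₁ (w.window s)) (spectralMap hα₀ hα₁ (w.window t))
      = w.covConst α * w.cov ((1 - α) / 2) s t := by
  have hs : |(s : ℝ)| = s := abs_of_nonneg s.2
  have ht : |(t : ℝ)| = t := abs_of_nonneg t.2
  have hst : |(s : ℝ) + t| = s + t := abs_of_nonneg (by positivity)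
  have hH : 2 * ((1 - α) / 2) = 1 - α := by ring
  cases w
  · rw [inner_spectralMap_of_cos hα₀ hα₁ _ _ 1 0 (-1) s t]
    · rw [hs, ht, covConst, cov, hH]
      ring
    · intro v
      simp only [window, fourierHat_oneSided]
      rw [sub_mul, Real.cos_sub]
      simp [Complex.exp_re, Complex.exp_im, mul_comm v]
      ring
  · rw [inner_spectralMap_of_cos hα₀ hα₁ _ _ 4 (-2) (-2) s t]
    · have : (1 - (1 - α) / 2) ≠ 0 := by linarith
      rw [hs, ht, hst, covConst, cov, hH, ← mul_assoc, div_mul_cancel₀ _ this]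
      ring
    · intro v
      simp only [window, fourierHat_odd]
      rw [sub_mul, Real.cos_sub, add_mul, Real.cos_add]
      simp [Complex.exp_re, Complex.exp_im, mul_comm v]
      ring
  · rw [inner_spectralMap_of_cos hα₀ hα₁ _ _ 0 2 (-2) s t]
    · rw [hst, covConst, cov, hH]
      ring
    · intro v
      simp only [window, fourierHat_symmetric]
      rw [sub_mul, Real.cos_sub, add_mul, Real.cos_add]
      simp [Complex.exp_re, Complex.exp_im, mul_comm v]
      ring

end WindowFamily

/-! ### Finite-dimensional distributions -/

/-- The linear combinations of a centered Gaussian process. -/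
lemma IsCenteredGaussianProcess.integral_exp_sum {Ω : Type*} [MeasurableSpace Ω]
    {X : ℝ≥0 → Ω → ℝ} {C : ℝ≥0 → ℝ≥0 → ℝ} {Q : Measure Ω} [IsProbabilityMeasure Q]
    (hX : IsCenteredGaussianProcess X C Q) (I : Finset ℝ≥0) (c : I → ℝ) :
    ∫ ω, Complex.exp (Complex.I * (∑ t : I, c t * X t ω : ℝ)) ∂Q
      = ((Real.exp (-(∑ s : I, ∑ t : I, c s * c t * C s t) / 2) : ℝ) : ℂ) := by
  have hL2 : ∀ t, MemLp (X t) 2 Q := fun t => (hX.gaussian.hasGaussianLaw_eval t).memLp_two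
  have hint : ∀ t, Integrable (X t) Q := fun t => (hL2 t).integrable (by norm_num)
  let L : (I → ℝ) →L[ℝ] ℝ := ∑ t : I, c t • ContinuousLinearMap.proj t
  have hL : ∀ ω, L (I.restrict fun t => X t ω) = ∑ t : I, c t * X t ω := fun ω => by
    simp [L]
  have hg : HasGaussianLaw (fun ω => ∑ t : I, c t * X t ω) Q := by
    have := (hX.gaussian.hasGaussianLaw I).map_fun L
    simpa only [hL] using this
  have hmean : ∫ ω, ∑ t : I, c t * X t ω ∂Q = 0 := by
    rw [integral_finsetSum _ fun (t : I) _ => (hint t).const_mul (c t)]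
    simp [integral_const_mul, hX.centered]
  have hvar : Var[fun ω => ∑ t : I, c t * X t ω; Q] = ∑ s : I, ∑ t : I, c s * c t * C s t := by
    rw [variance_of_integral_eq_zero hg.aemeasurable hmean]
    have h1 : ∀ ω, (∑ t : I, c t * X t ω) ^ 2
        = ∑ s : I, ∑ t : I, c s * c t * (X s ω * X t ω) := fun ω => by
      rw [sq, Finset.sum_mul_sum]
      refine Finset.sum_congr rfl fun s _ => Finset.sum_congr rfl fun t _ => by ring
    have h2 : ∀ s t : I, Integrable (fun ω => c s * c t * (X s ω * X t ω)) Q := fun s t =>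
      ((hL2 s).integrable_mul (hL2 t)).const_mul _
    simp only [h1]
    rw [integral_finsetSum _ fun s _ => integrable_finsetSum _ fun t _ => h2 s t]
    refine Finset.sum_congr rfl fun s _ => ?_
    rw [integral_finsetSum _ fun t _ => h2 s t]
    refine Finset.sum_congr rfl fun t _ => ?_
    rw [integral_const_mul, hX.covariance]
  have h1 := charFun_gaussianReal (μ := 0) (v := (Var[fun ω => ∑ t : I, c t * X t ω; Q]).toNNReal) 1
  have h2 := hg.map_eq_gaussianReal
  rw [hmean] at h2
  rw [← h2, charFun_map_eq_integral hg.aemeasurable] at h1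
  rw [← hvar]
  refine Eq.trans ?_ (h1.trans ?_)
  · congr 1 with ω
    simp
  · rw [Real.coe_toNNReal _ (variance_nonneg _ _)]
    push_cast
    congr 1
    ring

/-- A Hilbert space valued function `h` whose inner products are `C` yields a centered Gaussian
process with covariance function `C`. -/
lemma exists_isCenteredGaussianProcess {K : Type} [NormedAddCommGroup K] [InnerProductSpace ℝ K]
    [CompleteSpace K] {C : ℝ≥0 → ℝ≥0 → ℝ} (h : ℝ≥0 → K) (hC : ∀ s t, inner ℝ (h s) (h t) = C s t) :
    ∃ (Ω' : Type) (_ : MeasurableSpace Ω') (Q : Measure Ω') (X : ℝ≥0 → Ω' → ℝ),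
      IsProbabilityMeasure Q ∧ IsCenteredGaussianProcess X C Q := by
  obtain ⟨Ω, _, Q, hQ, W, hW⟩ := exists_isonormal K
  have hWg : ∀ x, Q.map (W x) = gaussianReal 0 (‖x‖₊ ^ 2) := fun x => by
    refine map_eq_gaussianReal_of_integral_exp (Lp.aestronglyMeasurable _).aemeasurable _
      fun u => ?_
    have h1 := hW (u • x)
    rw [norm_smul, mul_pow, Real.norm_eq_abs, sq_abs] at h1
    refine Eq.trans (integral_congr_ae ?_) h1
    filter_upwards [Lp.coeFn_smul u (W x)] with ω hω
    rw [map_smul, hω]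
    simp
  have hmeas : ∀ t, AEMeasurable (W (h t)) Q := fun t => (Lp.aestronglyMeasurable _).aemeasurable
  refine ⟨Ω, inferInstance, Q, fun t => W (h t), hQ, ⟨fun I => ⟨?_⟩⟩, fun t => ?_, fun s t => ?_⟩
  · have hm : AEMeasurable (fun ω => I.restrict fun t => W (h t) ω) Q :=
      aemeasurable_pi_lambda _ fun t => hmeas t
    refine isGaussian_of_map_eq_gaussianReal fun L =>
      ⟨0, ‖∑ t : I, L (Pi.single t 1) • h t‖₊ ^ 2, ?_⟩
    rw [AEMeasurable.map_map_of_aemeasurable (by fun_prop) hm, ← hWg]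
    refine Measure.map_congr ?_
    have h1 : ∀ᵐ ω ∂Q, ∀ t ∈ (Finset.univ : Finset I), (L (Pi.single t 1) • W (h t)) ω
        = L (Pi.single t 1) * W (h t) ω := by
      refine (Finset.eventually_all _).2 fun t _ => ?_
      filter_upwards [Lp.coeFn_smul (L (Pi.single t 1)) (W (h t))] with ω hω
      rw [hω]
      rfl
    filter_upwards [h1, Lp.coeFn_finsetSum Finset.univ
      fun t : I => L (Pi.single t 1) • W (h t)] with ω h2 h3
    rw [map_sum]
    simp only [map_smul]
    rw [h3, Finset.sum_apply, Finset.sum_congr rfl h2, Function.comp_apply,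
      pi_eq_sum_univ' (I.restrict fun t => W (h t) ω), map_sum]
    simp [mul_comm]
  · have h1 := integral_map (hmeas t) (f := fun x : ℝ => x) aestronglyMeasurable_id
    rw [hWg, integral_id_gaussianReal] at h1
    exact h1.symm
  · rw [← hC, ← W.inner_map_map, L2.inner_def]
    congr 1 with ω
    simp [mul_comm]

namespace StableParticleSystem

variable {Ω : Type*} [MeasurableSpace Ω] {α : ℝ} {k : ℕ} {P : Measure Ω}
  (S : StableParticleSystem α k P) [IsProbabilityMeasure P]

/-- The fluctuations are linear in the window. They are given by integrals, so this needs the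
integrability of each window against the particles and holds almost surely. -/
lemma fluct_sum {κ : Type*} [Fintype κ] (c : κ → ℝ) (f : κ → windowSpace) {T : ℝ} (hT : 0 < T) :
    ∀ᵐ ω ∂P, ∑ t, c t * S.fluct T (f t) ω = S.fluct T (∑ t, c t • f t : windowSpace) ω := by
  have h1 : ∀ᵐ ω ∂P, ∀ t, Integrable (fun x => (f t : ℝ → ℝ) (x / T)) (S.N 1 ω) :=
    ae_all_iff.2 fun t => S.ae_integrable_window (f t).2.choose_spec hT
  have h2 : ∀ t, Integrable (S.pairing T (f t)) P := fun t =>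
    S.integrable_pairing (f t).2.choose_spec hT
  have h3 : ∀ᵐ ω ∂P, S.pairing T (∑ t, c t • f t : windowSpace) ω
      = ∑ t, c t * S.pairing T (f t) ω := by
    filter_upwards [h1] with ω hω
    simp only [pairing, ← integral_const_mul]
    rw [← integral_finsetSum _ fun t _ => (hω t).const_mul (c t)]
    congr 1 with x
    simp
  have h4 : ∫ ω, S.pairing T (∑ t, c t • f t : windowSpace) ω ∂P
      = ∑ t, c t * ∫ ω, S.pairing T (f t) ω ∂P := by
    rw [integral_congr_ae h3, integral_finsetSum _ fun t _ => (h2 t).const_mul (c t)]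
    simp only [integral_const_mul]
  filter_upwards [h3] with ω hω
  simp only [fluct]
  rw [hω, h4, ← Finset.sum_sub_distrib, Finset.sum_div]
  refine Finset.sum_congr rfl fun t _ => ?_
  ring

/-- Convergence of the finite-dimensional distributions for a window family. -/
theorem tendstoFiniteDimensional_window (hα₀ : 0 < α) (hα₁ : α < 1) (w : WindowFamily)
    {Ω' : Type*} [MeasurableSpace Ω'] {Q : Measure Ω'} [IsProbabilityMeasure Q]
    {X : ℝ≥0 → Ω' → ℝ} (hX : IsCenteredGaussianProcess X (w.cov ((1 - α) / 2)) Q) :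
    TendstoFiniteDimensional (fun T t ω => S.fluct T (w.ψ t) ω)
      (fun t ω => √(k / Real.pi * w.covConst α) * X t ω) P Q := by
  intro I
  have hK : 0 ≤ k / Real.pi * w.covConst α :=
    mul_nonneg (div_nonneg k.cast_nonneg Real.pi_pos.le) (w.covConst_pos hα₀ hα₁).le
  refine tendstoInDistribution_pi_of_integral_exp (fun T => aemeasurable_pi_lambda _ fun t =>
    (S.integrable_fluct (w.window t).2.choose_spec T.2).aestronglyMeasurable.aemeasurable)
    (aemeasurable_pi_lambda _ fun t => ((hX.gaussian.aemeasurable t).const_mul _)) fun c => ?_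
  have h1 : limitVar α k (∑ t : I, c t • w.window t : windowSpace)
      = ∑ s : I, ∑ t : I, (c s * √(k / Real.pi * w.covConst α))
        * (c t * √(k / Real.pi * w.covConst α)) * w.cov ((1 - α) / 2) s t := by
    rw [limitVar_eq_norm_spectralMap hα₀ hα₁, ← real_inner_self_eq_norm_sq, map_sum, sum_inner,
      Finset.mul_sum]
    refine Finset.sum_congr rfl fun s _ => ?_
    rw [inner_sum, Finset.mul_sum]
    refine Finset.sum_congr rfl fun t _ => ?_
    rw [map_smul, map_smul, real_inner_smul_left, real_inner_smul_right,
      w.inner_spectralMap_window hα₀ hα₁]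
    linear_combination (-c s * c t * w.cov ((1 - α) / 2) s t) * Real.mul_self_sqrt hK
  have h2 := hX.integral_exp_sum I fun t => c t * √(k / Real.pi * w.covConst α)
  rw [← h1] at h2
  simp only [mul_assoc] at h2
  rw [h2]
  have h3 := (S.tendsto_integral_exp_fluct hα₀ hα₁
    (∑ t : I, c t • w.window t : windowSpace).2.choose_spec).comp
    (tendsto_Ioi_atTop.1 (tendsto_id (α := Set.Ioi (0 : ℝ))))
  refine h3.congr fun T => integral_congr_ae ?_
  filter_upwards [S.fluct_sum c (fun t : I => w.window t) T.2] with ω hω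
  exact congrArg (fun x : ℝ => Complex.exp (Complex.I * x)) hω.symm

end StableParticleSystem

/-! ### Gaussian measures on a Hilbert space -/

/-- A Hilbert–Schmidt operator `Ψ` on `H` is the square root of the covariance of a Gaussian random
vector in `H`: the series `∑ W (Ψ b_i) b_i` converges almost surely. -/
theorem exists_gaussian_vector {H κ : Type*} [NormedAddCommGroup H] [InnerProductSpace ℝ H]
    [CompleteSpace H] [SecondCountableTopology H] [MeasurableSpace H] [BorelSpace H]
    (b : HilbertBasis κ ℝ H) {K : Type} [NormedAddCommGroup K] [InnerProductSpace ℝ K]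
    [CompleteSpace K] (Ψ : H →L[ℝ] K) (hΨ : Summable fun i => ‖Ψ (b i)‖ ^ 2) :
    ∃ (Ω : Type) (_ : MeasurableSpace Ω) (Q : Measure Ω) (_ : IsProbabilityMeasure Q) (G : Ω → H),
      AEMeasurable G Q ∧
      ∀ g, Q.map (fun ω => inner ℝ g (G ω)) = gaussianReal 0 (‖Ψ g‖₊ ^ 2) := by
  obtain ⟨Ω, _, Q, hQ, W, hW⟩ := exists_isonormal K
  have hcount : Countable κ := b.orthonormal.countable_of_separable
  have hsq : ∀ i, ∫⁻ ω, ENNReal.ofReal (W (Ψ (b i)) ω ^ 2) ∂Q = ENNReal.ofReal (‖Ψ (b i)‖ ^ 2) := by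
    intro i
    have h1 : Integrable (fun ω => W (Ψ (b i)) ω ^ 2) Q := (Lp.memLp (W (Ψ (b i)))).integrable_sq
    rw [← ofReal_integral_eq_lintegral_ofReal h1 (ae_of_all _ fun ω => sq_nonneg _),
      ← W.norm_map, ← real_inner_self_eq_norm_sq, L2.inner_def]
    congr 2 with ω
    simp [sq]
  have hae : ∀ᵐ ω ∂Q, Summable fun i => W (Ψ (b i)) ω ^ 2 := by
    have h1 : ∫⁻ ω, ∑' i, ENNReal.ofReal (W (Ψ (b i)) ω ^ 2) ∂Q ≠ ⊤ := by
      rw [lintegral_tsum fun i =>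
        ((Lp.aestronglyMeasurable _).aemeasurable.pow_const 2).ennreal_ofReal]
      simp only [hsq]
      rw [← ENNReal.ofReal_tsum_of_nonneg (fun i => sq_nonneg _) hΨ]
      exact ENNReal.ofReal_ne_top
    have h2 := ae_lt_top' (AEMeasurable.tsum fun i =>
      ((Lp.aestronglyMeasurable (W (Ψ (b i)))).aemeasurable.pow_const 2).ennreal_ofReal) h1
    filter_upwards [h2] with ω hω
    have h3 := ENNReal.summable_toReal hω.ne
    simpa [ENNReal.toReal_ofReal (sq_nonneg _)] using h3
  let G : Ω → H := fun ω => ∑' i, W (Ψ (b i)) ω • b i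
  have hG : ∀ᵐ ω ∂Q, HasSum (fun i => W (Ψ (b i)) ω • b i) (G ω) := by
    filter_upwards [hae] with ω hω
    have h1 := (b.orthonormal.orthogonalFamily.summable_iff_norm_sq_summable
      fun i => W (Ψ (b i)) ω).2 (by simpa using hω)
    exact (by simpa using h1 : Summable fun i => W (Ψ (b i)) ω • b i).hasSum
  have hGm : AEStronglyMeasurable G Q := by
    refine aestronglyMeasurable_of_tendsto_ae (atTop : Filter (Finset κ))
      (f := fun s ω => ∑ i ∈ s, W (Ψ (b i)) ω • b i) (fun s => ?_) hG
    exact Finset.aestronglyMeasurable_fun_sum s fun i _ =>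
      (Lp.aestronglyMeasurable _).smul_const _
  refine ⟨Ω, inferInstance, Q, hQ, G, hGm.aemeasurable, fun g => ?_⟩
  have hchar : ∀ g, ∫ ω, Complex.exp (Complex.I * (inner ℝ g (G ω) : ℝ)) ∂Q
      = ((Real.exp (-‖Ψ g‖ ^ 2 / 2) : ℝ) : ℂ) := by
    intro g
    -- the partial sums of the series are images under `W`
    have h1 : ∀ s : Finset κ, ∫ ω, Complex.exp (Complex.I *
        (∑ i ∈ s, inner ℝ (b i) g * W (Ψ (b i)) ω : ℝ)) ∂Q
        = ((Real.exp (-‖Ψ (∑ i ∈ s, inner ℝ (b i) g • b i)‖ ^ 2 / 2) : ℝ) : ℂ) := by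
      intro s
      rw [← hW]
      refine integral_congr_ae ?_
      have h2 : ∀ᵐ ω ∂Q, ∀ i ∈ s, (inner ℝ (b i) g • W (Ψ (b i))) ω
          = inner ℝ (b i) g * W (Ψ (b i)) ω := by
        refine (Finset.eventually_all _).2 fun i _ => ?_
        filter_upwards [Lp.coeFn_smul (inner ℝ (b i) g) (W (Ψ (b i)))] with ω hω
        rw [hω]
        rfl
      filter_upwards [h2, Lp.coeFn_finsetSum s fun i => inner ℝ (b i) g • W (Ψ (b i))] with ω h3 h4
      simp only [map_sum, map_smul]
      rw [h4, Finset.sum_apply, Finset.sum_congr rfl h3]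
    have h2 : HasSum (fun i => inner ℝ (b i) g • b i) g := by
      simpa [b.repr_apply_apply] using b.hasSum_repr g
    have h3 : Tendsto (fun s : Finset κ => ((Real.exp
        (-‖Ψ (∑ i ∈ s, inner ℝ (b i) g • b i)‖ ^ 2 / 2) : ℝ) : ℂ)) atTop
        (𝓝 ((Real.exp (-‖Ψ g‖ ^ 2 / 2) : ℝ) : ℂ)) := by
      have hc : Continuous fun x : H => ((Real.exp (-‖Ψ x‖ ^ 2 / 2) : ℝ) : ℂ) := by fun_prop
      exact (hc.tendsto g).comp h2
    have h4 : Tendsto (fun s : Finset κ => ∫ ω, Complex.exp (Complex.I *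
        (∑ i ∈ s, inner ℝ (b i) g * W (Ψ (b i)) ω : ℝ)) ∂Q) atTop
        (𝓝 (∫ ω, Complex.exp (Complex.I * (inner ℝ g (G ω) : ℝ)) ∂Q)) := by
      refine tendsto_integral_filter_of_dominated_convergence (fun _ => 1) (.of_forall fun s => ?_)
        (.of_forall fun s => ae_of_all _ fun ω => ?_) (integrable_const _) ?_
      · exact (integrable_exp_I_mul (Finset.aestronglyMeasurable_fun_sum s fun i _ =>
          (Lp.aestronglyMeasurable _).const_mul _)).aestronglyMeasurable
      · rw [mul_comm, Complex.norm_exp_ofReal_mul_I]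
      · filter_upwards [hG] with ω hω
        have h5 : HasSum (fun i => inner ℝ (b i) g * W (Ψ (b i)) ω) (inner ℝ g (G ω)) := by
          have := (innerSL ℝ g).hasSum hω
          refine this.congr_fun fun i => ?_
          simp [real_inner_comm, mul_comm]
        have hc : Continuous fun x : ℝ => Complex.exp (Complex.I * (x : ℂ)) := by fun_prop
        exact (hc.tendsto _).comp h5
    simp only [h1] at h4
    exact tendsto_nhds_unique h4 h3
  refine map_eq_gaussianReal_of_integral_exp (by fun_prop) _ fun u => ?_
  have h1 := hchar (u • g)
  rw [map_smul, norm_smul, mul_pow, Real.norm_eq_abs, sq_abs] at h1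
  simp only [real_inner_smul_left] at h1
  exact h1

/-! ### Modulations in `L²` -/

section Modulation

open scoped FourierTransform

variable {M : ℝ → ℂ} (hM : MemLp M 2 (volume : Measure ℝ))

lemma memLp_modulate (hM : MemLp M 2 (volume : Measure ℝ)) (y : ℝ) :
    MemLp (fun v : ℝ => Complex.exp ((2 * Real.pi * (y * v) : ℝ) * Complex.I) * M v) 2 := by
  refine hM.of_le ?_ (ae_of_all _ fun v => ?_)
  · exact (Continuous.aestronglyMeasurable (by fun_prop)).mul hM.aestronglyMeasurable
  · rw [norm_mul, Complex.norm_exp_ofReal_mul_I, one_mul]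

/-- The function `v ↦ exp (2 π i y v) M(v)` as an element of `L²`. -/
noncomputable def modulate (y : ℝ) : Lp ℂ 2 (volume : Measure ℝ) := (memLp_modulate hM y).toLp

lemma coeFn_modulate (y : ℝ) : modulate hM y =ᵐ[volume]
    fun v => Complex.exp ((2 * Real.pi * (y * v) : ℝ) * Complex.I) * M v :=
  (memLp_modulate hM y).coeFn_toLp

lemma norm_modulate (y : ℝ) : ‖modulate hM y‖ = ‖hM.toLp‖ := by
  rw [modulate, Lp.norm_toLp, Lp.norm_toLp]
  congr 1
  refine eLpNorm_congr_norm_ae (ae_of_all _ fun v => ?_)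
  rw [norm_mul, Complex.norm_exp_ofReal_mul_I, one_mul]

lemma integrable_conj_mul_Lp (hM : MemLp M 2 (volume : Measure ℝ))
    (g : Lp ℂ 2 (volume : Measure ℝ)) : Integrable fun v => starRingEnd ℂ (M v) * g v :=
  (hM.star).integrable_mul (Lp.memLp g)

lemma inner_modulate (y : ℝ) (g : Lp ℂ 2 (volume : Measure ℝ)) :
    inner ℝ (modulate hM y) g = (𝓕 (fun v => starRingEnd ℂ (M v) * g v) y).re := by
  have hi : Integrable fun v : ℝ => Complex.exp ((-2 * Real.pi * inner ℝ v y : ℝ) * Complex.I) •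
      (starRingEnd ℂ (M v) * g v) := by
    refine (integrable_conj_mul_Lp hM g).bdd_mul (c := 1)
      (Continuous.aestronglyMeasurable (by fun_prop)) (ae_of_all _ fun v => ?_)
    rw [Complex.norm_exp_ofReal_mul_I]
  rw [L2.inner_def, Real.fourier_eq']
  refine Eq.trans (integral_congr_ae ?_) (integral_re hi)
  filter_upwards [coeFn_modulate hM y] with v hv
  rw [hv, Complex.inner]
  change _ = Complex.re _
  rw [map_mul, ← Complex.exp_conj, smul_eq_mul, mul_assoc, mul_comm (g v), mul_assoc]
  congr 3
  simp [Complex.conj_ofNat]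
  ring

lemma continuous_fourier_of_integrable {F : ℝ → ℂ} (hF : Integrable F) : Continuous (𝓕 F) :=
  VectorFourier.fourierIntegral_continuous Real.continuous_fourierChar
    (L := innerₗ ℝ) (by exact continuous_inner) hF (𝕜 := ℝ) (E := ℂ)

lemma continuous_inner_modulate (g : Lp ℂ 2 (volume : Measure ℝ)) :
    Continuous fun y => inner ℝ (modulate hM y) g := by
  simp only [inner_modulate]
  exact Complex.continuous_re.comp (continuous_fourier_of_integrable (integrable_conj_mul_Lp hM g))

/-- The modulations of `M` depend continuously on the frequency if `v M(v)` is square integrable. -/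
lemma continuous_modulate (hM' : MemLp (fun v : ℝ => (v : ℂ) * M v) 2 (volume : Measure ℝ)) :
    Continuous (modulate hM) := by
  refine (LipschitzWith.of_dist_le' (K := 2 * Real.pi * ‖hM'.toLp _‖) fun y z => ?_).continuous
  rw [dist_eq_norm, Real.dist_eq, modulate, modulate, ← MemLp.toLp_sub, mul_right_comm]
  refine Lp.norm_le_mul_norm_of_ae_le_mul ?_
  filter_upwards [((memLp_modulate hM y).sub (memLp_modulate hM z)).coeFn_toLp, hM'.coeFn_toLp]
    with v h1 h2
  rw [h1, h2, Pi.sub_apply, ← sub_mul, norm_mul, norm_mul, Complex.norm_real, Real.norm_eq_abs,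
    ← mul_assoc _ |v|]
  refine mul_le_mul_of_nonneg_right ?_ (norm_nonneg _)
  rw [mul_comm _ Complex.I, mul_comm _ Complex.I]
  refine (norm_exp_I_mul_sub_exp_I_mul_le _ _).trans (le_of_eq ?_)
  rw [← mul_sub, ← sub_mul, abs_mul, abs_mul (y - z), abs_of_pos (by positivity)]
  ring

lemma hasDerivAt_inner_modulate
    (hM' : MemLp (fun v : ℝ => (2 * Real.pi * Complex.I * v) * M v) 2 (volume : Measure ℝ))
    (g : Lp ℂ 2 (volume : Measure ℝ)) (y : ℝ) :
    HasDerivAt (fun y => inner ℝ (modulate hM y) g) (inner ℝ (modulate hM' y) g) y := by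
  have h2 := integrable_conj_mul_Lp hM' g
  have he : ∀ v : ℝ, starRingEnd ℂ (2 * Real.pi * Complex.I * v * M v) * g v
      = (-2 * Real.pi * Complex.I * v) • (starRingEnd ℂ (M v) * g v) := fun v => by
    simp only [map_mul, Complex.conj_I, Complex.conj_ofReal, smul_eq_mul, map_ofNat]
    ring
  simp only [he] at h2
  have h3 : Integrable fun v : ℝ => v • (starRingEnd ℂ (M v) * g v) := by
    refine (h2.const_mul (-2 * Real.pi * Complex.I)⁻¹).congr (ae_of_all _ fun v => ?_)
    have : (-2 * Real.pi * Complex.I : ℂ) ≠ 0 := by simp [Real.pi_ne_zero]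
    simp only [smul_eq_mul, Complex.real_smul]
    rw [← mul_assoc, ← mul_assoc (_ : ℂ)⁻¹, inv_mul_cancel₀ this, one_mul]
  have h4 := Real.hasDerivAt_fourier (integrable_conj_mul_Lp hM g) h3 y
  simp only [inner_modulate, he]
  exact (Complex.reCLM.hasFDerivAt.comp_hasDerivAt y h4)

end Modulation

/-! ### Point evaluations as vectors of a Hilbert space -/

section EvalKernel

lemma memLp_two_of_sq_norm_le_inv {M : ℝ → ℂ} (hM : Measurable M)
    (h : ∀ v, ‖M v‖ ^ 2 ≤ (1 + v ^ 2)⁻¹) : MemLp M 2 (volume : Measure ℝ) := by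
  rw [memLp_two_iff_integrable_sq_norm hM.aestronglyMeasurable]
  refine integrable_inv_one_add_sq.mono' (by fun_prop) (ae_of_all _ fun v => ?_)
  rw [Real.norm_eq_abs, abs_of_nonneg (sq_nonneg _)]
  exact h v

lemma memLp_resolvent :
    MemLp (fun v : ℝ => (((1 + v ^ 2)⁻¹ : ℝ) : ℂ)) 2 (volume : Measure ℝ) := by
  refine memLp_two_of_sq_norm_le_inv (by fun_prop) fun v => ?_
  have h : (0 : ℝ) < 1 + v ^ 2 := by positivity
  rw [Complex.norm_real, Real.norm_eq_abs, sq_abs, sq]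
  exact mul_le_of_le_one_left (by positivity) (inv_le_one_of_one_le₀ (by nlinarith [sq_nonneg v]))

lemma memLp_mul_resolvent :
    MemLp (fun v : ℝ => (v : ℂ) * (((1 + v ^ 2)⁻¹ : ℝ) : ℂ)) 2 (volume : Measure ℝ) := by
  refine memLp_two_of_sq_norm_le_inv (by fun_prop) fun v => ?_
  have h : (0 : ℝ) < 1 + v ^ 2 := by positivity
  rw [norm_mul, Complex.norm_real, Complex.norm_real, Real.norm_eq_abs, Real.norm_eq_abs, mul_pow,
    sq_abs, sq_abs, sq (1 + v ^ 2)⁻¹, ← mul_assoc]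
  refine mul_le_of_le_one_left (by positivity) ?_
  rw [← div_eq_mul_inv, div_le_one h]
  linarith

lemma memLp_deriv_resolvent :
    MemLp (fun v : ℝ => (2 * Real.pi * Complex.I * v) * (((1 + v ^ 2)⁻¹ : ℝ) : ℂ)) 2
      (volume : Measure ℝ) := by
  simpa only [mul_assoc] using memLp_mul_resolvent.const_mul (2 * Real.pi * Complex.I)

/-- The vector of `L²(ℝ; ℂ)` representing the evaluation at `y`: the inner product of
`evalKernel y` with `v ↦ (1 + v²) (𝓕⁻¹ ((1 + x²) φ))(v)` is `φ y`. The weights make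
`evalKernel y` an element of `L²` that decays as `y → ±∞`. -/
noncomputable def evalKernel (y : ℝ) : Lp ℂ 2 (volume : Measure ℝ) :=
  (1 + y ^ 2)⁻¹ • modulate memLp_resolvent y

/-- The derivative of `evalKernel`. -/
noncomputable def evalKernelDeriv (y : ℝ) : Lp ℂ 2 (volume : Measure ℝ) :=
  (-(2 * y) / (1 + y ^ 2) ^ 2) • modulate memLp_resolvent y
    + (1 + y ^ 2)⁻¹ • modulate memLp_deriv_resolvent y

lemma hasDerivAt_inv_one_add_sq (y : ℝ) :
    HasDerivAt (fun y : ℝ => (1 + y ^ 2)⁻¹) (-(2 * y) / (1 + y ^ 2) ^ 2) y := by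
  have h := ((hasDerivAt_pow 2 y).const_add 1).fun_inv (by positivity)
  simpa using h

lemma hasDerivAt_inner_evalKernel (g : Lp ℂ 2 (volume : Measure ℝ)) (y : ℝ) :
    HasDerivAt (fun y => inner ℝ (evalKernel y) g) (inner ℝ (evalKernelDeriv y) g) y := by
  have h := (hasDerivAt_inv_one_add_sq y).fun_mul
    (hasDerivAt_inner_modulate memLp_resolvent memLp_deriv_resolvent g y)
  simpa only [evalKernel, evalKernelDeriv, inner_add_left, real_inner_smul_left] using h

lemma continuous_inner_evalKernelDeriv (g : Lp ℂ 2 (volume : Measure ℝ)) :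
    Continuous fun y => inner ℝ (evalKernelDeriv y) g := by
  have h1 := continuous_inner_modulate memLp_resolvent g
  have h2 := continuous_inner_modulate memLp_deriv_resolvent g
  simp only [evalKernelDeriv, inner_add_left, real_inner_smul_left]
  have h3 : Continuous fun y : ℝ => -(2 * y) / (1 + y ^ 2) ^ 2 :=
    Continuous.div (by fun_prop) (by fun_prop) fun y => by positivity
  have h4 : Continuous fun y : ℝ => (1 + y ^ 2)⁻¹ :=
    Continuous.inv₀ (by fun_prop) fun y => by positivity
  exact (h3.mul h1).add (h4.mul h2)

lemma continuous_evalKernel : Continuous evalKernel := by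
  have h4 : Continuous fun y : ℝ => (1 + y ^ 2)⁻¹ :=
    Continuous.inv₀ (by fun_prop) fun y => by positivity
  exact h4.smul (continuous_modulate memLp_resolvent memLp_mul_resolvent)

/-- A constant such that both `‖evalKernel y‖` and `‖evalKernelDeriv y‖` are at most
`kernelConst / (1 + y²)`. -/
noncomputable def kernelConst : ℝ := ‖memLp_resolvent.toLp‖ + ‖memLp_deriv_resolvent.toLp‖

lemma kernelConst_nonneg : 0 ≤ kernelConst := add_nonneg (norm_nonneg _) (norm_nonneg _)

lemma norm_evalKernel_le (y : ℝ) : ‖evalKernel y‖ ≤ kernelConst * (1 + y ^ 2)⁻¹ := by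
  have h : (0 : ℝ) < (1 + y ^ 2)⁻¹ := by positivity
  rw [evalKernel, norm_smul, norm_modulate, Real.norm_eq_abs, abs_of_pos h, mul_comm]
  exact mul_le_mul_of_nonneg_right (le_add_of_nonneg_right (norm_nonneg _)) h.le

lemma norm_evalKernelDeriv_le (y : ℝ) : ‖evalKernelDeriv y‖ ≤ kernelConst * (1 + y ^ 2)⁻¹ := by
  have h : (0 : ℝ) < 1 + y ^ 2 := by positivity
  have h1 : |-(2 * y) / (1 + y ^ 2) ^ 2| ≤ (1 + y ^ 2)⁻¹ := by
    rw [abs_div, abs_of_pos (pow_pos h 2), div_le_iff₀ (pow_pos h 2), sq (1 + y ^ 2),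
      inv_mul_cancel_left₀ h.ne', abs_neg, abs_le]
    constructor <;> nlinarith [sq_nonneg (y - 1), sq_nonneg (y + 1)]
  refine (norm_add_le _ _).trans ?_
  rw [norm_smul, norm_smul, norm_modulate, norm_modulate, Real.norm_eq_abs, Real.norm_eq_abs,
    abs_of_pos (inv_pos.2 h), kernelConst, add_mul, mul_comm _ (1 + y ^ 2)⁻¹,
    mul_comm _ (1 + y ^ 2)⁻¹]
  gcongr

/-! ### Trace class bounds -/

/-- A weighted Cauchy–Schwarz inequality. -/
lemma sq_integral_abs_le {F : ℝ → ℝ}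
    (hi : Integrable fun y => F y ^ 2 * (1 + y ^ 2)) :
    (∫ y, |F y|) ^ 2 ≤ Real.pi * ∫ y, F y ^ 2 * (1 + y ^ 2) := by
  set A := ∫ y, F y ^ 2 * (1 + y ^ 2)
  set a := ∫ y, |F y| with ha
  have hw := integrable_inv_one_add_sq
  have hA : 0 ≤ A := integral_nonneg fun y => by positivity
  have ha0 : 0 ≤ a := integral_nonneg fun y => abs_nonneg _
  rcases ha0.eq_or_lt with h0 | hpos
  · rw [← h0]
    simpa using mul_nonneg Real.pi_pos.le hA
  set l : ℝ := a / Real.pi with hl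
  have hl0 : 0 < l := div_pos hpos Real.pi_pos
  -- integrate `2 l |F| ≤ F² (1 + y²) + l² / (1 + y²)`
  have h1 : ∫ y, 2 * l * |F y| ≤ ∫ y, (F y ^ 2 * (1 + y ^ 2) + l ^ 2 * (1 + y ^ 2)⁻¹) := by
    refine integral_mono_of_nonneg (ae_of_all _ fun y => by positivity)
      (hi.add (hw.const_mul _)) (ae_of_all _ fun y => ?_)
    have h : (0 : ℝ) < 1 + y ^ 2 := by positivity
    have h2 : F y ^ 2 * (1 + y ^ 2) + l ^ 2 * (1 + y ^ 2)⁻¹ - 2 * l * |F y|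
        = (|F y| * (1 + y ^ 2) - l) ^ 2 * (1 + y ^ 2)⁻¹ := by
      rw [← sq_abs (F y)]
      field_simp
      ring
    have h3 : 0 ≤ (|F y| * (1 + y ^ 2) - l) ^ 2 * (1 + y ^ 2)⁻¹ := by positivity
    simp only
    linarith
  rw [integral_const_mul, integral_add hi (hw.const_mul _), integral_const_mul,
    integral_univ_inv_one_add_sq] at h1
  have h2 : l * Real.pi = a := div_mul_cancel₀ _ Real.pi_pos.ne'
  have h3 : l * a ≤ A := by
    have : l ^ 2 * Real.pi = l * a := by rw [sq, mul_assoc, h2]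
    rw [this] at h1
    linarith
  calc a ^ 2 = Real.pi * (l * a) := by rw [← mul_assoc, mul_comm Real.pi, h2, sq]
    _ ≤ _ := mul_le_mul_of_nonneg_left h3 Real.pi_pos.le

variable {H : Type*} [NormedAddCommGroup H] [InnerProductSpace ℝ H] {K : ℝ → H} {C : ℝ}

lemma integrable_inner_sq_mul (hK : ∀ g, Continuous fun y => inner ℝ (K y) g)
    (hC : ∀ y, ‖K y‖ ≤ C * (1 + y ^ 2)⁻¹) (g : H) :
    Integrable fun y => inner ℝ (K y) g ^ 2 * (1 + y ^ 2) := by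
  have := hK g
  refine (integrable_inv_one_add_sq.const_mul (C ^ 2 * ‖g‖ ^ 2)).mono'
    (Continuous.aestronglyMeasurable (by fun_prop)) (ae_of_all _ fun y => ?_)
  have h : (0 : ℝ) < 1 + y ^ 2 := by positivity
  rw [Real.norm_eq_abs, abs_of_nonneg (by positivity)]
  have h1 : |inner ℝ (K y) g| ≤ C * (1 + y ^ 2)⁻¹ * ‖g‖ :=
    (abs_real_inner_le_norm _ _).trans (mul_le_mul_of_nonneg_right (hC y) (norm_nonneg _))
  have h2 : inner ℝ (K y) g ^ 2 ≤ (C * (1 + y ^ 2)⁻¹ * ‖g‖) ^ 2 := by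
    rw [← sq_abs]
    exact pow_le_pow_left₀ (abs_nonneg _) h1 2
  calc inner ℝ (K y) g ^ 2 * (1 + y ^ 2) ≤ (C * (1 + y ^ 2)⁻¹ * ‖g‖) ^ 2 * (1 + y ^ 2) := by gcongr
    _ = _ := by field_simp

lemma integrable_inner_of_bound (hK : ∀ g, Continuous fun y => inner ℝ (K y) g)
    (hC : ∀ y, ‖K y‖ ≤ C * (1 + y ^ 2)⁻¹) (g : H) : Integrable fun y => inner ℝ (K y) g := by
  have := hK g
  refine (integrable_inv_one_add_sq.const_mul (C * ‖g‖)).mono' this.aestronglyMeasurable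
    (ae_of_all _ fun y => ?_)
  rw [mul_right_comm]
  exact (abs_real_inner_le_norm _ _).trans (mul_le_mul_of_nonneg_right (hC y) (norm_nonneg _))

lemma integral_abs_inner_le (hC : ∀ y, ‖K y‖ ≤ C * (1 + y ^ 2)⁻¹) (g : H) :
    ∫ y, |inner ℝ (K y) g| ≤ C * Real.pi * ‖g‖ := by
  have h : ∫ y, |inner ℝ (K y) g| ≤ ∫ y : ℝ, C * ‖g‖ * (1 + y ^ 2)⁻¹ := by
    refine integral_mono_of_nonneg (ae_of_all _ fun y => abs_nonneg _)
      (integrable_inv_one_add_sq.const_mul _) (ae_of_all _ fun y => ?_)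
    simp only
    rw [mul_right_comm]
    exact (abs_real_inner_le_norm _ _).trans (mul_le_mul_of_nonneg_right (hC y) (norm_nonneg _))
  rw [integral_const_mul, integral_univ_inv_one_add_sq] at h
  linarith

/-- For a kernel `K` with `‖K y‖ = O(1 / (1 + y²))` the map `g ↦ ⟨K ·, g⟩` from `H` to `L¹` has
square summable norms along every orthonormal basis. -/
lemma summable_sq_integral_abs_inner (hK : ∀ g, Continuous fun y => inner ℝ (K y) g)
    (hC : ∀ y, ‖K y‖ ≤ C * (1 + y ^ 2)⁻¹) {κ : Type*} {b : κ → H} (hb : Orthonormal ℝ b) :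
    Summable fun i => (∫ y, |inner ℝ (K y) (b i)|) ^ 2 := by
  refine summable_of_sum_le (c := Real.pi * (C ^ 2 * Real.pi)) (fun i => sq_nonneg _) fun s => ?_
  have hi := integrable_inner_sq_mul hK hC
  calc ∑ i ∈ s, (∫ y, |inner ℝ (K y) (b i)|) ^ 2
      ≤ ∑ i ∈ s, Real.pi * ∫ y, inner ℝ (K y) (b i) ^ 2 * (1 + y ^ 2) :=
        Finset.sum_le_sum fun i _ => sq_integral_abs_le (hi _)
    _ = Real.pi * ∫ y, ∑ i ∈ s, inner ℝ (K y) (b i) ^ 2 * (1 + y ^ 2) := by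
        rw [integral_finsetSum _ fun i _ => hi _, Finset.mul_sum]
    _ ≤ Real.pi * ∫ y : ℝ, C ^ 2 * (1 + y ^ 2)⁻¹ := by
        refine mul_le_mul_of_nonneg_left ?_ Real.pi_pos.le
        refine integral_mono_of_nonneg
          (ae_of_all _ fun y => Finset.sum_nonneg fun i _ => by positivity)
          (integrable_inv_one_add_sq.const_mul _) (ae_of_all _ fun y => ?_)
        have h : (0 : ℝ) < 1 + y ^ 2 := by positivity
        have h1 : ∑ i ∈ s, inner ℝ (K y) (b i) ^ 2 ≤ ‖K y‖ ^ 2 := by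
          have := hb.sum_inner_products_le (s := s) (K y)
          simpa [real_inner_comm] using this
        have h2 : ‖K y‖ ^ 2 ≤ (C * (1 + y ^ 2)⁻¹) ^ 2 := pow_le_pow_left₀ (norm_nonneg _) (hC y) 2
        simp only
        rw [← Finset.sum_mul]
        calc _ ≤ (C * (1 + y ^ 2)⁻¹) ^ 2 * (1 + y ^ 2) :=
              mul_le_mul_of_nonneg_right (h1.trans h2) h.le
          _ = _ := by field_simp
    _ = _ := by rw [integral_const_mul, integral_univ_inv_one_add_sq]

end EvalKernel

/-! ### Windows attached to the vectors of `L²` -/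

/-- The functions `y ↦ ⟨evalKernel y, g⟩` are integrable with an integrable derivative. -/
lemma isWindow_inner_evalKernel (g : Lp ℂ 2 (volume : Measure ℝ)) :
    IsWindow (fun y => inner ℝ (evalKernel y) g) (∫ y, |inner ℝ (evalKernelDeriv y) g|) := by
  refine IsWindow.of_weak_deriv
    (integrable_inner_of_bound (fun g => continuous_evalKernel.inner continuous_const)
      norm_evalKernel_le g)
    (integrable_inner_of_bound continuous_inner_evalKernelDeriv norm_evalKernelDeriv_le g)
    fun x y _ => ?_
  exact (intervalIntegral.integral_eq_sub_of_hasDerivAt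
    (fun u _ => hasDerivAt_inner_evalKernel g u)
    ((continuous_inner_evalKernelDeriv g).intervalIntegrable _ _)).symm

/-- The window `y ↦ ⟨evalKernel y, g⟩`, as a linear function of `g`. -/
noncomputable def kernelWindow : Lp ℂ 2 (volume : Measure ℝ) →ₗ[ℝ] windowSpace where
  toFun g := ⟨fun y => inner ℝ (evalKernel y) g, _, isWindow_inner_evalKernel g⟩
  map_add' g g' := by
    ext y
    exact inner_add_right _ _ _
  map_smul' c g := by
    ext y
    exact real_inner_smul_right _ _ _

lemma kernelWindow_apply (g : Lp ℂ 2 (volume : Measure ℝ)) (y : ℝ) :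
    (kernelWindow g : ℝ → ℝ) y = inner ℝ (evalKernel y) g := rfl

lemma kernelWindow_isWindow (g : Lp ℂ 2 (volume : Measure ℝ)) :
    IsWindow (kernelWindow g : ℝ → ℝ) (∫ y, |inner ℝ (evalKernelDeriv y) g|) :=
  isWindow_inner_evalKernel g

section

variable {α : ℝ} (hα₀ : 0 < α) (hα₁ : α < 1) (k : ℕ)

include hα₀ hα₁ in
/-- The limit variance of the window attached to `g` is dominated by the two `L¹` norms that control
the Fourier transform of the window. -/
lemma limitVar_kernelWindow_le (g : Lp ℂ 2 (volume : Measure ℝ)) :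
    limitVar α k (kernelWindow g) ≤ k / Real.pi * (((∫ y, |inner ℝ (evalKernel y) g|) ^ 2
      + (2 * ∫ y, |inner ℝ (evalKernelDeriv y) g|) ^ 2) * weightConst α) :=
  mul_le_mul_of_nonneg_left
    ((kernelWindow_isWindow g).integral_sq_norm_fourierHat_mul_rpow_le hα₀ hα₁)
    (div_nonneg k.cast_nonneg Real.pi_pos.le)

lemma sq_norm_sqrt_smul_spectralMap (f : windowSpace) :
    ‖√(k / Real.pi) • spectralMap hα₀ hα₁ f‖ ^ 2 = limitVar α k f := by
  rw [norm_smul, mul_pow, Real.norm_eq_abs, sq_abs, Real.sq_sqrt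
    (div_nonneg k.cast_nonneg Real.pi_pos.le), limitVar_eq_norm_spectralMap hα₀ hα₁]

/-- The square root of the covariance operator of the limit field, in the representation of
functions as vectors of `L²`. -/
noncomputable def limitRoot :
    Lp ℂ 2 (volume : Measure ℝ) →L[ℝ] Lp ℂ 2 (volume : Measure ℝ) :=
  LinearMap.mkContinuous (√(k / Real.pi) • (spectralMap hα₀ hα₁ ∘ₗ kernelWindow))
    (√(k / Real.pi * (5 * (kernelConst * Real.pi) ^ 2 * weightConst α))) fun g => by
    have h0 : 0 ≤ kernelConst * Real.pi := mul_nonneg kernelConst_nonneg Real.pi_pos.le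
    have hk : (0 : ℝ) ≤ k / Real.pi := div_nonneg k.cast_nonneg Real.pi_pos.le
    have hw := weightConst_nonneg α
    refine (sq_le_sq₀ (norm_nonneg _) (by positivity)).1 ?_
    rw [mul_pow, Real.sq_sqrt (by positivity)]
    refine (sq_norm_sqrt_smul_spectralMap hα₀ hα₁ k (kernelWindow g)).trans_le ?_
    refine (limitVar_kernelWindow_le hα₀ hα₁ k g).trans ?_
    have h1 := integral_abs_inner_le norm_evalKernel_le g
    have h2 := integral_abs_inner_le norm_evalKernelDeriv_le g
    have h1' := pow_le_pow_left₀ (integral_nonneg fun _ => abs_nonneg _) h1 2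
    have h2' := pow_le_pow_left₀ (integral_nonneg fun _ => abs_nonneg _) h2 2
    rw [mul_assoc]
    refine mul_le_mul_of_nonneg_left ?_ hk
    calc _ ≤ (5 * (kernelConst * Real.pi) ^ 2 * ‖g‖ ^ 2) * weightConst α := by
          refine mul_le_mul_of_nonneg_right ?_ hw
          rw [mul_pow 2]
          nlinarith
      _ = _ := by ring

lemma limitRoot_apply (g : Lp ℂ 2 (volume : Measure ℝ)) :
    limitRoot hα₀ hα₁ k g = √(k / Real.pi) • spectralMap hα₀ hα₁ (kernelWindow g) := rfl

lemma sq_norm_limitRoot (g : Lp ℂ 2 (volume : Measure ℝ)) :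
    ‖limitRoot hα₀ hα₁ k g‖ ^ 2 = limitVar α k (kernelWindow g) :=
  sq_norm_sqrt_smul_spectralMap hα₀ hα₁ k _

variable {κ : Type*} {b : κ → Lp ℂ 2 (volume : Measure ℝ)}

lemma summable_sq_integral_evalKernelDeriv (hb : Orthonormal ℝ b) :
    Summable fun i => (∫ y, |inner ℝ (evalKernelDeriv y) (b i)|) ^ 2 :=
  summable_sq_integral_abs_inner continuous_inner_evalKernelDeriv norm_evalKernelDeriv_le hb

include hα₀ hα₁ in
/-- `limitRoot` is a Hilbert–Schmidt operator. -/
lemma summable_limitVar_kernelWindow (hb : Orthonormal ℝ b) :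
    Summable fun i => limitVar α k (kernelWindow (b i)) := by
  refine Summable.of_nonneg_of_le (fun i => limitVar_nonneg _ _ _)
    (fun i => limitVar_kernelWindow_le hα₀ hα₁ k (b i)) ?_
  simp only [mul_pow]
  exact (((summable_sq_integral_abs_inner (fun g => continuous_evalKernel.inner continuous_const)
    norm_evalKernel_le hb).add ((summable_sq_integral_evalKernelDeriv hb).mul_left _)).mul_right
    _).mul_left _

end

/-! ### Schwartz functions as vectors of `L²` -/

section Schwartz

open scoped FourierTransform

/-- The continuous linear map `φ ↦ (1 + v²) (𝓕⁻¹ ((1 + x²) φ))(v)` from Schwartz functions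
to `L²`. -/
noncomputable def schwartzVector : 𝓢(ℝ, ℝ) →L[ℝ] Lp ℂ 2 (volume : Measure ℝ) :=
  (SchwartzMap.toLpCLM ℝ ℂ 2 volume).comp
    ((SchwartzMap.smulLeftCLM ℂ fun v : ℝ => (1 + v ^ 2 : ℝ)).comp
      ((FourierTransform.fourierCLE ℝ 𝓢(ℝ, ℂ)).symm.toContinuousLinearMap.comp
        ((SchwartzMap.smulLeftCLM ℂ fun x : ℝ => (1 + x ^ 2 : ℝ)).comp
          (SchwartzMap.postcompCLM Complex.ofRealCLM))))

/-- The vector `evalKernel y` evaluates at `y`, by Fourier inversion. -/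
lemma inner_evalKernel_schwartzVector (φ : 𝓢(ℝ, ℝ)) (y : ℝ) :
    inner ℝ (evalKernel y) (schwartzVector φ) = φ y := by
  have hg : (fun v : ℝ => (1 + v ^ 2 : ℝ)).HasTemperateGrowth := by fun_prop
  set u : 𝓢(ℝ, ℂ) := SchwartzMap.smulLeftCLM ℂ (fun x : ℝ => (1 + x ^ 2 : ℝ))
    (SchwartzMap.postcompCLM Complex.ofRealCLM φ) with hu
  have huy : u y = ((1 + y ^ 2 : ℝ) : ℂ) * φ y := by
    rw [hu, SchwartzMap.smulLeftCLM_apply hg]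
    simp
  have h1 : schwartzVector φ
      = (SchwartzMap.smulLeftCLM ℂ (fun v : ℝ => (1 + v ^ 2 : ℝ)) (𝓕⁻ u)).toLp 2 volume := rfl
  have h2 : (fun v : ℝ => starRingEnd ℂ (((1 + v ^ 2)⁻¹ : ℝ) : ℂ) * schwartzVector φ v)
      =ᵐ[volume] (𝓕⁻ u : 𝓢(ℝ, ℂ)) := by
    rw [h1]
    filter_upwards [(SchwartzMap.smulLeftCLM ℂ (fun v : ℝ => (1 + v ^ 2 : ℝ))
      (𝓕⁻ u)).coeFn_toLp 2 volume] with v hv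
    have h : (1 + v ^ 2 : ℝ) ≠ 0 := by positivity
    rw [hv, SchwartzMap.smulLeftCLM_apply hg, Complex.conj_ofReal]
    beta_reduce
    rw [Complex.real_smul, ← mul_assoc,
      ← Complex.ofReal_mul, inv_mul_cancel₀ h, Complex.ofReal_one, one_mul]
  have h3 : 𝓕 (fun v : ℝ => starRingEnd ℂ (((1 + v ^ 2)⁻¹ : ℝ) : ℂ) * schwartzVector φ v) y
      = u y := by
    calc _ = 𝓕 ((𝓕⁻ u : 𝓢(ℝ, ℂ)) : ℝ → ℂ) y := by
          rw [Real.fourier_eq', Real.fourier_eq']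
          refine integral_congr_ae (h2.mono fun v hv => ?_)
          simp only [hv]
      _ = u y := by
          rw [← SchwartzMap.fourier_coe, FourierTransform.fourier_fourierInv_eq]
  rw [evalKernel, real_inner_smul_left, inner_modulate, h3, huy, ← Complex.ofReal_mul,
    Complex.ofReal_re, inv_mul_cancel_left₀ (by positivity)]

/-- The window attached to the vector of a Schwartz function is that function. -/
lemma kernelWindow_schwartzVector (φ : 𝓢(ℝ, ℝ)) :
    (kernelWindow (schwartzVector φ) : ℝ → ℝ) = φ :=
  funext fun y => inner_evalKernel_schwartzVector φ y

end Schwartz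

/-! ### Moments of centered Gaussian variables -/

section GaussianMoments

variable {Ω : Type*} [MeasurableSpace Ω] {Q : Measure Ω} {Y : Ω → ℝ}
  {v : ℝ≥0}

lemma memLp_two_of_map_eq_gaussianReal (hY : AEMeasurable Y Q) (h : Q.map Y = gaussianReal 0 v) :
    MemLp Y 2 Q := by
  have h1 : MemLp (id : ℝ → ℝ) 2 (Q.map Y) := by
    rw [h]
    exact memLp_id_gaussianReal 2
  exact (memLp_map_measure_iff aestronglyMeasurable_id hY).1 h1

lemma integral_sq_of_map_eq_gaussianReal (hY : AEMeasurable Y Q)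
    (h : Q.map Y = gaussianReal 0 v) : ∫ ω, Y ω ^ 2 ∂Q = v := by
  have h1 := integral_map hY (f := fun x : ℝ => x ^ 2) (by fun_prop)
  have h2 := variance_of_integral_eq_zero (X := fun x : ℝ => x) (μ := gaussianReal 0 v)
    measurable_id.aemeasurable integral_id_gaussianReal
  rw [variance_fun_id_gaussianReal] at h2
  rw [← h1, h, h2]

lemma integral_exp_of_map_eq_gaussianReal (hY : AEMeasurable Y Q)
    (h : Q.map Y = gaussianReal 0 v) :
    ∫ ω, Complex.exp (Complex.I * Y ω) ∂Q = ((Real.exp (-v / 2) : ℝ) : ℂ) := by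
  have h1 := charFun_map_eq_integral hY (1 : ℝ)
  rw [h, charFun_gaussianReal] at h1
  simp only [RCLike.inner_apply, conj_trivial, mul_one] at h1
  rw [← h1]
  push_cast
  congr 1
  ring

end GaussianMoments

/-! ### The fluctuation field as a random vector -/

/-- The function dominating `evalKernel` is a window. -/
lemma isWindow_inv_one_add_sq : ∃ V, IsWindow (fun y : ℝ => (1 + y ^ 2)⁻¹) V := by
  have hc : Continuous fun y : ℝ => -(2 * y) / (1 + y ^ 2) ^ 2 :=
    Continuous.div (by fun_prop) (by fun_prop) fun y => by positivity
  have hi : Integrable fun y : ℝ => -(2 * y) / (1 + y ^ 2) ^ 2 := by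
    refine integrable_inv_one_add_sq.mono' hc.aestronglyMeasurable (ae_of_all _ fun y => ?_)
    have h : (0 : ℝ) < 1 + y ^ 2 := by positivity
    rw [Real.norm_eq_abs, abs_div, abs_of_pos (pow_pos h 2), div_le_iff₀ (pow_pos h 2),
      sq (1 + y ^ 2), inv_mul_cancel_left₀ h.ne', abs_neg, abs_le]
    constructor <;> nlinarith [sq_nonneg (y - 1), sq_nonneg (y + 1)]
  exact ⟨_, IsWindow.of_weak_deriv integrable_inv_one_add_sq hi fun x y _ =>
    (intervalIntegral.integral_eq_sub_of_hasDerivAt (fun u _ => hasDerivAt_inv_one_add_sq u)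
      (hc.intervalIntegrable _ _)).symm⟩

namespace StableParticleSystem

variable {Ω : Type*} [MeasurableSpace Ω] {α : ℝ} {k : ℕ} {P : Measure Ω}
  (S : StableParticleSystem α k P)

/-- The normalized fluctuation of `⟨N_1, evalKernel (· / T)⟩`, a random vector of `L²` that
represents the fluctuation field. -/
noncomputable def vectorFluct (T : ℝ) (ω : Ω) : Lp ℂ 2 (volume : Measure ℝ) :=
  (√(T ^ (1 - α)))⁻¹ • (∫ x, evalKernel (x / T) ∂(S.N 1 ω)
    - ∫ ω', ∫ x, evalKernel (x / T) ∂(S.N 1 ω') ∂P)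

variable [IsProbabilityMeasure P] {T : ℝ}

lemma ae_integrable_evalKernel (hT : 0 < T) :
    (∀ᵐ ω ∂P, Integrable (fun x => evalKernel (x / T)) (S.N 1 ω)) ∧
      Integrable (fun ω => ∫ x, evalKernel (x / T) ∂(S.N 1 ω)) P := by
  obtain ⟨V, hV⟩ := isWindow_inv_one_add_sq
  have h1 := (hV.const_mul kernelConst).comp_div hT
  have h2 : StronglyMeasurable fun x => evalKernel (x / T) :=
    (continuous_evalKernel.comp (by fun_prop)).stronglyMeasurable
  exact ⟨S.ae_integrable_N h2 h1 fun x => norm_evalKernel_le _,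
    S.integrable_integral_N h2 h1 fun x => norm_evalKernel_le _⟩

lemma aestronglyMeasurable_vectorFluct (hT : 0 < T) :
    AEStronglyMeasurable (S.vectorFluct T) P := by
  have h := ((S.ae_integrable_evalKernel hT).2.aestronglyMeasurable.sub
    (aestronglyMeasurable_const (b := ∫ ω', ∫ x, evalKernel (x / T) ∂(S.N 1 ω') ∂P))).const_smul
    (√(T ^ (1 - α)))⁻¹
  exact h

/-- The coordinates of the random vector are the fluctuations of the windows attached to them. -/
lemma inner_vectorFluct (hT : 0 < T) {ω : Ω}
    (hω : Integrable (fun x => evalKernel (x / T)) (S.N 1 ω)) (g : Lp ℂ 2 (volume : Measure ℝ)) :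
    inner ℝ g (S.vectorFluct T ω) = S.fluct T (kernelWindow g) ω := by
  obtain ⟨h1, h2⟩ := S.ae_integrable_evalKernel hT
  have h3 : ∀ ω, Integrable (fun x => evalKernel (x / T)) (S.N 1 ω) →
      inner ℝ g (∫ x, evalKernel (x / T) ∂(S.N 1 ω)) = S.pairing T (kernelWindow g) ω := by
    intro ω hω
    rw [← integral_inner hω]
    simp only [pairing, kernelWindow_apply, real_inner_comm g]
  have h4 : inner ℝ g (∫ ω, ∫ x, evalKernel (x / T) ∂(S.N 1 ω) ∂P)
      = ∫ ω, S.pairing T (kernelWindow g) ω ∂P := by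
    rw [← integral_inner h2]
    exact integral_congr_ae (h1.mono fun ω hω => h3 ω hω)
  rw [vectorFluct, real_inner_smul_right, inner_sub_right, h3 ω hω, h4, fluct, div_eq_inv_mul]

/-- Convergence in distribution of the fluctuation field in `L²`. -/
theorem tendstoInDistribution_vectorFluct [MeasurableSpace (Lp ℂ 2 (volume : Measure ℝ))]
    [BorelSpace (Lp ℂ 2 (volume : Measure ℝ))] (hα₀ : 0 < α) (hα₁ : α < 1) {Ω' : Type*}
    [MeasurableSpace Ω'] {Q : Measure Ω'} [IsProbabilityMeasure Q]
    {G : Ω' → Lp ℂ 2 (volume : Measure ℝ)} (hG : AEMeasurable G Q)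
    (hlaw : ∀ g, Q.map (fun ω => inner ℝ g (G ω))
      = gaussianReal 0 (‖limitRoot hα₀ hα₁ k g‖₊ ^ 2)) :
    TendstoInDistribution (fun (T : Set.Ioi (0 : ℝ)) => S.vectorFluct T) atTop G (fun _ => P)
      Q := by
  have : Fact ((2 : ENNReal) ≠ ⊤) := ⟨by norm_num⟩
  obtain ⟨w, b, -⟩ := exists_hilbertBasis ℝ (Lp ℂ 2 (volume : Measure ℝ))
  have hIoi : Tendsto (fun T : Set.Ioi (0 : ℝ) => (T : ℝ)) atTop atTop :=
    tendsto_Ioi_atTop.1 tendsto_id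
  have hm : ∀ g, AEMeasurable (fun ω => inner ℝ g (G ω)) Q := fun g => by fun_prop
  have hv : ∀ g, ((‖limitRoot hα₀ hα₁ k g‖₊ ^ 2 : ℝ≥0) : ℝ) = limitVar α k (kernelWindow g) :=
    fun g => sq_norm_limitRoot hα₀ hα₁ k g
  refine tendstoInDistribution_hilbert b
    (s := fun i => limitVar α k (kernelWindow (b i))
      + (4 * k + k ^ 2) * (∫ y, |inner ℝ (evalKernelDeriv y) (b i)|) ^ 2)
    (fun T => (S.aestronglyMeasurable_vectorFluct T.2).aemeasurable) hG (fun g => ?_)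
    (fun i => add_nonneg (limitVar_nonneg _ _ _) (by positivity))
    ((summable_limitVar_kernelWindow hα₀ hα₁ k b.orthonormal).add
      ((summable_sq_integral_evalKernelDeriv b.orthonormal).mul_left _)) ?_ fun i => ?_
  · rw [integral_exp_of_map_eq_gaussianReal (hm g) (hlaw g), hv]
    refine ((S.tendsto_integral_exp_fluct hα₀ hα₁ (kernelWindow_isWindow g)).comp hIoi).congr
      fun T => integral_congr_ae ?_
    filter_upwards [(S.ae_integrable_evalKernel T.2).1] with ω hω
    rw [S.inner_vectorFluct T.2 hω]
  · filter_upwards [hIoi.eventually_ge_atTop 1] with T hT i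
    refine le_trans (le_of_eq (lintegral_congr_ae ?_))
      (S.lintegral_fluct_sq_le hα₀ hα₁ (kernelWindow_isWindow (b i)) hT)
    filter_upwards [(S.ae_integrable_evalKernel T.2).1] with ω hω
    rw [S.inner_vectorFluct T.2 hω]
  · have h1 := (memLp_two_of_map_eq_gaussianReal (hm (b i)) (hlaw (b i))).integrable_sq
    rw [← ofReal_integral_eq_lintegral_ofReal h1 (ae_of_all _ fun _ => sq_nonneg _),
      integral_sq_of_map_eq_gaussianReal (hm (b i)) (hlaw (b i)), hv]
    exact ENNReal.ofReal_le_ofReal (le_add_of_nonneg_right (by positivity))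

end StableParticleSystem

/-! ### The limit field -/

/-- The tempered distribution represented by a vector of `L²`. -/
noncomputable def toTempered : Lp ℂ 2 (volume : Measure ℝ) →L[ℝ] RealTemperedDistribution :=
  (ContinuousLinearMap.precomp ℝ schwartzVector).comp (innerSL ℝ)

lemma toTempered_apply (g : Lp ℂ 2 (volume : Measure ℝ)) (φ : 𝓢(ℝ, ℝ)) :
    toTempered g φ = inner ℝ g (schwartzVector φ) := rfl

/-- The covariance integral is real, by the symmetry `x ↦ -x`, and equals the spectral inner
product. -/
lemma integral_fourierHat_mul_conj {α : ℝ} (hα₀ : 0 < α) (hα₁ : α < 1) (f g : windowSpace) :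
    ∫ x : ℝ, fourierHat f x * (starRingEnd ℂ) (fourierHat g x) * ((|x| ^ α : ℝ) : ℂ)
      = ((inner ℝ (spectralMap hα₀ hα₁ f) (spectralMap hα₀ hα₁ g) : ℝ) : ℂ) := by
  set F : ℝ → ℂ := fun x => fourierHat f x * (starRingEnd ℂ) (fourierHat g x) *
    ((|x| ^ α : ℝ) : ℂ) with hF
  have hi : Integrable F := by
    have h1 := (f.2.choose_spec.memLp_spectral hα₀ hα₁).integrable_mul
      (g.2.choose_spec.memLp_spectral hα₀ hα₁).star
    refine h1.congr (ae_of_all _ fun v => ?_)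
    have := conj_spectral_mul_spectral α g f v
    rw [mul_comm (starRingEnd ℂ (fourierHat g v))] at this
    rw [hF]
    simp only [← this]
    exact mul_comm _ _
  have hre : (∫ x, F x).re = inner ℝ (spectralMap hα₀ hα₁ f) (spectralMap hα₀ hα₁ g) := by
    rw [inner_spectralMap]
    refine (integral_re hi).symm.trans ?_
    congr 1 with v
    change (F v).re = _
    rw [hF]
    simp only [Complex.re_mul_ofReal]
    congr 1
    simp only [Complex.mul_re, Complex.conj_re, Complex.conj_im]
    ring
  have hconj : starRingEnd ℂ (∫ x, F x) = ∫ x, F x := by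
    rw [← integral_conj, ← integral_neg_eq_self F]
    congr 1 with v
    rw [hF]
    simp only [map_mul, fourierHat_neg, abs_neg, Complex.conj_ofReal, Complex.conj_conj]
  rw [← hre]
  exact (Complex.conj_eq_iff_re.1 hconj).symm

/-- The law of the limit field. -/
theorem isLimitFieldLaw_map {α : ℝ} (hα₀ : 0 < α) (hα₁ : α < 1) (k : ℕ)
    [MeasurableSpace (Lp ℂ 2 (volume : Measure ℝ))]
    [BorelSpace (Lp ℂ 2 (volume : Measure ℝ))] {Ω : Type*} [MeasurableSpace Ω] {Q : Measure Ω}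
    [IsProbabilityMeasure Q] {G : Ω → Lp ℂ 2 (volume : Measure ℝ)} (hG : AEMeasurable G Q)
    (hlaw : ∀ g, Q.map (fun ω => inner ℝ g (G ω))
      = gaussianReal 0 (‖limitRoot hα₀ hα₁ k g‖₊ ^ 2)) :
    IsLimitFieldLaw α k (Q.map fun ω => toTempered (G ω)) := by
  have : Fact ((2 : ENNReal) ≠ ⊤) := ⟨by norm_num⟩
  have hm : ∀ g, AEMeasurable (fun ω => inner ℝ g (G ω)) Q := fun g => by fun_prop
  have hJ : AEMeasurable (fun ω => toTempered (G ω)) Q :=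
    toTempered.continuous.measurable.comp_aemeasurable hG
  have hev : ∀ φ : 𝓢(ℝ, ℝ), Measurable fun L : RealTemperedDistribution => L φ := fun φ =>
    (continuous_eval_const φ).measurable
  have hap : ∀ (φ : 𝓢(ℝ, ℝ)) (ω : Ω),
      toTempered (G ω) φ = inner ℝ (schwartzVector φ) (G ω) := fun φ ω => by
    rw [toTempered_apply, real_inner_comm]
  have hL2 := fun g => memLp_two_of_map_eq_gaussianReal (hm g) (hlaw g)
  have hsq : ∀ g, ∫ ω, inner ℝ g (G ω) ^ 2 ∂Q = ‖limitRoot hα₀ hα₁ k g‖ ^ 2 := fun g =>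
    integral_sq_of_map_eq_gaussianReal (hm g) (hlaw g)
  -- the covariance, by polarization
  have hcov : ∀ g h, ∫ ω, inner ℝ g (G ω) * inner ℝ h (G ω) ∂Q
      = inner ℝ (limitRoot hα₀ hα₁ k g) (limitRoot hα₀ hα₁ k h) := by
    intro g h
    have h1 := hsq (g + h)
    have h2 : ∀ ω, inner ℝ (g + h) (G ω) ^ 2 = inner ℝ g (G ω) ^ 2 + inner ℝ h (G ω) ^ 2
        + 2 * (inner ℝ g (G ω) * inner ℝ h (G ω)) := fun ω => by
      rw [inner_add_left]; ring
    have hi : Integrable (fun ω => inner ℝ g (G ω) * inner ℝ h (G ω)) Q :=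
      (hL2 g).integrable_mul (hL2 h)
    have hi2 : Integrable (fun ω => inner ℝ g (G ω) ^ 2 + inner ℝ h (G ω) ^ 2) Q :=
      (hL2 g).integrable_sq.add (hL2 h).integrable_sq
    simp only [h2] at h1
    rw [integral_add hi2 (hi.const_mul 2),
      integral_add (hL2 g).integrable_sq (hL2 h).integrable_sq, integral_const_mul, hsq, hsq,
      map_add, norm_add_sq_real] at h1
    linarith
  refine ⟨fun φ => ⟨‖limitRoot hα₀ hα₁ k (schwartzVector φ)‖₊ ^ 2, ?_⟩, fun φ ψ => ?_⟩
  · rw [AEMeasurable.map_map_of_aemeasurable (hev φ).aemeasurable hJ, ← hlaw]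
    congr 1 with ω
    exact hap φ ω
  · rw [integral_map hJ (f := fun L : RealTemperedDistribution => L φ * L ψ)
      ((hev φ).mul (hev ψ)).aestronglyMeasurable]
    simp only [hap]
    rw [hcov, limitRoot_apply, limitRoot_apply, real_inner_smul_left, real_inner_smul_right,
      ← mul_assoc, Real.mul_self_sqrt (div_nonneg k.cast_nonneg Real.pi_pos.le)]
    have h1 := integral_fourierHat_mul_conj hα₀ hα₁ (kernelWindow (schwartzVector φ))
      (kernelWindow (schwartzVector ψ))
    rw [kernelWindow_schwartzVector, kernelWindow_schwartzVector] at h1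
    rw [h1]
    push_cast
    ring

/-! ### Convergence of the rescaled fluctuations -/

theorem theorem2p9 (α : ℝ) (hα₀ : 0 < α) (hα₁ : α < 1) (k : ℕ) :
    -- (a) convergence in law in the space of tempered distributions
    (∃ (ν : Measure RealTemperedDistribution) (_ : IsProbabilityMeasure ν),
      IsLimitFieldLaw α k ν ∧
      ∀ (Ω : Type*) [MeasurableSpace Ω] (P : Measure Ω) [IsProbabilityMeasure P]
        (S : StableParticleSystem α k P),
        (∀ (T : Set.Ioi (0 : ℝ)) (φ : 𝓢(ℝ, ℝ)), Integrable (S.pairing T φ) P) ∧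
        ∃ Z : Set.Ioi (0 : ℝ) → Ω → RealTemperedDistribution,
          (∀ T : Set.Ioi (0 : ℝ), ∀ᵐ ω ∂P, ∀ φ : 𝓢(ℝ, ℝ),
            Integrable (fun x : ℝ => φ (x / T)) (S.N 1 ω) ∧ Z T ω φ = S.fluct T φ ω) ∧
          TendstoInDistribution Z atTop (id : RealTemperedDistribution → RealTemperedDistribution)
            (fun _ => P) ν) ∧
    -- (b) finite-dimensional convergence for each of the three families of windows
    (∀ w : WindowFamily, ∃ K : ℝ, 0 ≤ K ∧ (0 < k → 0 < K) ∧
      (∃ (Ω' : Type) (_ : MeasurableSpace Ω') (Q : Measure Ω') (X : ℝ≥0 → Ω' → ℝ),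
        IsProbabilityMeasure Q ∧
          IsCenteredGaussianProcess X (w.cov ((1 - α) / 2)) Q) ∧
      ∀ (Ω : Type*) [MeasurableSpace Ω] (P : Measure Ω) [IsProbabilityMeasure P]
        (S : StableParticleSystem α k P),
        (∀ (T : Set.Ioi (0 : ℝ)) (t : ℝ≥0), Integrable (S.pairing T (w.ψ t)) P ∧
          ∀ᵐ ω ∂P, Integrable (fun x : ℝ => w.ψ t (x / T)) (S.N 1 ω)) ∧
        ∀ (Ω' : Type*) [MeasurableSpace Ω'] (Q : Measure Ω') [IsProbabilityMeasure Q]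
          (X : ℝ≥0 → Ω' → ℝ), IsCenteredGaussianProcess X (w.cov ((1 - α) / 2)) Q →
          TendstoFiniteDimensional (fun T t ω => S.fluct T (w.ψ t) ω)
            (fun t ω => K * X t ω) P Q) := by
  let mH : MeasurableSpace (Lp ℂ 2 (volume : Measure ℝ)) := borel _
  have hH : BorelSpace (Lp ℂ 2 (volume : Measure ℝ)) := ⟨rfl⟩
  have : Fact ((2 : ENNReal) ≠ ⊤) := ⟨by norm_num⟩
  refine ⟨?_, fun w => ?_⟩
  · -- the limit field is the image under `toTempered` of a Gaussian vector of `L²`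
    obtain ⟨ι, b, -⟩ := exists_hilbertBasis ℝ (Lp ℂ 2 (volume : Measure ℝ))
    have hsum : Summable fun i => ‖limitRoot hα₀ hα₁ k (b i)‖ ^ 2 := by
      simp only [sq_norm_limitRoot]
      exact summable_limitVar_kernelWindow hα₀ hα₁ k b.orthonormal
    obtain ⟨Ω', _, Q, hQ, G, hG, hlaw⟩ := exists_gaussian_vector b (limitRoot hα₀ hα₁ k) hsum
    have hJ : AEMeasurable (fun ω => toTempered (G ω)) Q :=
      toTempered.continuous.measurable.comp_aemeasurable hG
    have hν : IsProbabilityMeasure (Q.map fun ω => toTempered (G ω)) :=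
      Measure.isProbabilityMeasure_map hJ
    refine ⟨Q.map fun ω => toTempered (G ω), hν, isLimitFieldLaw_map hα₀ hα₁ k hG hlaw, ?_⟩
    intro Ω _ P _ S
    refine ⟨fun T φ => ?_, fun T ω => toTempered (S.vectorFluct T ω), fun T => ?_, ?_⟩
    · rw [← kernelWindow_schwartzVector φ]
      exact S.integrable_pairing (kernelWindow_isWindow (schwartzVector φ)) T.2
    · filter_upwards [(S.ae_integrable_evalKernel T.2).1] with ω hω φ
      refine ⟨?_, ?_⟩
      · refine (hω.inner_const (𝕜 := ℝ) (schwartzVector φ)).congr (ae_of_all _ fun x => ?_)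
        exact inner_evalKernel_schwartzVector φ (x / T)
      · rw [toTempered_apply, real_inner_comm, S.inner_vectorFluct T.2 hω,
          kernelWindow_schwartzVector]
    · have h1 := (S.tendstoInDistribution_vectorFluct hα₀ hα₁ hG hlaw).continuous_comp
        toTempered.continuous
      refine ⟨h1.forall_aemeasurable, aemeasurable_id, ?_⟩
      have h2 := h1.tendsto
      convert! h2 using 2
      exact congrArg 𝓝 (Subtype.ext Measure.map_id)
  · have hc := w.covConst_pos hα₀ hα₁
    have hpi := Real.pi_pos
    -- `covConst` turns the covariance of `w` into the spectral inner product of the windows, and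
    -- `k / π` turns the latter into the limit covariance
    refine ⟨√(k / Real.pi * w.covConst α), Real.sqrt_nonneg _, fun hk => ?_, ?_, ?_⟩
    · have : (0 : ℝ) < k := by exact_mod_cast hk
      positivity
    · refine exists_isCenteredGaussianProcess
        (fun t => (√(w.covConst α))⁻¹ • spectralMap hα₀ hα₁ (w.window t)) fun s t => ?_
      rw [real_inner_smul_left, real_inner_smul_right, w.inner_spectralMap_window hα₀ hα₁,
        ← mul_assoc, ← mul_inv, Real.mul_self_sqrt hc.le, inv_mul_cancel_left₀ hc.ne']
    · intro Ω _ P _ S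
      refine ⟨fun T t => ⟨S.integrable_pairing (w.window t).2.choose_spec T.2,
        S.ae_integrable_window (w.window t).2.choose_spec T.2⟩, ?_⟩
      intro Ω' _ Q _ X hX
      exact S.tendstoFiniteDimensional_window hα₀ hα₁ w hX
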